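/- **Setting.** Let $X$ be a simplicial complete toric surface over $\mathbb C$ whose fan has rays with primitive generators $v_1,\dots,v_m\in\mathbb Z^2$, let $S_X=\mathbb C[z_1,\dots,z_m]$ be its homogeneous coordinate ring, graded by $Cl(X)$ with $\deg z_i=[\mathcal D_i]$, let $I_Z=\langle\prod_{i\notin\sigma(1)}z_i\rangle_{\sigma}$ be the irrelevant ideal and $Z\subset\mathbb C^m$ its zero set, so that $X=(\mathbb C^m\setminus Z)/G$ with $G=\mathrm{Hom}(Cl(X),\mathbb C^*)$. For a polynomial 1-form $\alpha=\sum_iA_i\,dz_i$ on an affine space with coordinate ring $S$, put $J(\alpha)=\langle A_i\rangle_i$ and $K(\alpha)=\mathrm{ann}(\overline{d\alpha})+J(\alpha)$, where $\overline{d\alpha}$ is the class of $d\alpha$ in $\Omega^2_{S}\otimes_SS/J(\alpha)$ ($\Omega^2_S$ the Kähler 2-forms). Let $\mathcal D\in Cl(X)$ and let $\alpha=\sum_{i=1}^mA_i\,dz_i$ be an integrable twisted 1-form of degree $\mathcal D$ on $X$: each $A_i\in S_X$ is homogeneous of degree $\mathcal D-[\mathcal D_i]$, $\sum_ia_iz_iA_i=0$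 for every integral relation $\sum_ia_iv_i=0$, and $\alpha\wedge d\alpha=0$. Let $n\ge m$, let $e_1v_1+\dots+e_mv_m=0$ be a relation with $e_i\in\mathbb N$, and let $F=(F_1,\dots,F_m)$ be homogeneous polynomials in $S_{\mathbb P^n}=\mathbb C[x_0,\dots,x_n]$ with $\deg F_i=e_i$, that is, a polynomial lifting of a rational map $\mathbb P^n\dashrightarrow X$. Let $F^*:S_X\to S_{\mathbb P^n}$, $z_i\mapsto F_i$, and $\omega=F^*(\alpha)=\sum_iA_i(F)\,dF_i$. Let $C(F)\subset\mathbb P^n$ be the set of critical points of $F$: the points $x$ at which the columns of the Jacobian matrix of $F$, together with the vectors $(a_iF_i(x))_i$ for all relations $\sum_ia_iv_i=0$, do not span $\mathbb C^m$. (If $F(x)\notin Z$ this means that $\mathbb P^n\dashrightarrow(\mathbb C^m\setminus Z)/G$ is not submersive at $x$.) The pair $(F,\alpha)$ is called almost generic if 1. $A_1,\dots,A_m$ do not all vanish at $F(x)$, for every $x\in C(F)$ with $F(x)\notin Z$ (no critical value of $F$ in $X$ is a singular point of $\alpha$), and the subscheme $Sing(\omega)\subset\mathbb P^n$ defined by $J(\omega)$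 is reduced at every point of $C(F)$; 2. the ideal $(J(\alpha):I_Z^\infty)$ is radical and has codimension $\ge2$; 3. $(K(\alpha):I_Z^\infty)=(J(\alpha):I_Z^\infty)$. **Proposition.** If $(F,\alpha)$ is almost generic and the ring homomorphism $F^*:S_X\to S_{\mathbb P^n}$ is flat, then $$K(F^*\alpha)=F^*(K(\alpha)),$$ an equality of ideals of $S_{\mathbb P^n}$, where $F^*(K(\alpha))$ denotes the ideal generated by the image of $K(\alpha)$. -/

import Mathlib

namespace ToricKupka

/-- A simplicial complete fan in `ℝ^q` with respect to the lattice `ℤ^q`, having exactly `m` rays.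
The primitive generators of the rays are `v 0, …, v (m-1)`, and a cone is recorded by the finite
set of (the indices of) its rays. -/
structure CompleteSimplicialFan (q m : ℕ) where
  /-- the ray generators -/
  v : Fin m → Fin q → ℤ
  /-- the cones, each given by the set of its rays -/
  cones : Set (Finset (Fin m))
  primitive : ∀ i, ∀ (k : ℤ) (w : Fin q → ℤ), v i = k • w → IsUnit k
  ray_mem : ∀ i, {i} ∈ cones
  face_mem : ∀ σ ∈ cones, ∀ τ, τ ⊆ σ → τ ∈ cones
  simplicial : ∀ σ ∈ cones,
    LinearIndependent ℝ (fun i : σ => fun j : Fin q => (v i j : ℝ))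
  /-- two cones meet exactly in the cone spanned by their common rays -/
  inter : ∀ σ ∈ cones, ∀ τ ∈ cones, ∀ c d : Fin m → ℝ,
    (∀ i, 0 ≤ c i) → (∀ i ∉ σ, c i = 0) → (∀ i, 0 ≤ d i) → (∀ i ∉ τ, d i = 0) →
    (∀ j, ∑ i, c i * (v i j : ℝ) = ∑ i, d i * (v i j : ℝ)) →
    ∃ e : Fin m → ℝ, (∀ i, 0 ≤ e i) ∧ (∀ i ∉ σ ∩ τ, e i = 0) ∧
      ∀ j, ∑ i, c i * (v i j : ℝ) = ∑ i, e i * (v i j : ℝ)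
  /-- the cones cover `ℝ^q` -/
  complete : ∀ y : Fin q → ℝ, ∃ σ ∈ cones, ∃ c : Fin m → ℝ,
    (∀ i, 0 ≤ c i) ∧ (∀ i ∉ σ, c i = 0) ∧ ∀ j, y j = ∑ i, c i * (v i j : ℝ)

namespace CompleteSimplicialFan

variable {q m : ℕ} (X : CompleteSimplicialFan q m)

/-- The map `ℤ^q → ℤ^m`, `u ↦ (⟨u, v_i⟩)_i`, sending a character of the torus to its divisor. -/
def divisorOfCharacter : (Fin q → ℤ) →+ (Fin m → ℤ) where
  toFun u i := ∑ j, u j * X.v i j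
  map_zero' := by ext i; simp
  map_add' u w := by ext i; simp [add_mul, Finset.sum_add_distrib]

/-- The Weil divisor class group of the toric variety of the fan: torus invariant divisors
`ℤ^m` modulo the divisors of characters. -/
abbrev Cl : Type := (Fin m → ℤ) ⧸ X.divisorOfCharacter.range

/-- The class of the torus invariant divisor `∑ b_i D_i`. -/
def cls (b : Fin m → ℤ) : X.Cl := QuotientAddGroup.mk b

/-- Homogeneity in the homogeneous coordinate ring `S = ℂ[z_1, …, z_m]`, where
`deg z_i = [D_i]`. -/
def IsHomogeneous (f : MvPolynomial (Fin m) ℂ) (D : X.Cl) : Prop :=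
  ∀ b ∈ f.support, X.cls (fun i => (b i : ℤ)) = D

/-- An integral relation `∑ a_i v_i = 0` among the ray generators. -/
def IsRelation (a : Fin m → ℤ) : Prop := ∑ i, a i • X.v i = 0

/-- The irrelevant ideal of `S`, generated by the products of all `z_i`, `i ∉ σ(1)`, for the
cones `σ` of the fan. -/
noncomputable def irrelevantIdeal : Ideal (MvPolynomial (Fin m) ℂ) :=
  Ideal.span {f | ∃ σ ∈ X.cones, f = ∏ i ∈ σᶜ, MvPolynomial.X i}

/-- The irrelevant locus `Z ⊆ ℂ^m`; the toric variety is the quotient `(ℂ^m ∖ Z) / G`. -/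
def irrelevantLocus : Set (Fin m → ℂ) :=
  {z | ∀ f ∈ X.irrelevantIdeal, MvPolynomial.eval z f = 0}

end CompleteSimplicialFan

/-- Polynomial differential 1-forms `∑ A_i dz_i` on affine space, given by their coefficients. -/
abbrev OneForm (ι : Type) : Type := ι → MvPolynomial ι ℂ

namespace OneForm

variable {ι : Type}

/-- The coefficient of `dz_i ∧ dz_j` in the exterior derivative of `∑ A_i dz_i`. -/
noncomputable def d (A : OneForm ι) (i j : ι) : MvPolynomial ι ℂ :=
  MvPolynomial.pderiv i (A j) - MvPolynomial.pderiv j (A i)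

/-- The singular ideal `J(α)`, generated by the coefficients of `α`. -/
noncomputable def singularIdeal (A : OneForm ι) : Ideal (MvPolynomial ι ℂ) :=
  Ideal.span (Set.range A)

/-- The Kupka ideal `K(α) = ann(dα mod J(α)) + J(α)`, where `dα mod J(α)` is the class of `dα` in
`Ω² ⊗ S/J(α)`. As `Ω²` is free on the `dz_i ∧ dz_j`, this class is the family of the classes
of the coefficients of `dα`. -/
noncomputable def kupkaIdeal (A : OneForm ι) : Ideal (MvPolynomial ι ℂ) :=
  Ideal.torsionOf (MvPolynomial ι ℂ) (ι → ι → MvPolynomial ι ℂ ⧸ A.singularIdeal)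
      (fun i j => Ideal.Quotient.mk A.singularIdeal (A.d i j)) ⊔ A.singularIdeal

/-- The integrability condition `α ∧ dα = 0`, written in coefficients. -/
def IsIntegrable (A : OneForm ι) : Prop :=
  ∀ i j k, A i * A.d j k - A j * A.d i k + A k * A.d i j = 0

end OneForm

/-- The ring homomorphism `F^* : ℂ[z_1, …, z_m] → ℂ[x_0, …, x_n]`, `f ↦ f(F_1, …, F_m)`. -/
noncomputable def pullback {m n : ℕ} (F : Fin m → MvPolynomial (Fin (n + 1)) ℂ) :
    MvPolynomial (Fin m) ℂ →+* MvPolynomial (Fin (n + 1)) ℂ :=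
  (MvPolynomial.aeval F).toRingHom

/-- The pullback `F^*(α) = ∑ A_i(F) dF_i` of a 1-form. -/
noncomputable def pullbackForm {m n : ℕ} (F : Fin m → MvPolynomial (Fin (n + 1)) ℂ)
    (A : OneForm (Fin m)) : OneForm (Fin (n + 1)) :=
  fun k => ∑ i, pullback F (A i) * MvPolynomial.pderiv k (F i)

/-- The saturation `(J : I^∞) = ⋃_d (J : I^d)`. The union is increasing, so it is the supremum. -/
noncomputable def saturation {R : Type} [CommRing R] (J I : Ideal R) : Ideal R :=
  ⨆ d : ℕ, J.colon ((I ^ d : Ideal R) : Set R)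

/-- `α = ∑ A_i dz_i` is a twisted Zariski 1-form on `X` of degree `D` which is integrable:
`A_i` is homogeneous of degree `D - [D_i]`, the contractions of `α` with all radial vector fields
`∑ a_i z_i ∂/∂z_i` (for the relations `a` among the rays) vanish, and `α ∧ dα = 0`. -/
structure IsFoliationForm {q m : ℕ} (X : CompleteSimplicialFan q m) (D : X.Cl)
    (A : OneForm (Fin m)) : Prop where
  homogeneous : ∀ i, X.IsHomogeneous (A i) (D - X.cls (Pi.single i 1))
  descent : ∀ a, X.IsRelation a → ∑ i, MvPolynomial.C (a i : ℂ) * MvPolynomial.X i * A i = 0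
  integrable : A.IsIntegrable

/-- `F = (F_1, …, F_m)` is a polynomial lifting of degree `e` of a rational map from `ℙ^n` to the
toric variety of `X`: `e` is a relation among the rays and `F_i` is homogeneous of degree
`e_i`. -/
structure IsLifting {q m n : ℕ} (X : CompleteSimplicialFan q m) (e : Fin m → ℕ)
    (F : Fin m → MvPolynomial (Fin (n + 1)) ℂ) : Prop where
  relation : X.IsRelation (fun i => (e i : ℤ))
  homogeneous : ∀ i, (F i).IsHomogeneous (e i)

/-- The point of `ℙ^n` with homogeneous coordinates `x` is a critical point of `F`: the image of the
Jacobian matrix of `F` at `x` and the values at `F(x)` of the radial vector fields do not span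
`ℂ^m`. The radial vector fields at `z` span the tangent space of the `G`-orbit of `z`, so for
`F(x) ∉ Z` this says that the induced map from `ℙ^n` to `(ℂ^m ∖ Z) / G` is not submersive at `x`. -/
def IsCriticalPoint {q m n : ℕ} (X : CompleteSimplicialFan q m)
    (F : Fin m → MvPolynomial (Fin (n + 1)) ℂ) (x : Fin (n + 1) → ℂ) : Prop :=
  Submodule.span ℂ
      (Set.range (fun k : Fin (n + 1) => fun i : Fin m =>
          MvPolynomial.eval x (MvPolynomial.pderiv k (F i))) ∪
        {w | ∃ a, X.IsRelation a ∧ w = fun i => (a i : ℂ) * MvPolynomial.eval x (F i)}) ≠ ⊤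

/-- The maximal ideal of the point `x` of affine space. -/
noncomputable def pointIdeal {n : ℕ} (x : Fin (n + 1) → ℂ) :
    Ideal (MvPolynomial (Fin (n + 1)) ℂ) :=
  RingHom.ker (MvPolynomial.eval x)

instance {n : ℕ} (x : Fin (n + 1) → ℂ) : (pointIdeal x).IsPrime :=
  RingHom.ker_isPrime (MvPolynomial.eval x)

/-- The closed subscheme of `ℙ^n` defined by the homogeneous ideal `J` is reduced at the point with
homogeneous coordinates `x ≠ 0`: the ideal generated by `J` in the local ring of `ℂ^(n+1)` at `x`
is radical. (Outside its vertex the affine cone is a `ℂ^*`-bundle over the projective scheme,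
so its local ring at `x` is reduced exactly when the one of the projective scheme is.) -/
def IsReducedAt {n : ℕ} (J : Ideal (MvPolynomial (Fin (n + 1)) ℂ)) (x : Fin (n + 1) → ℂ) : Prop :=
  (J.map (algebraMap (MvPolynomial (Fin (n + 1)) ℂ)
    (Localization.AtPrime (pointIdeal x)))).IsRadical

/-- Almost generic pairs `(F, α)`. -/
structure IsAlmostGeneric {q m n : ℕ} (X : CompleteSimplicialFan q m)
    (F : Fin m → MvPolynomial (Fin (n + 1)) ℂ) (A : OneForm (Fin m)) : Prop where
  /-- no critical value of `F` in the toric variety is a singular point of `α` -/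
  criticalValues : ∀ x : Fin (n + 1) → ℂ, x ≠ 0 → IsCriticalPoint X F x →
    (fun i => MvPolynomial.eval x (F i)) ∉ X.irrelevantLocus →
    ∃ i, MvPolynomial.eval (fun j => MvPolynomial.eval x (F j)) (A i) ≠ 0
  /-- the singular scheme of `ω = F^*(α)` is reduced along the critical points of `F` -/
  reduced : ∀ x : Fin (n + 1) → ℂ, x ≠ 0 → IsCriticalPoint X F x →
    IsReducedAt (pullbackForm F A).singularIdeal x
  radical : (saturation A.singularIdeal X.irrelevantIdeal).IsRadical
  codim : 2 ≤ (saturation A.singularIdeal X.irrelevantIdeal).height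
  kupka : saturation A.kupkaIdeal X.irrelevantIdeal = saturation A.singularIdeal X.irrelevantIdeal

end ToricKupka

namespace ToricKupka

/-! Write J = J(α), ω = F^*α, and J^e, K^e for the ideals generated by the images of J and K(α)
under F^*. Always J(ω) ⊆ J^e, and integrability gives J^e · dω ⊆ J(ω). At a noncritical point the
Jacobian columns and the radial fields span, so that locally J(ω) = J^e and dω determines F^*(dα)
modulo J^e (`exists_eval_eq_one_of_not_critical`). The work is to control the critical points.

K(ω) ⊆ K^e. By flatness, K^e is the conductor of the coefficients of F^*(dα) into J^e
(`mem_map_colon_of_flat`), so the claim is that h · F^*(dα) has coefficients in J^e for h ∈ K(ω). On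
a toric surface the syzygies of the coefficients of α are the sum of a line, spanned by a vector
field tangent to the foliation, and a copy of the relations among the rays. This survives flat
pullback, so the syzygy module is projective (`IsRowSystem.projective_ker`), and then all
obstructions to membership in J^e live at primes P of height at most two
(`exists_prime_height_le_two`). Such a P does not consist of critical points
(`exists_not_critical`): otherwise the Jacobian minors would vanish on the zeros of J(ω) near a
general point of P, so by reducedness they would lie in J(ω) and in the ideal of the fibre of F. But
in characteristic zero the Jacobian determinant of an isolated complete intersection is never in its
ideal (`jacobian_not_mem`). At a noncritical zero of P the claim holds.

K^e ⊆ K(ω). For g ∈ K(α) each coefficient y of F^*g · dω lies in J^e and satisfies y² ∈ J(ω). Hence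
y ∈ J(ω) locally at noncritical points, and by reducedness at critical points x ≠ 0. Only the vertex
x = 0 of the affine cone escapes. If it is critical, a global identity g dα = β ∧ α with polynomial
β is proved instead (`exists_eq_wedge_of_mem_kupkaIdeal`), and it pulls back. Its only obstructions
are the ideals (z_i, z_j) of two opposite rays. From the critical vertex the Eagon–Northcott bound
produces a nonzero critical point with F_i = F_j = 0, where reducedness excludes the obstruction
(`not_le_span_X_pair_of_critical_zero`). -/

theorem det_mul_eq_adjugate_mulVec {R ι : Type} [CommRing R] [Fintype ι] [DecidableEq ι]
    (N : Matrix ι ι R) (v : ι → R) (i : ι) :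
    N.det * v i = N.adjugate.mulVec (N.mulVec v) i := by
  rw [Matrix.mulVec_mulVec, Matrix.adjugate_mul, Matrix.smul_mulVec, Matrix.one_mulVec]
  rfl

/-! ### Residues and Jacobian determinants. -/

section Residue

open MvPolynomial

variable {σ : Type} [Fintype σ] [DecidableEq σ]

theorem coeff_eq_zero_of_mem_span_X_pow {B : Type} [CommRing B] {c : ℕ} (t : Set σ)
    {f : MvPolynomial σ B} (hf : f ∈ Ideal.span ((fun k => X k ^ c) '' t))
    {e : σ →₀ ℕ} (he : ∀ k ∈ t, e k < c) : coeff e f = 0 := by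
  induction hf using Submodule.span_induction with
  | mem x hx =>
    obtain ⟨k, hk, rfl⟩ := hx
    rw [coeff_X_pow, if_neg]
    rintro rfl
    simpa using he k hk
  | zero => simp
  | add x y _ _ hx hy => simp [hx, hy]
  | smul a x hx _ =>
    clear * - hx he
    induction hx using Submodule.span_induction generalizing a with
    | mem x hx =>
      obtain ⟨k, hk, rfl⟩ := hx
      have h1 : (X k ^ c : MvPolynomial σ B) = monomial (Finsupp.single k c) 1 :=
        X_pow_eq_monomial
      simp only [smul_eq_mul]
      rw [h1, coeff_mul_monomial', if_neg]
      intro h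
      have := h k
      simp only [Finsupp.single_eq_same] at this
      exact absurd (he k hk) (by omega)
    | zero => simp
    | add x y _ _ hx hy => simp only [smul_add, coeff_add, hx, hy, add_zero]
    | smul b x _ hx => rw [smul_smul]; exact hx _

/-- In the exponents that the ideal does not touch, `X i * E` and `b * E` have equal coefficients,
so raising the exponent of `X i` by one trades a coefficient for a factor `b`. After `c` steps the
factor `b ^ c = 0` appears. -/
theorem coeff_eq_zero_of_X_sub_C_mul_mem {B : Type} [CommRing B] {c : ℕ} (hc : 0 < c) {i : σ}
    {b : B} (hb : b ^ c = 0) {E : MvPolynomial σ B}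
    (hE : (X i - C b) * E ∈ Ideal.span ((fun k => X k ^ c) '' {k | k ≠ i})) :
    coeff (Finsupp.equivFunOnFinite.symm fun _ => c - 1) E = 0 := by
  set e : σ →₀ ℕ := Finsupp.equivFunOnFinite.symm fun _ => c - 1 with he
  have step : ∀ r : ℕ, coeff (e + Finsupp.single i r) E =
      b * coeff (e + Finsupp.single i (r + 1)) E := by
    intro r
    have h0 : coeff (e + Finsupp.single i (r + 1)) ((X i - C b) * E) = 0 := by
      refine coeff_eq_zero_of_mem_span_X_pow _ hE ?_
      intro k hk
      have hk' : i ≠ k := fun h => hk h.symm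
      simp [he, Finsupp.single_apply, hk']
      omega
    rw [sub_mul, coeff_sub, coeff_C_mul, Finsupp.single_add, ← add_assoc, mul_comm (X i),
      coeff_mul_X, sub_eq_zero] at h0
    rw [h0, Finsupp.single_add, ← add_assoc]
  have iter : ∀ r : ℕ, coeff e E = b ^ r * coeff (e + Finsupp.single i r) E := by
    intro r
    induction r with
    | zero => simp
    | succ r ih => rw [ih, step r, pow_succ, mul_assoc]
  rw [iter c, hb, zero_mul]

/-- This is the transformation law for residues. The rows of `M` are exchanged one at a time for
diagonal ones. Both kinds of row solve the same equation against `X - y`, so their difference has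
right-hand side zero, and Cramer's rule puts `X i - y i` times the determinant of the difference in
the ideal of the other powers. -/
theorem coeff_mul_det_eq {B : Type} [CommRing B] {c : ℕ} (hc : 0 < c) (y : σ → B)
    (hy : ∀ i, y i ^ c = 0) (s u : MvPolynomial σ B) (M : Matrix σ σ (MvPolynomial σ B))
    (hM : M.mulVec (fun j => X j - C (y j)) = fun i => s * X i ^ c) :
    coeff (Finsupp.equivFunOnFinite.symm fun _ => c - 1) (u * M.det) =
      coeff (Finsupp.equivFunOnFinite.symm fun _ => c - 1)
        (u * ∏ i, s * ∑ a ∈ Finset.range c, X i ^ a * C (y i) ^ (c - 1 - a)) := by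
  set v : σ → MvPolynomial σ B := fun j => X j - C (y j) with hv
  set d : σ → MvPolynomial σ B :=
    fun i => s * ∑ a ∈ Finset.range c, X i ^ a * C (y i) ^ (c - 1 - a) with hd
  have hdv : ∀ i, d i * v i = s * X i ^ c := by
    intro i
    rw [hd, hv]
    simp only
    rw [mul_assoc, geom_sum₂_mul, ← C_pow, hy, C_0, sub_zero]
  let N : Finset σ → Matrix σ σ (MvPolynomial σ B) := fun t =>
    Matrix.of fun i => if i ∈ t then M i else Pi.single i (d i)
  have hNv : ∀ t i, (N t).mulVec v i = s * X i ^ c := by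
    intro t i
    by_cases hi : i ∈ t
    · rw [← congrFun hM i]
      simp [N, Matrix.mulVec, hi]
    · rw [← hdv i]
      simp [N, Matrix.mulVec, hi]
  have key : ∀ t : Finset σ,
      coeff (Finsupp.equivFunOnFinite.symm fun _ => c - 1) (u * (N t).det) =
      coeff (Finsupp.equivFunOnFinite.symm fun _ => c - 1) (u * (N ∅).det) := by
    intro t
    induction t using Finset.induction_on with
    | empty => rfl
    | insert i t hi ih =>
      rw [← ih, ← sub_eq_zero, ← coeff_sub, ← mul_sub]
      have h1 : N (insert i t) = (N t).updateRow i (M i) := by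
        ext a b
        by_cases ha : a = i
        · subst ha; simp [N]
        · simp [N, Matrix.updateRow_ne ha, ha]
      have h2 : (N (insert i t)).det - (N t).det =
          ((N t).updateRow i (M i - N t i)).det := by
        rw [h1, eq_comm, sub_eq_add_neg (M i), Matrix.det_updateRow_add, sub_eq_add_neg]
        congr 1
        have : -(N t i) = (-1 : MvPolynomial σ B) • N t i := by simp
        rw [this, Matrix.det_updateRow_smul, Matrix.updateRow_eq_self]
        simp
      rw [h2]
      set N' := (N t).updateRow i (M i - N t i) with hN'
      have h3 : ∀ k, N'.mulVec v k = if k = i then 0 else s * X k ^ c := by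
        intro k
        by_cases hk : k = i
        · subst hk
          have e1 : N'.mulVec v k = M.mulVec v k - (N t).mulVec v k := by
            simp only [hN', Matrix.mulVec, Matrix.updateRow_self]
            exact sub_dotProduct _ _ _
          rw [e1, hNv, hM]; simp
        · rw [if_neg hk, ← hNv t k]
          simp [hN', Matrix.mulVec, Matrix.updateRow_ne hk]
      apply coeff_eq_zero_of_X_sub_C_mul_mem hc (hy i)
      have h5 : (X i - C (y i)) * (u * N'.det) = u * (N'.det * v i) := by
        simp only [hv]; ring
      rw [h5, det_mul_eq_adjugate_mulVec]
      apply Ideal.mul_mem_left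
      simp only [Matrix.mulVec, dotProduct]
      apply Ideal.sum_mem
      intro k _
      apply Ideal.mul_mem_left
      have := h3 k
      simp only [Matrix.mulVec, dotProduct] at this
      rw [this]
      split_ifs with hk
      · exact zero_mem _
      · exact Ideal.mul_mem_left _ _ (Ideal.subset_span ⟨k, hk, rfl⟩)
  have h1 : N Finset.univ = M := by ext a b; simp [N]
  have h2 : (N ∅).det = ∏ i, d i := by
    have : N ∅ = Matrix.diagonal d := by
      ext a b
      simp only [N, Matrix.of_apply, Finset.notMem_empty, if_false, Matrix.diagonal_apply,
        Pi.single_apply]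
      simp [eq_comm]
    rw [this, Matrix.det_diagonal]
  rw [← h1, key, h2]

theorem coeff_prod_geom_sum {B : Type} [CommRing B] {c : ℕ} (hc : 0 < c) (y : σ → B) :
    coeff (Finsupp.equivFunOnFinite.symm fun _ => c - 1)
      (∏ i, ∑ a ∈ Finset.range c, X i ^ a * C (y i) ^ (c - 1 - a)) = 1 := by
  rw [Finset.prod_univ_sum, coeff_sum]
  have hm : ∀ p : σ → ℕ, ∏ i, (X i ^ p i * C (y i) ^ (c - 1 - p i) : MvPolynomial σ B) =
      monomial (Finsupp.equivFunOnFinite.symm p) (∏ i, y i ^ (c - 1 - p i)) := by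
    intro p
    rw [Finset.prod_mul_distrib, monomial_eq, mul_comm]
    congr 1
    · rw [map_prod]; simp
    · rw [Finsupp.prod_fintype _ _ (by simp)]; simp
  rw [Finset.sum_eq_single (fun _ => c - 1)]
  · rw [hm]; simp
  · intro p _ hp
    rw [hm, coeff_monomial, if_neg]
    intro h
    exact hp (Finsupp.equivFunOnFinite.symm.injective h)
  · intro h
    exfalso
    apply h
    simp only [Fintype.mem_piFinset, Finset.mem_range]
    intro; omega

theorem sub_C_eval_mem_span {B : Type} [CommRing B] (y : σ → B) (f : MvPolynomial σ B) :
    f - C (eval y f) ∈ Ideal.span (Set.range fun j => (X j - C (y j) : MvPolynomial σ B)) := by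
  induction f using MvPolynomial.induction_on with
  | C a => simp
  | add p q hp hq =>
    have : p + q - C (eval y (p + q)) = (p - C (eval y p)) + (q - C (eval y q)) := by
      simp; ring
    rw [this]; exact add_mem hp hq
  | mul_X p i hp =>
    have : p * X i - C (eval y (p * X i)) =
        X i * (p - C (eval y p)) + C (eval y p) * (X i - C (y i)) := by
      simp; ring
    rw [this]
    exact add_mem (Ideal.mul_mem_left _ _ hp)
      (Ideal.mul_mem_left _ _ (Ideal.subset_span ⟨i, rfl⟩))

/-- The variables are nilpotent modulo their powers, so there `s` is a unit plus a nilpotent. -/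
theorem exists_mul_sub_one_mem_span_X_pow {k : Type} [Field k] {s : MvPolynomial σ k}
    (hs : constantCoeff s ≠ 0) (c : ℕ) :
    ∃ u, u * s - 1 ∈ Ideal.span (Set.range fun i => (X i ^ c : MvPolynomial σ k)) := by
  set I := Ideal.span (Set.range fun i => (X i ^ c : MvPolynomial σ k)) with hI
  have h1 : s - C (constantCoeff s) ∈ I.radical := by
    have h := sub_C_eval_mem_span (0 : σ → k) s
    have h' : eval (0 : σ → k) s = constantCoeff s := by
      rw [constantCoeff_eq, ← constantCoeff_eq, eval_zero]
    rw [h'] at h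
    refine (Ideal.span_le.2 ?_) h
    rintro _ ⟨j, rfl⟩
    show X j - C (0 : k) ∈ I.radical
    rw [C_0, sub_zero]
    refine Ideal.mem_radical_iff.2 ⟨c, ?_⟩
    exact Ideal.subset_span ⟨j, rfl⟩
  have h2 : IsNilpotent (Ideal.Quotient.mk I (s - C (constantCoeff s))) := by
    obtain ⟨n, hn⟩ := Ideal.mem_radical_iff.1 h1
    exact ⟨n, by rw [← map_pow]; exact Ideal.Quotient.eq_zero_iff_mem.2 hn⟩
  have h3 : IsUnit (Ideal.Quotient.mk I (C (constantCoeff s))) :=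
    ((isUnit_iff_ne_zero.2 hs).map C).map _
  have h4 : IsUnit (Ideal.Quotient.mk I s) := by
    have : Ideal.Quotient.mk I s = Ideal.Quotient.mk I (C (constantCoeff s)) +
        Ideal.Quotient.mk I (s - C (constantCoeff s)) := by rw [← map_add]; ring_nf
    rw [this]
    exact h2.isUnit_add_left_of_commute h3 (Commute.all _ _)
  obtain ⟨b, hb⟩ := h4.exists_left_inv
  obtain ⟨u, rfl⟩ := Ideal.Quotient.mk_surjective b
  refine ⟨u, Ideal.Quotient.eq_zero_iff_mem.1 ?_⟩
  rw [map_sub, map_mul, hb, map_one, sub_self]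

/-- The functional `f ↦ coeff (u * det M * f)` kills `(g) + (X ^ c)`. -/
theorem mul_det_mul_mem_span_X_pow {k : Type} [CommRing k] (g : σ → MvPolynomial σ k)
    {c : ℕ} {s u : MvPolynomial σ k}
    (M : Matrix σ σ (MvPolynomial σ k)) (hM : M.mulVec g = fun i => s * X i ^ c)
    {f : MvPolynomial σ k} (hf : f ∈ Ideal.span (Set.range g) ⊔
      Ideal.span (Set.range fun i => (X i ^ c : MvPolynomial σ k))) :
    u * M.det * f ∈ Ideal.span (Set.range fun i => (X i ^ c : MvPolynomial σ k)) := by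
  have hMg : ∀ i, M.det * g i ∈ Ideal.span (Set.range fun i => (X i ^ c : MvPolynomial σ k)) := by
    intro i
    rw [det_mul_eq_adjugate_mulVec, hM]
    simp only [Matrix.mulVec, dotProduct]
    refine Ideal.sum_mem _ fun j _ => Ideal.mul_mem_left _ _ (Ideal.mul_mem_left _ _ ?_)
    exact Ideal.subset_span ⟨j, rfl⟩
  have : Ideal.span (Set.range g) ⊔
      Ideal.span (Set.range fun i => (X i ^ c : MvPolynomial σ k)) ≤
      (Ideal.span (Set.range fun i => (X i ^ c : MvPolynomial σ k))).colon {u * M.det} := by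
    refine sup_le (Ideal.span_le.2 ?_) ?_
    · rintro _ ⟨i, rfl⟩
      rw [SetLike.mem_coe, Submodule.mem_colon_singleton, smul_eq_mul, mul_comm, mul_assoc]
      exact Ideal.mul_mem_left _ _ (hMg i)
    · intro x hx
      rw [Submodule.mem_colon_singleton, smul_eq_mul]
      exact Ideal.mul_mem_right _ _ hx
  have h := this hf
  rw [Submodule.mem_colon_singleton, smul_eq_mul] at h
  rwa [mul_comm]

/-- The functional is a Grothendieck residue and `δ` the Bezoutian: the determinant of a matrix `Δ`
that writes the `g i`, over `B`, through the differences `X j - y j`, where `y` is the tautological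
point. At `y` it becomes the Jacobian determinant. Since `(h - h(y)) * δ` lies in the ideal of the
`g i`, which the functional kills, only the value `1` at `δ` has to be computed. -/
theorem residue_reproducing {k : Type} [Field k] {B : Type} [CommRing B] [Algebra k B]
    (π : MvPolynomial σ k →ₐ[k] B) (g : σ → MvPolynomial σ k)
    (hg : ∀ i, π (g i) = 0) {c : ℕ} (hc : 0 < c) (hX : ∀ i, π (X i) ^ c = 0)
    {s u : MvPolynomial σ k}
    (M : Matrix σ σ (MvPolynomial σ k)) (hM : M.mulVec g = fun i => s * X i ^ c)
    (hu : u * s ^ Fintype.card σ - 1 ∈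
      Ideal.span (Set.range fun i => (X i ^ c : MvPolynomial σ k))) :
    ∃ δ : MvPolynomial σ B,
      eval (fun i => π (X i)) δ = π (Matrix.of fun i j => pderiv j (g i)).det ∧
      ∀ h, coeff (Finsupp.equivFunOnFinite.symm fun _ => c - 1)
        (MvPolynomial.map (algebraMap k B) (u * M.det) *
          (MvPolynomial.map (algebraMap k B) h * δ)) = π h := by
  set e : σ →₀ ℕ := Finsupp.equivFunOnFinite.symm fun _ => c - 1 with he
  set y : σ → B := fun i => π (X i) with hyd
  have hy : ∀ i, y i ^ c = 0 := hX
  set φ : MvPolynomial σ k →+* MvPolynomial σ B := MvPolynomial.map (algebraMap k B) with hφ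
  have hev : ∀ f, eval y (φ f) = π f := by
    intro f
    rw [eval_map]
    have : (aeval y : MvPolynomial σ k →ₐ[k] B) = π := by
      ext i; simp [y]
    rw [← this]; rfl
  have hΔ : ∀ i, ∃ D : σ → MvPolynomial σ B, ∑ j, D j * (X j - C (y j)) = φ (g i) := by
    intro i
    have h := sub_C_eval_mem_span y (φ (g i))
    rw [hev, hg i, C_0, sub_zero] at h
    exact (Ideal.mem_span_range_iff_exists_fun).1 h
  choose Δ hΔ using hΔ
  set δ := (Matrix.of Δ).det with hδ
  have hΔv : (Matrix.of Δ).mulVec (fun j => X j - C (y j)) = fun i => φ (g i) := by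
    funext i; exact hΔ i
  have hΔy : ∀ i l, eval y (Δ i l) = π (pderiv l (g i)) := by
    intro i l
    rw [← hev]
    have : φ (pderiv l (g i)) = pderiv l (φ (g i)) := (pderiv_map).symm
    rw [this, ← hΔ i, map_sum, map_sum, Finset.sum_eq_single l]
    · simp [Derivation.leibniz, y]
    · intro j _ hj
      simp [Derivation.leibniz, pderiv_X_of_ne hj, y]
    · simp
  refine ⟨δ, ?_, ?_⟩
  · have h1 : π (Matrix.of fun i j => pderiv j (g i)).det =
        (π : MvPolynomial σ k →+* B) (Matrix.of fun i j => pderiv j (g i)).det := rfl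
    rw [h1, hδ, RingHom.map_det, RingHom.map_det]
    congr 1
    ext i j
    exact hΔy i j
  have hφX : ∀ f ∈ Ideal.span (Set.range fun i => (X i ^ c : MvPolynomial σ k)),
      φ f ∈ Ideal.span ((fun i => (X i ^ c : MvPolynomial σ B)) '' Set.univ) := by
    intro f hf
    have := Ideal.mem_map_of_mem φ hf
    rw [Ideal.map_span, ← Set.range_comp] at this
    rw [Set.image_univ]
    convert this using 3
    funext i
    simp [φ]
  have hlt : ∀ k ∈ (Set.univ : Set σ), e k < c := by intro k _; simp [he]; omega
  have hIX : ∀ i, u * M.det * g i ∈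
      Ideal.span (Set.range fun i => (X i ^ c : MvPolynomial σ k)) := fun i =>
    mul_det_mul_mem_span_X_pow g M hM
      ((le_sup_left : _ ≤ Ideal.span (Set.range g) ⊔ _) (Ideal.subset_span ⟨i, rfl⟩))
  have hker : ∀ f ∈ Ideal.span (Set.range fun i => φ (g i)), coeff e (φ (u * M.det) * f) = 0 := by
    intro f hf
    refine coeff_eq_zero_of_mem_span_X_pow (c := c) Set.univ ?_ hlt
    obtain ⟨a, rfl⟩ := (Ideal.mem_span_range_iff_exists_fun).1 hf
    rw [Finset.mul_sum]
    refine Ideal.sum_mem _ fun i _ => ?_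
    rw [mul_left_comm, ← map_mul]
    refine Ideal.mul_mem_left _ _ (hφX _ (hIX i))
  -- `M * Δ` carries `X - y` to `s * X ^ c`, so the transformation law applies to its determinant;
  -- `u` cancels the power of `s`.
  have hone : coeff e (φ (u * M.det) * δ) = 1 := by
    have h1 : φ (u * M.det) * δ = φ u * (φ.mapMatrix M * Matrix.of Δ).det := by
      rw [Matrix.det_mul, ← RingHom.map_det, map_mul, mul_assoc]
    rw [h1, coeff_mul_det_eq hc y hy (φ s) (φ u)]
    · rw [Finset.prod_mul_distrib, Finset.prod_const, Finset.card_univ, ← map_pow, ← mul_assoc,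
        ← map_mul]
      have h2 : u * s ^ Fintype.card σ = (u * s ^ Fintype.card σ - 1) + 1 := by ring
      rw [h2, map_add, add_mul, coeff_add, map_one, one_mul, coeff_prod_geom_sum hc,
        coeff_eq_zero_of_mem_span_X_pow (c := c) Set.univ (Ideal.mul_mem_right _ _ (hφX _ hu)) hlt,
        zero_add]
    · rw [← Matrix.mulVec_mulVec, hΔv]
      funext i
      have := congrFun hM i
      simp only [Matrix.mulVec, dotProduct] at this ⊢
      have h3 := congrArg φ this
      rw [map_sum] at h3
      simp only [map_mul, map_pow] at h3
      simp only [RingHom.mapMatrix_apply, Matrix.map_apply]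
      rw [h3]; simp [φ]
  intro h
  · skip
    have h1 : (φ h - C (π h)) * δ ∈ Ideal.span (Set.range fun i => φ (g i)) := by
      have h2 := sub_C_eval_mem_span y (φ h)
      rw [hev] at h2
      obtain ⟨a, ha⟩ := (Ideal.mem_span_range_iff_exists_fun).1 h2
      rw [← ha, Finset.sum_mul]
      refine Ideal.sum_mem _ fun j _ => ?_
      rw [mul_assoc]
      refine Ideal.mul_mem_left _ _ ?_
      rw [mul_comm, hδ, det_mul_eq_adjugate_mulVec (Matrix.of Δ) (fun j => X j - C (y j)), hΔv]
      simp only [Matrix.mulVec, dotProduct]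
      exact Ideal.sum_mem _ fun i _ => Ideal.mul_mem_left _ _ (Ideal.subset_span ⟨i, rfl⟩)
    have h3 := hker _ h1
    rw [sub_mul, mul_sub, coeff_sub, sub_eq_zero] at h3
    rw [h3, mul_left_comm, coeff_C_mul, hone, mul_one]

/-- The reproducing formula makes the coefficients of `δ` dual to the monomials: `b = ∑ L (b X^α)
δ_α`. Hence `B` is finite dimensional, and the trace of the identity, which is its dimension, equals
`L` of the value of `δ` at the tautological point, that is zero. In characteristic zero the
dimension itself is then zero. -/
theorem subsingleton_of_residue {k : Type} [Field k] [CharZero k] {B : Type} [CommRing B]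
    [Algebra k B] (π : MvPolynomial σ k →ₐ[k] B) (hπs : Function.Surjective π)
    (L : B →ₗ[k] k) (e : σ →₀ ℕ) (U : MvPolynomial σ k) (hL : ∀ f, L (π f) = coeff e (U * f))
    (δ : MvPolynomial σ B) (hδy : eval (fun i => π (X i)) δ = 0)
    (hrep : ∀ h, coeff e (MvPolynomial.map (algebraMap k B) U *
          (MvPolynomial.map (algebraMap k B) h * δ)) = π h) : Subsingleton B := by
  set φ : MvPolynomial σ k →+* MvPolynomial σ B := MvPolynomial.map (algebraMap k B) with hφ
  classical
  have hid : ∀ b : B, b = ∑ α ∈ δ.support,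
      L (b * π (monomial α 1)) • coeff α δ := by
    intro b
    obtain ⟨h, rfl⟩ := hπs b
    conv_lhs => rw [← hrep h, δ.as_sum]
    rw [Finset.mul_sum, Finset.mul_sum, coeff_sum]
    refine Finset.sum_congr rfl fun α _ => ?_
    have h6 : (monomial α (coeff α δ) : MvPolynomial σ B) =
        φ (monomial α 1) * C (coeff α δ) := by
      simp only [φ, map_monomial, map_one]
      rw [mul_comm, C_mul_monomial, mul_one]
    rw [h6, ← map_mul, hL, Algebra.smul_def, ← mul_assoc, ← mul_assoc, ← map_mul, ← map_mul,
      mul_comm _ (C _), coeff_C_mul, mul_comm, ← mul_assoc, coeff_map]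
  have hfin : Module.Finite k B := by
    refine ⟨⟨δ.support.image fun α => coeff α δ, ?_⟩⟩
    rw [eq_top_iff]
    intro b _
    rw [hid b]
    refine Submodule.sum_mem _ fun α hα => Submodule.smul_mem _ _ (Submodule.subset_span ?_)
    simpa using ⟨α, by simpa using hα, rfl⟩
  have htr : (Module.finrank k B : k) = 0 := by
    rw [← LinearMap.trace_id k B]
    have h7 : (LinearMap.id : B →ₗ[k] B) = ∑ α ∈ δ.support,
        (L ∘ₗ LinearMap.mulRight k (π (monomial α 1))).smulRight (coeff α δ) := by
      ext b
      rw [LinearMap.id_apply, LinearMap.sum_apply]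
      exact hid b
    rw [h7, map_sum]
    simp only [LinearMap.trace_smulRight]
    have h8 : L (eval (fun i => π (X i)) δ) = 0 := by rw [hδy, map_zero]
    rw [← h8, eval_eq', map_sum]
    refine Finset.sum_congr rfl fun α _ => ?_
    simp only [LinearMap.comp_apply, LinearMap.mulRight_apply]
    congr 2
    rw [monomial_eq, C_1, one_mul, Finsupp.prod_fintype _ _ (by simp), map_prod]
    simp
  have h0 : Module.finrank k B = 0 := by exact_mod_cast htr
  exact Module.finrank_zero_iff.1 h0

/-- The quotient by the `g i` and the powers `X i ^ c` is nonzero, since all generators vanish at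
the origin. As `s'` becomes a unit there, the Jacobian determinant would vanish in the quotient, and
the trace argument would make the quotient zero. -/
theorem residue_contradiction {k : Type} [Field k] [CharZero k] (g : σ → MvPolynomial σ k)
    (hg : ∀ i, constantCoeff (g i) = 0) {c : ℕ} (hc : 0 < c) {s s' : MvPolynomial σ k}
    (hs : constantCoeff s ≠ 0) (hs' : constantCoeff s' ≠ 0)
    (M : Matrix σ σ (MvPolynomial σ k)) (hM : M.mulVec g = fun i => s * X i ^ c)
    (hJ : s' * (Matrix.of fun i j => pderiv j (g i)).det ∈ Ideal.span (Set.range g)) : False := by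
  set I : Ideal (MvPolynomial σ k) :=
    Ideal.span (Set.range g) ⊔ Ideal.span (Set.range fun i => (X i ^ c : MvPolynomial σ k)) with hI
  set e : σ →₀ ℕ := Finsupp.equivFunOnFinite.symm fun _ => c - 1 with he
  have hI0 : ∀ f ∈ I, constantCoeff f = 0 := by
    intro f hf
    have : I ≤ RingHom.ker (constantCoeff (σ := σ) (R := k)) := by
      refine sup_le (Ideal.span_le.2 ?_) (Ideal.span_le.2 ?_)
      · rintro _ ⟨i, rfl⟩; exact hg i
      · rintro _ ⟨i, rfl⟩
        simp [RingHom.mem_ker, hc.ne']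
    exact this hf
  have hXI : Ideal.span (Set.range fun i => (X i ^ c : MvPolynomial σ k)) ≤ I := le_sup_right
  let π : MvPolynomial σ k →ₐ[k] MvPolynomial σ k ⧸ I := Ideal.Quotient.mkₐ k I
  have hπ : ∀ f, f ∈ I → π f = 0 := fun f hf => Ideal.Quotient.eq_zero_iff_mem.2 hf
  have hsN : constantCoeff (s ^ Fintype.card σ) ≠ 0 := by rw [map_pow]; exact pow_ne_zero _ hs
  obtain ⟨u, hu⟩ := exists_mul_sub_one_mem_span_X_pow hsN c
  obtain ⟨δ, hδ, hrep⟩ := residue_reproducing π g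
    (fun i => hπ _ ((le_sup_left : _ ≤ I) (Ideal.subset_span ⟨i, rfl⟩))) hc
    (fun i => by rw [← map_pow]; exact hπ _ (hXI (Ideal.subset_span ⟨i, rfl⟩))) M hM hu
  have hJ0 : π (Matrix.of fun i j => pderiv j (g i)).det = 0 := by
    obtain ⟨w, hw⟩ := exists_mul_sub_one_mem_span_X_pow hs' c
    have h2 : π w * π s' = 1 := by
      rw [← sub_eq_zero, ← map_mul, ← map_one π, ← map_sub]
      exact hπ _ (hXI hw)
    rw [← one_mul (π _), ← h2, mul_assoc, ← map_mul, hπ _ ((le_sup_left : _ ≤ I) hJ), mul_zero]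
  let L0 : MvPolynomial σ k →ₗ[k] k := (lcoeff k e) ∘ₗ (LinearMap.mulLeft k (u * M.det))
  have hL0 : ∀ f, L0 f = coeff e (u * M.det * f) := fun f => rfl
  have hL0I : I.restrictScalars k ≤ LinearMap.ker L0 := by
    intro f hf
    rw [LinearMap.mem_ker, hL0]
    have h5 := mul_det_mul_mem_span_X_pow (u := u) g M hM hf
    rw [← Set.image_univ] at h5
    exact coeff_eq_zero_of_mem_span_X_pow Set.univ h5 (by intro k _; simp [he]; omega)
  have := subsingleton_of_residue π Ideal.Quotient.mk_surjective
    ((I.restrictScalars k).liftQ L0 hL0I) e (u * M.det) (fun f => rfl) δ (hδ.trans hJ0) hrep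
  have h2 : (1 : MvPolynomial σ k) ∈ I :=
    Ideal.Quotient.eq_zero_iff_mem.1 (Subsingleton.elim _ _)
  simpa using hI0 _ h2

end Residue

end ToricKupka

namespace ToricKupka

/-! ### Nagata's substitution, making a polynomial monic in one variable. -/

section NagataSubstitution

open Polynomial MvPolynomial Ideal Nat RingHom List

variable {k : Type} [Field k] {n : ℕ} (f : MvPolynomial (Fin (n + 1)) k)
variable (v w : Fin (n + 1) →₀ ℕ)

variable {f v} in
theorem lt_up (vlt : ∀ i, v i < 2 + f.totalDegree) : ∀ l ∈ ofFn v, l < 2 + f.totalDegree := by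
  grind

/-- The substitution `X_i ↦ X_i + c X_0 ^ ((2 + deg f) ^ i)` for `i ≠ 0`, fixing `X_0`. -/
noncomputable abbrev nagataMap (c : k) :
    MvPolynomial (Fin (n + 1)) k →ₐ[k] MvPolynomial (Fin (n + 1)) k :=
  aeval fun i ↦ if i = 0 then X 0 else X i + c • X 0 ^ (2 + f.totalDegree) ^ i.1

theorem nagataMap_comp_neg (c : k) : (nagataMap f c).comp (nagataMap f (-c)) = AlgHom.id _ _ := by
  rw [comp_aeval, ← MvPolynomial.aeval_X_left]
  ext i v
  cases i using Fin.cases <;> simp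

/-- The substitution `nagataMap f 1` as an automorphism. -/
noncomputable abbrev nagataEquiv := AlgEquiv.ofAlgHom (nagataMap f 1) (nagataMap f (-1))
  (nagataMap_comp_neg f 1) (by simpa using nagataMap_comp_neg f (-1))

/-- The exponents are smaller than the base `2 + f.totalDegree`, so the two sums are expansions with
different digits. -/
theorem sum_r_mul_ne (vlt : ∀ i, v i < 2 + f.totalDegree) (wlt : ∀ i, w i < 2 + f.totalDegree) (ne : v ≠ w) :
    ∑ x : Fin (n + 1), (2 + f.totalDegree) ^ x.1 * v x ≠ ∑ x : Fin (n + 1), (2 + f.totalDegree) ^ x.1 * w x := by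
  intro h
  refine ne <| Finsupp.ext <| congrFun <| ofFn_inj.mp ?_
  apply ofDigits_inj_of_len_eq (Nat.lt_add_right f.totalDegree one_lt_two)
    (by simp) (lt_up vlt) (lt_up wlt)
  simpa only [ofDigits_eq_sum_mapIdx, mapIdx_eq_ofFn, get_ofFn, length_ofFn,
    Fin.val_cast, mul_comm, sum_ofFn] using! h

theorem degreeOf_zero_t {a : k} (ha : a ≠ 0) : ((nagataEquiv f) (monomial v a)).degreeOf 0 =
    ∑ i : Fin (n + 1), ((2 + f.totalDegree) ^ i.1) * v i := by
  rw [← natDegree_finSuccEquiv, monomial_eq, Finsupp.prod_pow v fun a ↦ X a]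
  simp only [Fin.prod_univ_succ, Fin.sum_univ_succ, map_mul, map_prod, map_pow,
    AlgEquiv.ofAlgHom_apply, MvPolynomial.aeval_C, MvPolynomial.aeval_X, if_pos, Fin.succ_ne_zero,
    ite_false, one_smul, map_add, finSuccEquiv_X_zero, finSuccEquiv_X_succ, algebraMap_eq]
  have h (i : Fin n) :
      (Polynomial.C (X (R := k) i) + Polynomial.X ^ ((2 + f.totalDegree) ^ i.succ.1)) ^ v i.succ ≠ 0 :=
    pow_ne_zero (v i.succ) (leadingCoeff_ne_zero.mp <| by simp [add_comm, leadingCoeff_X_pow_add_C])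
  rw [natDegree_mul (by simp [ha]) (mul_ne_zero (by simp) (Finset.prod_ne_zero_iff.mpr
    (fun i _ ↦ h i))), natDegree_mul (by simp) (Finset.prod_ne_zero_iff.mpr (fun i _ ↦ h i)),
    natDegree_prod _ _ (fun i _ ↦ h i), natDegree_finSuccEquiv, degreeOf_C]
  simpa only [natDegree_pow, zero_add, natDegree_X, mul_one, Fin.val_zero, pow_zero, one_mul,
    add_right_inj] using Finset.sum_congr rfl (fun i _ ↦ by
    rw [add_comm (Polynomial.C _), natDegree_X_pow_add_C, mul_comm])

/-- `nagataEquiv f` maps different monomials of `f` to polynomials with different degrees in `X_0`. -/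
theorem degreeOf_t_ne_of_ne (hv : v ∈ f.support) (hw : w ∈ f.support) (ne : v ≠ w) :
    (nagataEquiv f <| monomial v <| coeff v f).degreeOf 0 ≠
    (nagataEquiv f <| monomial w <| coeff w f).degreeOf 0 := by
  rw [degreeOf_zero_t _ _ <| mem_support_iff.mp hv, degreeOf_zero_t _ _ <| mem_support_iff.mp hw]
  refine sum_r_mul_ne f v w (fun i ↦ ?_) (fun i ↦ ?_) ne <;>
  exact lt_of_le_of_lt ((monomial_le_degreeOf i ‹_›).trans (degreeOf_le_totalDegree f i))
    (by lia)

theorem leadingCoeff_finSuccEquiv_t :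
    (finSuccEquiv k n ((nagataEquiv f) ((monomial v) (coeff v f)))).leadingCoeff =
    algebraMap k _ (coeff v f) := by
  rw [monomial_eq, Finsupp.prod_fintype]
  · simp only [map_mul, map_prod, leadingCoeff_mul, leadingCoeff_prod]
    rw [AlgEquiv.ofAlgHom_apply, algHom_C, algebraMap_eq, finSuccEquiv_apply,
      eval₂Hom_C, coe_comp]
    simp only [AlgEquiv.ofAlgHom_apply, Function.comp_apply, leadingCoeff_C, map_pow,
      leadingCoeff_pow, algebraMap_eq]
    have : ∀ j, ((finSuccEquiv k n) (nagataMap f 1 (X j))).leadingCoeff = 1 := fun j ↦ by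
      by_cases h : j = 0
      · simp [h, finSuccEquiv_apply]
      · simp only [aeval_eq_bind₁, bind₁_X_right, if_neg h, one_smul, map_add, map_pow]
        obtain ⟨i, rfl⟩ := Fin.exists_succ_eq.mpr h
        simp [finSuccEquiv_X_succ, finSuccEquiv_X_zero, add_comm]
    simp only [this, one_pow, Finset.prod_const_one, mul_one]
  exact fun i ↦ pow_zero _

/-- `nagataEquiv f` maps `f` into some polynomial in `X_0` such that the leading coefficient is invertible. -/
theorem nagata_leadingcoeff_isUnit (fne : f ≠ 0) :
    IsUnit (finSuccEquiv k n (nagataEquiv f f)).leadingCoeff := by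
  obtain ⟨v, vin, vs⟩ := Finset.exists_max_image f.support
    (fun v ↦ (nagataEquiv f ((monomial v) (coeff v f))).degreeOf 0) (support_nonempty.mpr fne)
  set h := fun w ↦ (MvPolynomial.monomial w) (coeff w f)
  simp only [← natDegree_finSuccEquiv] at vs
  replace vs : ∀ x ∈ f.support \ {v}, (finSuccEquiv k n ((nagataEquiv f) (h x))).degree <
      (finSuccEquiv k n ((nagataEquiv f) (h v))).degree := by
    intro x hx
    obtain ⟨h1, h2⟩ := Finset.mem_sdiff.mp hx
    apply degree_lt_degree <| lt_of_le_of_ne (vs x h1) ?_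
    simpa only [natDegree_finSuccEquiv]
      using degreeOf_t_ne_of_ne f _ _ h1 vin <| ne_of_not_mem_cons h2
  have coeff : (finSuccEquiv k n ((nagataEquiv f) (h v + ∑ x ∈ f.support \ {v}, h x))).leadingCoeff =
      (finSuccEquiv k n ((nagataEquiv f) (h v))).leadingCoeff := by
    simp only [map_add, map_sum]
    rw [add_comm]
    apply leadingCoeff_add_of_degree_lt <| (lt_of_le_of_lt <| degree_sum_le _ _) ?_
    have h2 : h v ≠ 0 := by simpa [h] using mem_support_iff.mp vin
    replace h2 : (finSuccEquiv k n ((nagataEquiv f) (h v))) ≠ 0 := fun eq ↦ h2 <|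
      by simpa only [map_eq_zero_iff _ (AlgEquiv.injective _)] using eq
    exact (Finset.sup_lt_iff <| Ne.bot_lt (fun x ↦ h2 <| degree_eq_bot.mp x)).mpr vs
  nth_rw 2 [← f.support_sum_monomial_coeff]
  rw [Finset.sum_eq_add_sum_sdiff_singleton_of_mem vin h]
  rw [leadingCoeff_finSuccEquiv_t] at coeff
  simpa only [coeff, algebraMap_eq] using (mem_support_iff.mp vin).isUnit.map MvPolynomial.C

end NagataSubstitution

end ToricKupka

namespace ToricKupka

/-! ### Heights in polynomial rings and regular sequences of length three. -/

section Grade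

open Polynomial

-- Inverting the nonzero constants keeps the height and lands in the polynomial ring over a field, a
-- principal ideal domain.
attribute [local instance] Polynomial.algebra Polynomial.isLocalization in
theorem height_le_one_of_comap_C_eq_bot {D : Type} [CommRing D] [IsDomain D]
    (P : Ideal D[X]) [hP : P.IsPrime] (h : P.comap C = ⊥) : P.height ≤ 1 := by
  have disj : Disjoint ((nonZeroDivisors D).map C : Set D[X]) P := by
    refine Set.disjoint_left.mpr fun a ⟨b, hb⟩ ha ↦ ?_
    have hbP : b ∈ P.comap C := by rw [Ideal.mem_comap, hb.2]; exact ha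
    rw [h, Ideal.mem_bot] at hbP
    exact nonZeroDivisors.ne_zero hb.1 hbP
  rw [← IsLocalization.height_map_of_disjoint (S := (FractionRing D)[X])
    (Submonoid.map C (nonZeroDivisors D)) P disj]
  have hp := IsLocalization.isPrime_of_isPrime_disjoint
    (Submonoid.map C (nonZeroDivisors D)) (FractionRing D)[X] P hP disj
  by_cases h0 : Ideal.map (algebraMap D[X] (FractionRing D)[X]) P = ⊥
  · rw [h0, Ideal.height_bot]; exact zero_le_one
  · have := Ideal.IsPrime.isMaximal hp h0
    rw [IsPrincipalIdealRing.height_eq_one_of_isMaximal _ (Polynomial.not_isField _)]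

/-- The fibre over the contraction `p` contributes the prime induced in `(R ⧸ p)[X]`, which meets
the constants in zero and so has height at most one. -/
theorem height_le_height_comap_C_add_one {R : Type} [CommRing R] [IsNoetherianRing R]
    (P : Ideal R[X]) [hP : P.IsPrime] : P.height ≤ (P.comap C).height + 1 := by
  set p := P.comap C with hp
  have hpp : p.IsPrime := Ideal.comap_isPrime _ _
  have : P.LiesOver p := ⟨rfl⟩
  refine (Ideal.height_le_height_add_of_liesOver p P).trans (add_le_add_right ?_ _)
  have hle : p.map (algebraMap R R[X]) ≤ P := Ideal.map_comap_le
  let e : (R ⧸ p)[X] ≃+* (R[X] ⧸ (p.map (algebraMap R R[X]))) :=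
    Ideal.polynomialQuotientEquivQuotientPolynomial p
  set P' := P.map (Ideal.Quotient.mk (p.map (algebraMap R R[X]))) with hP'
  have : P'.IsPrime := Ideal.map_isPrime_of_surjective Ideal.Quotient.mk_surjective
    (by rw [Ideal.mk_ker]; exact hle)
  rw [← RingEquiv.height_comap e]
  have : (P'.comap e).IsPrime := Ideal.comap_isPrime _ _
  refine height_le_one_of_comap_C_eq_bot _ ?_
  rw [eq_bot_iff]
  intro x hx
  obtain ⟨r, rfl⟩ := Ideal.Quotient.mk_surjective x
  rw [Ideal.mem_comap, Ideal.mem_comap] at hx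
  have he : e (C (Ideal.Quotient.mk p r)) =
      Ideal.Quotient.mk (p.map (algebraMap R R[X])) (C r) := by
    have := Ideal.polynomialQuotientEquivQuotientPolynomial_map_mk p (C r)
    rwa [Polynomial.map_C] at this
  rw [he, hP', Ideal.mem_quotient_iff_mem hle] at hx
  rw [Ideal.mem_bot, Ideal.Quotient.eq_zero_iff_mem]
  exact hx

/-- A monic element makes `R[X] ⧸ 𝔟` integral over `R`, and lying over applies. -/
theorem exists_prime_comap_C_eq {R : Type} [CommRing R] (𝔟 : Ideal R[X]) {f : R[X]}
    (hf : f.Monic) (hfb : f ∈ 𝔟) (p : Ideal R) [p.IsPrime] (hp : 𝔟.comap C ≤ p) :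
    ∃ P : Ideal R[X], P.IsPrime ∧ 𝔟 ≤ P ∧ P.comap C = p := by
  have hint : Algebra.IsIntegral R (R[X] ⧸ 𝔟) := ⟨hf.quotient_isIntegral hfb⟩
  obtain ⟨Q, -, hQ, hQp⟩ := Ideal.exists_ideal_over_prime_of_isIntegral (S := R[X] ⧸ 𝔟) p ⊥ (by
    intro x hx
    apply hp
    rw [Ideal.mem_comap, Ideal.mem_bot] at hx
    rw [Ideal.mem_comap]
    exact Ideal.Quotient.eq_zero_iff_mem.1 hx)
  refine ⟨Q.comap (Ideal.Quotient.mk 𝔟), Ideal.comap_isPrime _ _, ?_, ?_⟩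
  · intro x hx
    rw [Ideal.mem_comap, Ideal.Quotient.eq_zero_iff_mem.2 hx]
    exact zero_mem _
  · rw [← hQp]; rfl

/-- All primes containing the ideal have height at least `r`. -/
def HeightGE {R : Type} [CommRing R] (I : Ideal R) (r : ℕ∞) : Prop :=
  ∀ P : Ideal R, P.IsPrime → I ≤ P → r ≤ P.height

theorem height_span_singleton_le_one {R : Type} [CommRing R] [IsNoetherianRing R] {p : R}
    (hp : (Ideal.span {p}).IsPrime) : (Ideal.span {p}).height ≤ 1 := by
  refine Ideal.height_le_one_of_isPrincipal_of_mem_minimalPrimes (Ideal.span {p}) _ ?_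
  rw [Ideal.minimalPrimes_eq_subsingleton_self]; rfl

theorem HeightGE.isUnit_of_dvd {R : Type} [CommRing R] [IsDomain R] [UniqueFactorizationMonoid R]
    [IsNoetherianRing R] {I : Ideal R} (h : HeightGE I 2) {d : R} (hd : ∀ x ∈ I, d ∣ x) :
    IsUnit d := by
  by_contra hu
  by_cases h0 : d = 0
  · have := h ⊥ Ideal.isPrime_bot (fun x hx => by simpa [h0] using hd x hx)
    rw [Ideal.height_bot] at this
    exact absurd this (by norm_num)
  obtain ⟨p, hp, hpd⟩ := WfDvdMonoid.exists_irreducible_factor hu h0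
  have hpp : (Ideal.span {p}).IsPrime := (Ideal.span_singleton_prime hp.ne_zero).2 hp.prime
  have := (h _ hpp (fun x hx => Ideal.mem_span_singleton.2 (hpd.trans (hd x hx)))).trans
    (height_span_singleton_le_one hpp)
  exact absurd this (by norm_num)

theorem HeightGE.ne_bot {R : Type} [CommRing R] [IsDomain R] {I : Ideal R} {r : ℕ∞}
    (h : HeightGE I r) (hr : 0 < r) : I ≠ ⊥ := by
  intro h0
  have := h ⊥ Ideal.isPrime_bot h0.le
  rw [Ideal.height_bot] at this
  exact absurd this (not_le.2 hr)

/-- Prime avoidance: a principal prime has height at most one and cannot contain `I`, so some `b ∈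
I` is divisible by none of the finitely many prime factors of `a`. -/
theorem HeightGE.exists_isRelPrime {R : Type} [CommRing R] [IsDomain R]
    [UniqueFactorizationMonoid R] [IsNoetherianRing R] {I : Ideal R} (h : HeightGE I 2) :
    ∃ a ∈ I, ∃ b ∈ I, a ≠ 0 ∧ IsRelPrime a b := by
  classical
  obtain ⟨a, haI, ha⟩ := Submodule.exists_mem_ne_zero_of_ne_bot (h.ne_bot (by norm_num))
  set s := (UniqueFactorizationMonoid.factors a).toFinset with hs
  have hprime : ∀ q ∈ s, (Ideal.span {q}).IsPrime := by
    intro q hq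
    have := UniqueFactorizationMonoid.prime_of_factor q (Multiset.mem_toFinset.1 hq)
    exact (Ideal.span_singleton_prime this.ne_zero).2 this
  have hnot : ¬ ((I : Set R) ⊆ ⋃ q ∈ (s : Set R), Ideal.span {q}) := by
    rw [Ideal.subset_union_prime (s := s) (f := fun q => Ideal.span {q}) 0 0
      (fun i hi _ _ => hprime i hi)]
    rintro ⟨q, hq, hIq⟩
    have := (h _ (hprime q hq) hIq).trans (height_span_singleton_le_one (hprime q hq))
    exact absurd this (by norm_num)
  obtain ⟨b, hbI, hb⟩ := Set.not_subset.1 hnot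
  refine ⟨a, haI, b, hbI, ha, fun d hda hdb => ?_⟩
  by_contra hu
  obtain ⟨p, hp, hpd⟩ := WfDvdMonoid.exists_irreducible_factor hu (ne_zero_of_dvd_ne_zero ha hda)
  obtain ⟨q, hq, hpq⟩ := UniqueFactorizationMonoid.exists_mem_factors_of_dvd ha hp (hpd.trans hda)
  apply hb
  simp only [Set.mem_iUnion]
  exact ⟨q, Multiset.mem_toFinset.2 hq,
    Ideal.mem_span_singleton.2 (hpq.dvd_iff_dvd_left.1 (hpd.trans hdb))⟩

/-- A regular sequence of length three (with possibly trivial quotient). -/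
structure IsRegularTriple {R : Type} [CommRing R] (a b c : R) : Prop where
  ne_zero : a ≠ 0
  dvd : ∀ x, a ∣ b * x → a ∣ x
  mem : ∀ x, c * x ∈ Ideal.span {a, b} → x ∈ Ideal.span {a, b}

theorem IsRegularTriple.of_equiv {R S : Type} [CommRing R] [CommRing S] (e : R ≃+* S) {a b c : R}
    (h : IsRegularTriple (e a) (e b) (e c)) : IsRegularTriple a b c := by
  have hspan : ∀ x, x ∈ Ideal.span {a, b} ↔ e x ∈ Ideal.span {e a, e b} := by
    intro x
    simp only [Ideal.mem_span_pair]
    constructor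
    · rintro ⟨p, q, rfl⟩; exact ⟨e p, e q, by simp⟩
    · rintro ⟨p, q, h⟩; exact ⟨e.symm p, e.symm q, e.injective (by simp [h])⟩
  refine ⟨fun h0 => h.ne_zero (by simp [h0]), fun x hx => ?_, fun x hx => ?_⟩
  · exact (map_dvd_iff e).1 (h.dvd (e x) (by rw [← map_mul]; exact (map_dvd_iff e).2 hx))
  · rw [hspan] at hx ⊢
    exact h.mem _ (by rwa [← map_mul])

/-- Contraction to `R` loses at most one in height, so it leaves a coprime pair. Coprime constants
stay regular in `R[X]`, and the monic `f` is a nonzerodivisor modulo every ideal extended from `R`.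
-/
theorem HeightGE.exists_isRegularTriple_of_monic {R : Type} [CommRing R] [IsDomain R]
    [UniqueFactorizationMonoid R] [IsNoetherianRing R] {𝔟 : Ideal R[X]} (h : HeightGE 𝔟 3)
    {f : R[X]} (hf : f.Monic) (hfb : f ∈ 𝔟) :
    ∃ a ∈ 𝔟, ∃ b ∈ 𝔟, IsRegularTriple a b f := by
  have h2 : HeightGE (𝔟.comap C) 2 := by
    intro p hp hbp
    obtain ⟨P, hP, hbP, rfl⟩ := exists_prime_comap_C_eq 𝔟 hf hfb p hbp
    have h3 := (h P hP hbP).trans (height_le_height_comap_C_add_one P)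
    have : (3 : ℕ∞) = 2 + 1 := by norm_num
    rw [this] at h3
    exact (ENat.add_le_add_iff_right (by simp)).1 h3
  obtain ⟨a, ha, b, hb, ha0, hab⟩ := h2.exists_isRelPrime
  refine ⟨C a, ha, C b, hb, by simpa using ha0, fun x hx => ?_, fun x hx => ?_⟩
  · rw [C_dvd_iff_dvd_coeff] at hx ⊢
    intro i
    have := hx i
    rw [coeff_C_mul] at this
    exact hab.dvd_of_dvd_mul_left this
  · have hmap : Ideal.span {C a, C b} = (Ideal.span {a, b}).map C := by
      rw [Ideal.map_span, Set.image_pair]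
    rw [hmap] at hx ⊢
    have key : ∀ g : R[X], g ∈ (Ideal.span {a, b}).map C ↔
        g.map (Ideal.Quotient.mk (Ideal.span {a, b})) = 0 := by
      intro g
      rw [Ideal.mem_map_C_iff, Polynomial.ext_iff]
      simp only [coeff_map, coeff_zero, Ideal.Quotient.eq_zero_iff_mem]
    rw [key, Polynomial.map_mul] at hx
    rw [key]
    exact (hf.map _).mul_right_eq_zero_iff.1 hx

/-- Nagata's substitution makes a nonzero element of `I` monic up to a unit. With no variables the
ideal is the whole ring, and three ones qualify. -/
theorem HeightGE.exists_isRegularTriple {k : Type} [Field k] {n : ℕ}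
    {I : Ideal (MvPolynomial (Fin n) k)} (h : HeightGE I 3) :
    ∃ a ∈ I, ∃ b ∈ I, ∃ c ∈ I, IsRegularTriple a b c := by
  cases n with
  | zero =>
    have hI : I = ⊤ := by
      by_contra hI
      obtain ⟨M, hM, hIM⟩ := Ideal.exists_le_maximal I hI
      have h1 := h M hM.isPrime hIM
      have h2 := Ideal.height_le_ringKrullDim_of_isPrime (I := M)
      rw [MvPolynomial.ringKrullDim_of_isNoetherianRing, ringKrullDim_eq_zero_of_field] at h2
      simp only [Nat.card_eq_fintype_card, Fintype.card_fin, Nat.cast_zero, add_zero] at h2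
      have h3 : M.height ≤ 0 := by exact_mod_cast h2
      exact absurd (h1.trans h3) (by norm_num)
    refine ⟨1, by simp [hI], 1, by simp [hI], 1, by simp [hI], one_ne_zero, by simp, by simp⟩
  | succ n =>
    obtain ⟨f, hfI, hf⟩ := Submodule.exists_mem_ne_zero_of_ne_bot (h.ne_bot (by norm_num))
    let e : MvPolynomial (Fin (n + 1)) k ≃+* (MvPolynomial (Fin n) k)[X] :=
      ((nagataEquiv f).trans (MvPolynomial.finSuccEquiv k n)).toRingEquiv
    have hu : IsUnit (e f).leadingCoeff := nagata_leadingcoeff_isUnit f hf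
    have hI : HeightGE (I.map e) 3 := by
      intro P hP hIP
      rw [← RingEquiv.height_comap e]
      exact h _ (Ideal.comap_isPrime _ _) (Ideal.map_le_iff_le_comap.1 hIP)
    obtain ⟨a, ha, b, hb, hab⟩ := hI.exists_isRegularTriple_of_monic
      (monic_of_isUnit_leadingCoeff_inv_smul hu) (by
        rw [Units.smul_def, ← Polynomial.C_mul']
        exact Ideal.mul_mem_left _ _ (Ideal.mem_map_of_mem e hfI))
    have key : ∀ x ∈ I.map e, e.symm x ∈ I := by
      intro x hx
      rwa [← Ideal.comap_symm, Ideal.mem_comap] at hx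
    refine ⟨_, key a ha, _, key b hb, e.symm ((hu.unit⁻¹ : (MvPolynomial (Fin n) k)ˣ) • e f),
      key _ ?_, ?_⟩
    · rw [Units.smul_def, ← Polynomial.C_mul']
      exact Ideal.mul_mem_left _ _ (Ideal.mem_map_of_mem e hfI)
    · apply IsRegularTriple.of_equiv e
      simpa using hab

end Grade

/-! ### Unmixedness of ideals with projective syzygies. -/

section Koszul

variable {R : Type} [CommRing R]

/-- For a projective module, an element annihilated by the last element of a regular triple modulo
the first two is zero modulo the first two. -/
theorem IsRegularTriple.exists_eq_add {N : Type} [AddCommGroup N] [Module R N]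
    [Module.Projective R N] {a b c : R} (h : IsRegularTriple a b c) {x y z : N}
    (hx : c • x = a • y + b • z) : ∃ y' z' : N, x = a • y' + b • z' := by
  obtain ⟨s, hs⟩ := Module.Projective.out (R := R) (P := N)
  have hc : ∀ p : N, ∃ u v : R, s x p = a * u + b * v := by
    intro p
    have h1 : c * s x p ∈ Ideal.span {a, b} := by
      have := congrArg (fun w => s w p) hx
      simp only [map_smul, map_add, Finsupp.smul_apply, Finsupp.add_apply, smul_eq_mul] at this
      rw [this, Ideal.mem_span_pair]
      exact ⟨s y p, s z p, by ring⟩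
    obtain ⟨u, v, huv⟩ := Ideal.mem_span_pair.1 (h.mem _ h1)
    exact ⟨u, v, by rw [← huv]; ring⟩
  choose u v huv using hc
  refine ⟨∑ p ∈ (s x).support, u p • p, ∑ p ∈ (s x).support, v p • p, ?_⟩
  rw [Finset.smul_sum, Finset.smul_sum, ← Finset.sum_add_distrib]
  conv_lhs => rw [← hs x, Finsupp.linearCombination_apply, Finsupp.sum]
  refine Finset.sum_congr rfl fun p _ => ?_
  rw [huv p, add_smul, mul_smul, mul_smul]
  rfl

/-- Preimages of `a y`, `b y`, `c y` give three syzygies such as `b w₁ - a w₂`, and these satisfy a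
Koszul relation. Projectivity of the kernel rewrites the first one as `a u + b v` with syzygies `u`,
`v`. Then `a` divides `w₁ - v`, and the quotient is a preimage of `y`. -/
theorem IsRegularTriple.mem_range [IsDomain R] {ι : Type} {a b c : R} (h : IsRegularTriple a b c)
    (A : (ι → R) →ₗ[R] R) [Module.Projective R (LinearMap.ker A)] {y : R}
    (ha : a * y ∈ LinearMap.range A) (hb : b * y ∈ LinearMap.range A)
    (hc : c * y ∈ LinearMap.range A) : y ∈ LinearMap.range A := by
  obtain ⟨w₁, h₁⟩ := ha
  obtain ⟨w₂, h₂⟩ := hb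
  obtain ⟨w₃, h₃⟩ := hc
  let c₁₂ : LinearMap.ker A := ⟨b • w₁ - a • w₂, by
    simp only [LinearMap.mem_ker, map_sub, map_smul, h₁, h₂, smul_eq_mul]; ring⟩
  let c₁₃ : LinearMap.ker A := ⟨c • w₁ - a • w₃, by
    simp only [LinearMap.mem_ker, map_sub, map_smul, h₁, h₃, smul_eq_mul]; ring⟩
  let c₂₃ : LinearMap.ker A := ⟨c • w₂ - b • w₃, by
    simp only [LinearMap.mem_ker, map_sub, map_smul, h₃, h₂, smul_eq_mul]; ring⟩
  obtain ⟨u, v, huv⟩ := h.exists_eq_add (x := c₁₂) (y := -c₂₃) (z := c₁₃) (by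
    ext i
    simp [c₁₂, c₁₃, c₂₃]; ring)
  have huv' : ∀ i, b * w₁ i - a * w₂ i = a * u.1 i + b * v.1 i := by
    intro i
    have := congrArg (fun w : LinearMap.ker A => w.1 i) huv
    simpa [c₁₂] using this
  have hd : ∀ i, ∃ t, w₁ i - v.1 i = a * t := by
    intro i
    refine h.dvd _ ⟨w₂ i + u.1 i, ?_⟩
    linear_combination huv' i
  choose t ht using hd
  refine ⟨t, mul_left_cancel₀ h.ne_zero ?_⟩
  have h4 : w₁ = a • t + v.1 := by ext i; simp [← ht i]
  have h5 := h₁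
  rw [h4, map_add, map_smul, LinearMap.mem_ker.1 v.2, add_zero, smul_eq_mul] at h5
  exact h5

/-- An ideal generated by the entries of a row whose syzygies form a projective module is unmixed:
all the ideals `(J : y)` with `y ∉ J` lie in a prime of height at most two. -/
theorem exists_prime_height_le_two {k : Type} [Field k] {n : ℕ} {ι : Type}
    (A : (ι → MvPolynomial (Fin n) k) →ₗ[MvPolynomial (Fin n) k] MvPolynomial (Fin n) k)
    [Module.Projective (MvPolynomial (Fin n) k) (LinearMap.ker A)] {y : MvPolynomial (Fin n) k}
    (hy : y ∉ LinearMap.range A) :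
    ∃ P : Ideal (MvPolynomial (Fin n) k), P.IsPrime ∧ P.height ≤ 2 ∧
      ∀ t, t * y ∈ LinearMap.range A → t ∈ P := by
  by_contra hcon
  push Not at hcon
  set I : Ideal (MvPolynomial (Fin n) k) := Submodule.colon (LinearMap.range A) {y} with hI
  have hmem : ∀ t, t ∈ I ↔ t * y ∈ LinearMap.range A := by
    intro t
    rw [hI, Submodule.mem_colon_singleton, smul_eq_mul]
  -- If the conclusion fails, every prime over the conductor of `y` has height at least three, so
  -- the conductor contains a regular triple.
  have hht : HeightGE I 3 := by
    intro P hP hIP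
    by_contra hlt
    have h3 : P.height ≤ 2 := by
      rw [not_le] at hlt
      exact Order.le_of_lt_add_one (lt_of_lt_of_eq hlt (by norm_num))
    obtain ⟨t, ht, htP⟩ := hcon P hP h3
    exact htP (hIP ((hmem t).2 ht))
  obtain ⟨a, ha, b, hb, c, hc, habc⟩ := hht.exists_isRegularTriple
  exact hy (habc.mem_range A ((hmem _).1 ha) ((hmem _).1 hb) ((hmem _).1 hc))

end Koszul

/-! ### The determinant trick. -/

section DeterminantTrick

/-- The determinant of `t - N` kills `f`, so it vanishes in the domain `R`; modulo `P` it is a power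
of `t`. -/
theorem mem_prime_of_smul_eq_sum {R ι : Type} [CommRing R] [IsDomain R] [Fintype ι]
    [DecidableEq ι] (P : Ideal R) [hP : P.IsPrime] (f : ι → R) {i₀ : ι} (hf : f i₀ ≠ 0) (t : R)
    (N : Matrix ι ι R) (hN : ∀ i j, N i j ∈ P) (h : ∀ i, t * f i = ∑ j, N i j * f j) : t ∈ P := by
  have h1 : (t • (1 : Matrix ι ι R) - N).mulVec f = 0 := by
    rw [Matrix.sub_mulVec, Matrix.smul_mulVec, Matrix.one_mulVec, sub_eq_zero]
    funext i
    simpa [Matrix.mulVec, dotProduct] using h i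
  have h2 : (t • (1 : Matrix ι ι R) - N).det = 0 := by
    have h3 := det_mul_eq_adjugate_mulVec (t • (1 : Matrix ι ι R) - N) f i₀
    rw [h1, Matrix.mulVec_zero, Pi.zero_apply] at h3
    exact (mul_eq_zero.1 h3).resolve_right hf
  have h4 : Ideal.Quotient.mk P (t • (1 : Matrix ι ι R) - N).det =
      Ideal.Quotient.mk P t ^ Fintype.card ι := by
    rw [RingHom.map_det]
    have : (Ideal.Quotient.mk P).mapMatrix (t • (1 : Matrix ι ι R) - N) =
        (Ideal.Quotient.mk P t) • (1 : Matrix ι ι (R ⧸ P)) := by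
      ext i j
      simp only [RingHom.mapMatrix_apply, Matrix.map_apply, Matrix.sub_apply, Matrix.smul_apply,
        map_sub, Ideal.Quotient.eq_zero_iff_mem.2 (hN i j), sub_zero, smul_eq_mul, map_mul]
      rw [Matrix.one_apply, Matrix.one_apply]
      split_ifs <;> simp
    rw [this, Matrix.det_smul, Matrix.det_one, mul_one]
  rw [h2, map_zero, ← map_pow, eq_comm, Ideal.Quotient.eq_zero_iff_mem] at h4
  exact hP.mem_of_pow_mem _ h4

end DeterminantTrick

end ToricKupka

namespace ToricKupka

/-! ### Codimension of determinantal loci. -/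

section MaximalMinors

theorem exists_dual_ne_zero_of_span_ne_top {K ι : Type} [Field K] [Fintype ι] [DecidableEq ι]
    {s : Set (ι → K)} (hs : Submodule.span K s ≠ ⊤) :
    ∃ w : ι → K, w ≠ 0 ∧ ∀ v ∈ s, ∑ i, w i * v i = 0 := by
  obtain ⟨f, hf, hle⟩ := Submodule.exists_le_ker_of_lt_top _ (lt_top_iff_ne_top.2 hs)
  have hf' : ∀ v, f v = ∑ i, f (Pi.single i 1) * v i := by
    intro v
    conv_lhs => rw [LinearMap.pi_apply_eq_sum_univ f v]
    refine Finset.sum_congr rfl fun i _ => ?_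
    rw [smul_eq_mul, mul_comm]
    congr 2
    ext j
    rw [Pi.single_apply]
    simp [eq_comm]
  refine ⟨fun i => f (Pi.single i 1), fun h0 => hf ?_, fun v hv => ?_⟩
  · ext v
    have : ∀ i, f (Pi.single i 1) = 0 := fun i => congrFun h0 i
    simp [this]
  · rw [← hf' v]
    exact hle (Submodule.subset_span hv)

theorem exists_vecMul_eq_zero_of_minors {K : Type} [Field K] {m r : ℕ}
    (A : Matrix (Fin m) (Fin r) K) (h : ∀ f : Fin m → Fin r, (A.submatrix id f).det = 0) :
    ∃ w : Fin m → K, w ≠ 0 ∧ ∀ j, ∑ i, w i * A i j = 0 := by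
  by_cases hs : Submodule.span K (Set.range fun j => fun i => A i j) = ⊤
  · exfalso
    obtain ⟨κ, a, ha, hspan, hli⟩ := exists_linearIndependent' K (fun j => fun i => A i j)
    rw [hs] at hspan
    have : Finite κ := Finite.of_injective a ha
    have := Fintype.ofFinite κ
    have b : Module.Basis κ K (Fin m → K) := Module.Basis.mk hli hspan.ge
    have hcard : Fintype.card (Fin m) = Fintype.card κ := by
      rw [Fintype.card_fin, ← Module.finrank_eq_card_basis b]; simp
    let e : Fin m ≃ κ := Fintype.equivOfCardEq hcard
    have h1 : LinearIndependent K (A.submatrix id (a ∘ e)).col := hli.comp e e.injective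
    have h2 := Matrix.linearIndependent_cols_iff_isUnit.1 h1
    rw [Matrix.isUnit_iff_isUnit_det, h] at h2
    exact not_isUnit_zero h2
  · obtain ⟨w, hw, hws⟩ := exists_dual_ne_zero_of_span_ne_top hs
    exact ⟨w, hw, fun j => hws _ ⟨j, rfl⟩⟩

/-- The rows of the matrix are linearly dependent over the residue field of the prime `Q`. -/
def RankDrops {R κ ι : Type} [CommRing R] [Fintype κ] (M : Matrix κ ι R) (Q : Ideal R) : Prop :=
  ∃ w : κ → R, (∃ i, w i ∉ Q) ∧ ∀ j, ∑ i, w i * M i j ∈ Q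

theorem RankDrops.det_mem {R : Type} [CommRing R] {m r : ℕ} {M : Matrix (Fin m) (Fin r) R}
    {Q : Ideal R} [hQ : Q.IsPrime] (h : RankDrops M Q) (f : Fin m → Fin r) :
    (M.submatrix id f).det ∈ Q := by
  obtain ⟨w, ⟨i, hi⟩, hw⟩ := h
  have h1 := det_mul_eq_adjugate_mulVec (M.submatrix id f).transpose w i
  rw [Matrix.det_transpose] at h1
  refine (hQ.mem_or_mem (?_ : (M.submatrix id f).det * w i ∈ Q)).resolve_right hi
  rw [h1, Matrix.mulVec, dotProduct]
  refine Ideal.sum_mem _ fun j _ => Ideal.mul_mem_left _ _ ?_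
  have := hw (f j)
  simpa [Matrix.mulVec, dotProduct, mul_comm] using this

/-- Over the fraction field of `R ⧸ Q` all maximal minors vanish, which gives a row dependence; its
denominators are cleared. -/
theorem rankDrops_of_det_mem {R : Type} [CommRing R] {m r : ℕ} {M : Matrix (Fin m) (Fin r) R}
    {Q : Ideal R} [hQ : Q.IsPrime] (h : ∀ f : Fin m → Fin r, (M.submatrix id f).det ∈ Q) :
    RankDrops M Q := by
  let K := FractionRing (R ⧸ Q)
  let φ : R →+* K := (algebraMap (R ⧸ Q) K).comp (Ideal.Quotient.mk Q)
  have hφ : ∀ x, φ x = 0 ↔ x ∈ Q := by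
    intro x
    rw [← Ideal.Quotient.eq_zero_iff_mem]
    exact map_eq_zero_iff _ (IsFractionRing.injective (R ⧸ Q) K)
  obtain ⟨w, hw, hwM⟩ := exists_vecMul_eq_zero_of_minors (M.map φ) (by
    intro f
    have h1 := (hφ _).2 (h f)
    rw [RingHom.map_det] at h1
    exact h1)
  obtain ⟨b, hb⟩ := IsLocalization.exist_integer_multiples_of_finite (nonZeroDivisors (R ⧸ Q)) w
  choose u hu using hb
  have hb0 : algebraMap (R ⧸ Q) K b ≠ 0 :=
    IsFractionRing.to_map_ne_zero_of_mem_nonZeroDivisors b.2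
  choose w' hw' using fun i => Ideal.Quotient.mk_surjective (u i)
  have hww : ∀ i, φ (w' i) = algebraMap (R ⧸ Q) K b * w i := by
    intro i
    show algebraMap (R ⧸ Q) K (Ideal.Quotient.mk Q (w' i)) = _
    rw [hw', hu, Algebra.smul_def]
  refine ⟨w', ?_, fun j => ?_⟩
  · obtain ⟨i, hi⟩ := Function.ne_iff.1 hw
    refine ⟨i, fun hiQ => ?_⟩
    rw [← hφ, hww] at hiQ
    exact hi ((mul_eq_zero.1 hiQ).resolve_left hb0)
  · rw [← hφ, map_sum]
    have := hwM j
    simp only [map_mul, hww, mul_assoc]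
    rw [← Finset.mul_sum]
    simp only [Matrix.map_apply] at this
    rw [this, mul_zero]

theorem RankDrops.mono {R : Type} [CommRing R] {m r : ℕ} {M : Matrix (Fin m) (Fin r) R}
    {Q Q' : Ideal R} [hQ : Q.IsPrime] [hQ' : Q'.IsPrime] (h : RankDrops M Q) (hle : Q ≤ Q') :
    RankDrops M Q' :=
  rankDrops_of_det_mem fun f => hle (h.det_mem f)

/-- The Schur complement (without denominators) of an entry. -/
def schur {R : Type} [CommRing R] {m r : ℕ} (M : Matrix (Fin (m + 1)) (Fin (r + 1)) R)
    (i₀ : Fin (m + 1)) (j₀ : Fin (r + 1)) : Matrix (Fin m) (Fin r) R :=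
  Matrix.of fun i j => M i₀ j₀ * M (i₀.succAbove i) (j₀.succAbove j) -
    M (i₀.succAbove i) j₀ * M i₀ (j₀.succAbove j)

/-- Gaussian elimination with the pivot `M i₀ j₀`, which is invertible at `Q`. -/
theorem rankDrops_schur_iff {R : Type} [CommRing R] {m r : ℕ}
    (M : Matrix (Fin (m + 1)) (Fin (r + 1)) R) (i₀ : Fin (m + 1)) (j₀ : Fin (r + 1))
    (Q : Ideal R) [hQ : Q.IsPrime] (hu : M i₀ j₀ ∉ Q) :
    RankDrops (schur M i₀ j₀) Q ↔ RankDrops M Q := by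
  constructor
  · rintro ⟨w, ⟨i, hi⟩, hw⟩
    refine ⟨i₀.insertNth (-∑ i, w i * M (i₀.succAbove i) j₀) (fun i => M i₀ j₀ * w i),
      ⟨i₀.succAbove i, ?_⟩, fun j => ?_⟩
    · rw [Fin.insertNth_apply_succAbove]
      exact fun h => (hQ.mem_or_mem h).elim hu hi
    · rw [Fin.sum_univ_succAbove _ i₀]
      simp only [Fin.insertNth_apply_same, Fin.insertNth_apply_succAbove]
      rcases Fin.eq_self_or_eq_succAbove j₀ j with rfl | ⟨j, rfl⟩
      · convert zero_mem Q using 1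
        rw [neg_mul, Finset.sum_mul, neg_add_eq_zero]
        exact Finset.sum_congr rfl fun i _ => by ring
      · convert hw j using 1
        rw [neg_mul, Finset.sum_mul, ← Finset.sum_neg_distrib, ← Finset.sum_add_distrib]
        refine Finset.sum_congr rfl fun i _ => ?_
        simp only [schur, Matrix.of_apply]
        ring
  · rintro ⟨w, hi, hw⟩
    refine ⟨fun i => w (i₀.succAbove i), ?_, fun j => ?_⟩
    · by_contra hcon
      push Not at hcon
      obtain ⟨i, hi⟩ := hi
      rcases Fin.eq_self_or_eq_succAbove i₀ i with rfl | ⟨i, rfl⟩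
      · have h1 := hw j₀
        rw [Fin.sum_univ_succAbove _ i, Ideal.add_mem_iff_left _
          (Ideal.sum_mem _ fun k _ => Ideal.mul_mem_right _ _ (hcon k))] at h1
        exact (hQ.mem_or_mem h1).elim hi hu
      · exact hi (hcon i)
    · have h1 := hw j₀
      have h2 := hw (j₀.succAbove j)
      rw [Fin.sum_univ_succAbove _ i₀] at h1 h2
      convert Ideal.sub_mem _ (Ideal.mul_mem_left _ (M i₀ j₀) h2)
        (Ideal.mul_mem_left _ (M i₀ (j₀.succAbove j)) h1) using 1
      simp only [schur, Matrix.of_apply, mul_add, Finset.mul_sum]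
      rw [add_sub_add_comm, ← Finset.sum_sub_distrib]
      have : M i₀ j₀ * (w i₀ * M i₀ (j₀.succAbove j)) -
        M i₀ (j₀.succAbove j) * (w i₀ * M i₀ j₀) = 0 := by ring
      rw [this, zero_add]
      exact Finset.sum_congr rfl fun i _ => by ring

/-- `P` is minimal among the primes containing `T` at which the rank of `M` drops. -/
structure IsMinimalDrop {R : Type} [CommRing R] {m r : ℕ} (M : Matrix (Fin m) (Fin r) R)
    (T : Finset R) (P : Ideal R) : Prop where
  prime : P.IsPrime
  subset : (T : Set R) ⊆ P
  drops : RankDrops M P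
  minimal : ∀ Q : Ideal R, Q.IsPrime → (T : Set R) ⊆ Q → RankDrops M Q → Q ≤ P → P ≤ Q

theorem IsMinimalDrop.schur {R : Type} [CommRing R] {m r : ℕ}
    {M : Matrix (Fin (m + 1)) (Fin (r + 1)) R} {T : Finset R} {P : Ideal R}
    (h : IsMinimalDrop M T P) (i₀ : Fin (m + 1)) (j₀ : Fin (r + 1)) (hu : M i₀ j₀ ∉ P) :
    IsMinimalDrop (schur M i₀ j₀) T P := by
  have := h.prime
  refine ⟨h.prime, h.subset, (rankDrops_schur_iff M i₀ j₀ P hu).2 h.drops,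
    fun Q hQ hT hd hle => h.minimal Q hQ hT ?_ hle⟩
  exact (rankDrops_schur_iff M i₀ j₀ Q fun hQu => hu (hle hQu)).1 hd

-- When all entries lie in `P` there is no pivot; adding `X` to one entry creates one, while row `1`
-- still vanishes modulo the extended prime. If the rank dropped at a smaller `Q`, setting `X = 0`
-- and using minimality of `P` would make `P + (X)` minimal over `Q + (X)`. By Krull's theorem it
-- would have height at most one over `Q`, against the chain `Q < P[X] < P + (X)`.
open Polynomial in
theorem IsMinimalDrop.polynomial {R : Type} [CommRing R] [IsNoetherianRing R] {m r : ℕ}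
    {M : Matrix (Fin (m + 2)) (Fin (r + 1)) R} {T : Finset R} {P : Ideal R} [DecidableEq R[X]]
    (h : IsMinimalDrop M T P) (hM : ∀ i j, M i j ∈ P) :
    IsMinimalDrop (M.map C + Matrix.single 0 0 (X : R[X])) (T.image C) (P.map C) := by
  have hP := h.prime
  set M' := M.map C + Matrix.single 0 0 (X : R[X]) with hM'
  have hPC : (P.map C).IsPrime := Ideal.isPrime_map_C_of_isPrime
  refine ⟨hPC, ?_, ⟨Pi.single 1 1, ⟨1, ?_⟩, fun j => ?_⟩, fun Q hQ hT hd hle => ?_⟩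
  · intro x hx
    obtain ⟨t, ht, rfl⟩ := Finset.mem_image.1 (Finset.mem_coe.1 hx)
    exact Ideal.mem_map_of_mem _ (h.subset ht)
  · rw [Pi.single_eq_same]
    exact fun h1 => hPC.ne_top ((Ideal.eq_top_iff_one _).2 h1)
  · rw [Finset.sum_eq_single 1]
    · rw [Pi.single_eq_same, one_mul, hM', Matrix.add_apply, Matrix.single_apply_of_row_ne
        (by simp), add_zero]
      exact Ideal.mem_map_of_mem _ (hM 1 j)
    · intro i _ hi
      rw [Pi.single_eq_of_ne hi, zero_mul]
    · simp
  · by_contra hne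
    have hlt : Q < P.map C := lt_of_le_not_ge hle hne
    set N : Ideal R[X] := P.comap constantCoeff with hN
    have hNp : N.IsPrime := Ideal.comap_isPrime _ _
    have hPN : P.map C ≤ N := by
      rw [Ideal.map_le_iff_le_comap]
      intro x hx
      simpa [hN, Ideal.mem_comap] using hx
    have hXN : X ∈ N := by simp [hN, Ideal.mem_comap]
    have hX : X ∉ P.map C := by
      intro hX
      have := Ideal.mem_map_C_iff.1 hX 1
      rw [coeff_X_one] at this
      exact hP.ne_top ((Ideal.eq_top_iff_one _).2 this)
    have hmin : N ∈ (Q ⊔ Ideal.span {X}).minimalPrimes := by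
      refine ⟨⟨hNp, sup_le (hle.trans hPN) ?_⟩, ?_⟩
      · rw [Ideal.span_le, Set.singleton_subset_iff]; exact hXN
      · rintro Q' ⟨hQ', hQQ'⟩ hQN
        have hQ1 : Q ≤ Q' := le_sup_left.trans hQQ'
        have hX1 : X ∈ Q' := hQQ' (Ideal.mem_sup_right (Ideal.mem_span_singleton_self _))
        have hcoeff : ∀ f : R[X], f ∈ Q' ↔ C (f.coeff 0) ∈ Q' := by
          intro f
          conv_lhs => rw [← divX_mul_X_add f]
          exact Ideal.add_mem_iff_right _ (Ideal.mul_mem_left _ _ hX1)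
        have hle' : Q'.comap C ≤ P := by
          intro x hx
          have := hQN hx
          simpa [hN, Ideal.mem_comap] using this
        have hdrop : RankDrops M (Q'.comap C) := by
          obtain ⟨w, ⟨i, hi⟩, hw⟩ := hd.mono hQ1
          refine ⟨fun i => (w i).coeff 0, ⟨i, fun hi' => hi ((hcoeff _).2 hi')⟩, fun j => ?_⟩
          have h1 := (hcoeff _).1 (hw j)
          rw [Ideal.mem_comap]
          convert h1 using 2
          rw [finsetSum_coeff]
          refine Finset.sum_congr rfl fun i _ => ?_
          rw [mul_coeff_zero]
          congr 1
          rw [hM', Matrix.add_apply, coeff_add, Matrix.map_apply, coeff_C_zero,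
            Matrix.single_apply]
          split_ifs <;> simp
        have hPQ := h.minimal (Q'.comap C) (Ideal.comap_isPrime _ _) (by
          intro t ht
          rw [SetLike.mem_coe, Ideal.mem_comap]
          exact hQ1 (hT (Finset.mem_coe.2 (Finset.mem_image_of_mem C (Finset.mem_coe.1 ht)))))
            hdrop hle'
        intro f hf
        rw [hcoeff]
        exact hPQ hf
    have hht := Ideal.map_height_le_one_of_mem_minimalPrimes hmin
    have hQN : Q ≤ N := hle.trans hPN
    have p1 : ((P.map C).map (Ideal.Quotient.mk Q)).IsPrime :=
      Ideal.map_isPrime_of_surjective Ideal.Quotient.mk_surjective (by rw [Ideal.mk_ker]; exact hle)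
    have p2 : (N.map (Ideal.Quotient.mk Q)).IsPrime :=
      Ideal.map_isPrime_of_surjective Ideal.Quotient.mk_surjective (by rw [Ideal.mk_ker]; exact hQN)
    have l1 : (⊥ : Ideal (R[X] ⧸ Q)) < (P.map C).map (Ideal.Quotient.mk Q) := by
      rw [bot_lt_iff_ne_bot]
      intro h0
      apply hne
      intro x hx
      have := Ideal.mem_map_of_mem (Ideal.Quotient.mk Q) hx
      rwa [h0, Ideal.mem_bot, Ideal.Quotient.eq_zero_iff_mem] at this
    have l2 : (P.map C).map (Ideal.Quotient.mk Q) < N.map (Ideal.Quotient.mk Q) := by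
      refine lt_of_le_not_ge (Ideal.map_mono hPN) fun hge => hX ?_
      have := hge (Ideal.mem_map_of_mem (Ideal.Quotient.mk Q) hXN)
      rwa [Ideal.mem_quotient_iff_mem hle] at this
    have a1 := Ideal.height_add_one_le_of_lt_of_isPrime l1
    have a2 := Ideal.height_add_one_le_of_lt_of_isPrime l2
    have a3 := ((add_le_add_left a1 1).trans a2).trans hht
    rw [Ideal.height_bot] at a3
    exact absurd a3 (by norm_num)

open Polynomial in
theorem height_le_height_map_C {R : Type} [CommRing R] [IsNoetherianRing R] (P : Ideal R)
    [hP : P.IsPrime] : P.height ≤ (P.map (C : R →+* R[X])).height := by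
  have hPC : (P.map (C : R →+* R[X])).IsPrime := Ideal.isPrime_map_C_of_isPrime
  have : (P.map (C : R →+* R[X])).LiesOver P := ⟨by
    ext x
    show x ∈ P ↔ C x ∈ P.map C
    rw [Ideal.mem_map_C_iff]
    refine ⟨fun h n => ?_, fun h => by simpa using h 0⟩
    rw [coeff_C]; split_ifs
    · exact h
    · exact zero_mem _⟩
  rw [Ideal.height_eq_height_add_of_liesOver_of_hasGoingDown P (P.map (C : R →+* R[X]))]
  exact le_self_add

/-- The Eagon–Northcott bound for the codimension of a determinantal locus. -/
theorem IsMinimalDrop.height_add_le {m : ℕ} : ∀ {R : Type} [CommRing R] [IsNoetherianRing R]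
    {r : ℕ} {M : Matrix (Fin m) (Fin r) R} {T : Finset R} {P : Ideal R},
    IsMinimalDrop M T P → m ≤ r + 1 → P.height + m ≤ r + 1 + T.card := by
  induction m with
  | zero =>
    intro R _ _ r M T P h _
    obtain ⟨w, ⟨i, -⟩, -⟩ := h.drops
    exact i.elim0
  | succ m ih =>
    intro R _ _ r M T P h hmr
    classical
    have hP := h.prime
    -- With one row the rank drops where the row vanishes: this is Krull's height theorem for its
    -- `r` entries together with `T`.
    rcases m with _ | m
    · have hmin : P ∈ (Ideal.span ((T ∪ Finset.univ.image (M 0) : Finset R) : Set R)).minimalPrimes := by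
        refine ⟨⟨hP, ?_⟩, ?_⟩
        · rw [Ideal.span_le, Finset.coe_union, Set.union_subset_iff]
          refine ⟨h.subset, ?_⟩
          intro x hx
          obtain ⟨j, -, rfl⟩ := Finset.mem_image.1 (Finset.mem_coe.1 hx)
          obtain ⟨w, ⟨i, hi⟩, hw⟩ := h.drops
          have := hw j
          rw [Fin.sum_univ_one] at this
          rw [show i = 0 from Fin.ext (by omega)] at hi
          exact (hP.mem_or_mem this).resolve_left hi
        · rintro Q ⟨hQ, hTQ⟩ hle
          rw [Ideal.span_le, Finset.coe_union, Set.union_subset_iff] at hTQ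
          refine h.minimal Q hQ hTQ.1 ⟨1, ⟨0, fun h1 => hQ.ne_top ((Ideal.eq_top_iff_one _).2 h1)⟩,
            fun j => ?_⟩ hle
          rw [Fin.sum_univ_one, Pi.one_apply, one_mul]
          exact hTQ.2 (by simp)
      have h1 := Ideal.height_le_card_of_mem_minimalPrimes_span_finset hmin
      have h2 : (T ∪ Finset.univ.image (M 0)).card ≤ T.card + r :=
        (Finset.card_union_le _ _).trans (add_le_add_right
          (Finset.card_image_le.trans (by simp)) _)
      have h3 : P.height ≤ (T.card + r : ℕ) := h1.trans (by exact_mod_cast h2)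
      calc P.height + (0 + 1 : ℕ) ≤ (T.card + r : ℕ) + (0 + 1 : ℕ) := by gcongr
        _ = (r : ℕ∞) + 1 + T.card := by push_cast; ring
    · obtain ⟨r, rfl⟩ : ∃ r', r = r' + 1 := ⟨r - 1, by omega⟩
      -- A pivot outside the prime removes one row and one column, which lowers both sides of the
      -- bound by one.
      have hstep : ∀ {S : Type} [CommRing S] [IsNoetherianRing S]
          {N : Matrix (Fin (m + 2)) (Fin (r + 1)) S} {U : Finset S} {Q : Ideal S},
          IsMinimalDrop N U Q → (∃ i j, N i j ∉ Q) →
          Q.height + (m + 1 + 1 : ℕ) ≤ (r + 1 : ℕ) + 1 + U.card := by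
        intro S _ _ N U Q hN ⟨i, j, hij⟩
        have := add_le_add_left (ih (hN.schur i j hij) (by omega)) 1
        calc Q.height + (m + 1 + 1 : ℕ) = Q.height + (m + 1 : ℕ) + 1 := by push_cast; ring
          _ ≤ _ := this
          _ = _ := by push_cast; ring
      by_cases hM : ∃ i j, M i j ∉ P
      · exact hstep h hM
      · push Not at hM
        -- Without a pivot the matrix is deformed by an indeterminate; the extended prime has at
        -- least the height of `P`.
        have hpoly := h.polynomial hM
        have h1 := hstep hpoly ⟨0, 0, by
          intro h0
          have := Ideal.mem_map_C_iff.1 h0 1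
          simp at this
          exact hP.ne_top ((Ideal.eq_top_iff_one _).2 this)⟩
        calc P.height + (m + 1 + 1 : ℕ)
            ≤ (P.map Polynomial.C).height + (m + 1 + 1 : ℕ) := by
              gcongr; exact height_le_height_map_C P
          _ ≤ _ := h1
          _ ≤ _ := by gcongr; exact Finset.card_image_le

end MaximalMinors

end ToricKupka

namespace ToricKupka

/-! ### Coordinate primes, zeros of primes and heights of points. -/

section Coordinates

open MvPolynomial

variable {σ k : Type} [Field k]

theorem isPrime_span_X_image (s : Set σ) :
    (Ideal.span ((X : σ → MvPolynomial σ k) '' s)).IsPrime := by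
  classical
  let κ : MvPolynomial σ k →ₐ[k] MvPolynomial σ k := aeval fun i => if i ∈ s then 0 else X i
  have h1 : ∀ f, f - κ f ∈ Ideal.span ((X : σ → MvPolynomial σ k) '' s) := by
    intro f
    induction f using MvPolynomial.induction_on with
    | C a => simp [κ]
    | add p q hp hq =>
      have : p + q - κ (p + q) = (p - κ p) + (q - κ q) := by rw [map_add]; ring
      rw [this]; exact add_mem hp hq
    | mul_X p i hp =>
      have : p * X i - κ (p * X i) = X i * (p - κ p) + κ p * (X i - κ (X i)) := by
        rw [map_mul]; ring
      rw [this]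
      refine add_mem (Ideal.mul_mem_left _ _ hp) (Ideal.mul_mem_left _ _ ?_)
      by_cases hi : i ∈ s
      · simpa [κ, hi] using Ideal.subset_span (Set.mem_image_of_mem X hi)
      · simp [κ, hi]
  have h2 : Ideal.span ((X : σ → MvPolynomial σ k) '' s) = RingHom.ker κ := by
    apply le_antisymm
    · rw [Ideal.span_le]
      rintro _ ⟨i, hi, rfl⟩
      simp [κ, hi]
    · intro f hf
      have := h1 f
      rwa [(RingHom.mem_ker).1 hf, sub_zero] at this
  rw [h2]
  exact RingHom.ker_isPrime _

theorem card_le_height_span_X (s : Finset σ) :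
    (s.card : ℕ∞) ≤ (Ideal.span ((X : σ → MvPolynomial σ k) '' s)).height := by
  classical
  induction s using Finset.induction_on with
  | empty => simp
  | insert a s ha ih =>
    have p1 := isPrime_span_X_image (k := k) (s : Set σ)
    have p2 := isPrime_span_X_image (k := k) ((insert a s : Finset σ) : Set σ)
    have hlt : Ideal.span ((X : σ → MvPolynomial σ k) '' s) <
        Ideal.span ((X : σ → MvPolynomial σ k) '' ((insert a s : Finset σ) : Set σ)) := by
      refine lt_of_le_not_ge (Ideal.span_mono (Set.image_mono (by simp))) fun hge => ha ?_
      have h1 : (X a : MvPolynomial σ k) ∈ Ideal.span ((X : σ → MvPolynomial σ k) '' s) :=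
        hge (Ideal.subset_span ⟨a, by simp, rfl⟩)
      rw [mem_ideal_span_X_image] at h1
      obtain ⟨i, hi, h⟩ := h1 (Finsupp.single a 1) (by simp)
      rw [Finsupp.single_apply] at h
      have : a = i := by by_contra hne; simp [hne] at h
      subst this
      exact hi
    rw [Finset.card_insert_of_notMem ha]
    push_cast
    refine (add_le_add_left ih 1).trans ?_
    rw [← Finset.coe_insert]
    exact Ideal.height_add_one_le_of_lt_of_isPrime hlt

theorem card_le_height_of_X_mem (s : Finset σ) (P : Ideal (MvPolynomial σ k))
    (h : ∀ i ∈ s, X i ∈ P) : (s.card : ℕ∞) ≤ P.height := by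
  refine (card_le_height_span_X (k := k) s).trans (Ideal.height_mono ?_)
  rw [Ideal.span_le]
  rintro _ ⟨i, hi, rfl⟩
  exact h i hi

theorem exists_eval_ne_zero {n : ℕ} (P : Ideal (MvPolynomial (Fin n) ℂ)) [hP : P.IsPrime]
    {f : MvPolynomial (Fin n) ℂ} (hf : f ∉ P) :
    ∃ x : Fin n → ℂ, (∀ p ∈ P, eval x p = 0) ∧ eval x f ≠ 0 := by
  by_contra hcon
  push Not at hcon
  apply hf
  rw [← IsPrime.vanishingIdeal_zeroLocus (K := ℂ) P, mem_vanishingIdeal_iff]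
  intro x hx
  have : ∀ p ∈ P, eval x p = 0 := fun p hp => by
    have := (mem_zeroLocus_iff.1 hx) p hp
    rwa [aeval_eq_eval] at this
  rw [aeval_eq_eval]
  exact hcon x this

/-- Below height `n` some coordinate is outside `P`. A zero of `P` at which `f` times this
coordinate does not vanish is not the origin. -/
theorem exists_ne_zero_of_height_lt {n : ℕ} (P : Ideal (MvPolynomial (Fin n) ℂ)) [hP : P.IsPrime]
    (hn : P.height < n) {f : MvPolynomial (Fin n) ℂ} (hf : f ∉ P) :
    ∃ x : Fin n → ℂ, x ≠ 0 ∧ (∀ p ∈ P, eval x p = 0) ∧ eval x f ≠ 0 := by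
  have : ∃ i : Fin n, X i ∉ P := by
    by_contra hcon
    push Not at hcon
    have := card_le_height_of_X_mem Finset.univ P (fun i _ => hcon i)
    simp only [Finset.card_univ, Fintype.card_fin] at this
    exact absurd hn (not_lt.2 this)
  obtain ⟨i, hi⟩ := this
  obtain ⟨x, hx, hxf⟩ := exists_eval_ne_zero P (f := f * X i) (fun h =>
    (hP.mem_or_mem h).elim hf hi)
  rw [map_mul, eval_X] at hxf
  refine ⟨x, ?_, hx, left_ne_zero_of_mul hxf⟩
  rintro rfl
  simp at hxf

theorem height_pointIdeal {n : ℕ} (x : Fin n → ℂ) :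
    (RingHom.ker (eval x)).height = n := by
  let e : MvPolynomial (Fin n) ℂ ≃ₐ[ℂ] MvPolynomial (Fin n) ℂ :=
    AlgEquiv.ofAlgHom (aeval fun i => X i - C (x i)) (aeval fun i => X i + C (x i))
      (by ext i; simp) (by ext i; simp)
  have hp : (RingHom.ker (eval x)).IsPrime := RingHom.ker_isPrime _
  have h1 : (RingHom.ker (eval x)).height = (RingHom.ker (eval (0 : Fin n → ℂ))).height := by
    rw [← RingEquiv.height_comap e.toRingEquiv]
    congr 1
    ext f
    rw [Ideal.mem_comap, RingHom.mem_ker, RingHom.mem_ker]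
    have : eval x (e.toRingEquiv f) = eval 0 f := by
      show eval x (aeval (fun i => X i - C (x i)) f) = eval 0 f
      induction f using MvPolynomial.induction_on with
      | C a => simp
      | add p q hp hq => rw [map_add, map_add, hp, hq, map_add]
      | mul_X p i hp => rw [map_mul, map_mul, hp, map_mul]; simp
    rw [this]
  apply le_antisymm
  · have h2 := Ideal.height_le_ringKrullDim_of_isPrime (I := RingHom.ker (eval x))
    rw [MvPolynomial.ringKrullDim_of_isNoetherianRing, ringKrullDim_eq_zero_of_field] at h2
    simp only [Nat.card_eq_fintype_card, Fintype.card_fin, zero_add] at h2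
    exact_mod_cast h2
  · rw [h1]
    have := card_le_height_of_X_mem Finset.univ (RingHom.ker (eval (0 : Fin n → ℂ)))
      (fun i _ => by simp [RingHom.mem_ker])
    simpa using this

theorem pderiv_comm {σ R : Type} [CommRing R] (i j : σ) (f : MvPolynomial σ R) :
    pderiv i (pderiv j f) = pderiv j (pderiv i f) := by
  classical
  have h : ⁅pderiv (R := R) i, pderiv j⁆ = (0 : Derivation R (MvPolynomial σ R) (MvPolynomial σ R)) := by
    apply MvPolynomial.derivation_ext
    intro l
    rw [Derivation.commutator_apply, pderiv_X, pderiv_X]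
    have : ∀ a b : σ, pderiv (R := R) a (Pi.single (M := fun _ => MvPolynomial σ R) b 1 l) = 0 := by
      intro a b
      rw [Pi.single_apply]
      split_ifs <;> simp
    rw [this, this]
    simp
  have := congrArg (fun D => D f) h
  simpa [Derivation.commutator_apply, sub_eq_zero] using this

end Coordinates

/-! ### Heights and conductors under flat ring maps. -/

section Flat

theorem height_comap_le_of_flat {S R : Type} [CommRing S] [CommRing R] [IsNoetherianRing S]
    [IsNoetherianRing R] (φ : S →+* R) (hφ : φ.Flat) (P : Ideal R) [P.IsPrime] :
    (P.comap φ).height ≤ P.height := by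
  let := φ.toAlgebra
  have : Module.Flat S R := hφ
  have hp : (P.comap φ).IsPrime := Ideal.comap_isPrime _ _
  have : P.LiesOver (P.comap φ) := ⟨rfl⟩
  rw [Ideal.height_eq_height_add_of_liesOver_of_hasGoingDown (P.comap φ) P]
  exact le_self_add

theorem HeightGE.map_of_flat {S R : Type} [CommRing S] [CommRing R] [IsNoetherianRing S]
    [IsNoetherianRing R] (φ : S →+* R) (hφ : φ.Flat) {I : Ideal S} {r : ℕ∞} (h : HeightGE I r) :
    HeightGE (I.map φ) r := fun P hP hI =>
  (h _ (Ideal.comap_isPrime _ _) (Ideal.map_le_iff_le_comap.1 hI)).trans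
    (height_comap_le_of_flat φ hφ P)

/-- Conductor ideals commute with flat base change. -/
theorem mem_map_colon_of_flat {S R ι : Type} [CommRing S] [CommRing R] [Fintype ι]
    [IsNoetherianRing S] (φ : S →+* R) (hφ : φ.Flat) (J : Ideal S) (c : ι → S) {h : R}
    (hh : ∀ i, h * φ (c i) ∈ J.map φ) :
    h ∈ (J.colon (Set.range c)).map φ := by
  classical
  let := φ.toAlgebra
  have : Module.Flat S R := hφ
  have hsmul : ∀ (s : S) (r : R), s • r = φ s * r := fun _ _ => rfl
  obtain ⟨q, g, hg⟩ := Submodule.fg_iff_exists_fin_generating_family.1 (IsNoetherian.noetherian J)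
  have hJ : J.map φ = Ideal.span (Set.range fun l => φ (g l)) := by
    rw [← hg]
    show Ideal.map φ (Ideal.span _) = _
    rw [Ideal.map_span, ← Set.range_comp]
    rfl
  have hr : ∀ i, ∃ r : Fin q → R, ∑ l, r l * φ (g l) = h * φ (c i) := by
    intro i
    have := hh i
    rw [hJ] at this
    exact (Ideal.mem_span_range_iff_exists_fun).1 this
  choose r hr using hr
  let x : S × (ι × Fin q → S) →ₗ[S] R :=
    (LinearMap.toSpanSingleton S R h).coprod
      (-(Fintype.linearCombination S (fun p : ι × Fin q => r p.1 p.2)))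
  let f : (ι → S) →ₗ[S] S × (ι × Fin q → S) :=
    LinearMap.prod (Fintype.linearCombination S c)
      (LinearMap.pi fun p => g p.2 • LinearMap.proj p.1)
  have hfu : ∀ u, f u = (∑ i, u i * c i, fun p => g p.2 * u p.1) := fun u => rfl
  have hxf : x ∘ₗ f = 0 := by
    apply LinearMap.ext
    intro u
    rw [LinearMap.comp_apply, hfu]
    simp only [x, LinearMap.coprod_apply,
      LinearMap.toSpanSingleton_apply, LinearMap.neg_apply, Fintype.linearCombination_apply,
      LinearMap.zero_apply, hsmul, map_sum, map_mul, Fintype.sum_prod_type]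
    rw [← sub_eq_add_neg, sub_eq_zero]
    refine Finset.sum_congr rfl fun i _ => ?_
    rw [mul_assoc, mul_comm _ h, ← hr i, Finset.mul_sum]
    exact Finset.sum_congr rfl fun l _ => by ring
  -- The equations `h φ(c i) = ∑ r φ(g l)` are `S`-linear relations in the flat module `R`. By the
  -- equational criterion they already hold in a free `S`-module, where every coordinate of the
  -- vector standing for `h` lies in the conductor.
  obtain ⟨k, a, y, hxy, haf⟩ := Module.Flat.exists_factorization_of_comp_eq_zero_of_free hxf
  have h1 : h = y (a (1, 0)) := by
    rw [← LinearMap.comp_apply, ← hxy]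
    simp [x]
  rw [h1, ← Finsupp.sum_single (a (1, 0)), Finsupp.sum, map_sum]
  refine Ideal.sum_mem _ fun t _ => ?_
  have h2 : (Finsupp.single t (a (1, 0) t) : Fin k →₀ S) = a (1, 0) t • Finsupp.single t 1 := by
    simp
  rw [h2, map_smul, hsmul]
  refine Ideal.mul_mem_right _ _ (Ideal.mem_map_of_mem φ ?_)
  rw [Submodule.mem_colon]
  rintro _ ⟨i, rfl⟩
  have h3 : a (f (Pi.single i 1)) t = 0 := by
    rw [← LinearMap.comp_apply, haf]; simp
  have h4 : f (Pi.single i 1) = c i • ((1 : S), (0 : ι × Fin q → S)) +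
      ∑ l, g l • ((0 : S), (Pi.single (i, l) 1 : ι × Fin q → S)) := by
    rw [hfu]
    apply Prod.ext
    · simp [Pi.single_apply, Prod.fst_sum]
    · funext p
      obtain ⟨p1, p2⟩ := p
      simp only [Prod.snd_add, Prod.smul_snd, smul_zero, zero_add, Prod.snd_sum,
        Finset.sum_apply, Pi.smul_apply, Pi.single_apply, smul_eq_mul, Prod.mk.injEq]
      by_cases hp : p1 = i
      · subst hp; simp
      · simp [hp]
  rw [h4, map_add, map_smul, map_sum, Finsupp.add_apply, Finsupp.smul_apply,
    Finsupp.finsetSum_apply] at h3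
  rw [smul_eq_mul, mul_comm, ← smul_eq_mul, eq_neg_of_add_eq_zero_left h3]
  refine neg_mem (Ideal.sum_mem _ fun l _ => ?_)
  rw [map_smul, Finsupp.smul_apply, smul_eq_mul]
  refine Ideal.mul_mem_right _ _ ?_
  rw [← hg]
  exact Submodule.subset_span ⟨l, rfl⟩

end Flat

end ToricKupka

namespace ToricKupka

open MvPolynomial

/-! ### Pullback of forms and integrability. -/

section Forms

variable {m n : ℕ}

/-- `J(α)` kills the class of `dα`, so the sum in the definition is just the annihilator. -/
theorem mem_kupkaIdeal {ι : Type} {A : OneForm ι} {f : MvPolynomial ι ℂ} :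
    f ∈ A.kupkaIdeal ↔ ∀ i j, f * A.d i j ∈ A.singularIdeal := by
  have h1 : ∀ f : MvPolynomial ι ℂ, f ∈ Ideal.torsionOf (MvPolynomial ι ℂ)
      (ι → ι → MvPolynomial ι ℂ ⧸ A.singularIdeal)
      (fun i j => Ideal.Quotient.mk A.singularIdeal (A.d i j)) ↔
      ∀ i j, f * A.d i j ∈ A.singularIdeal := by
    intro f
    rw [Ideal.mem_torsionOf_iff]
    constructor
    · intro h i j
      have := congrFun (congrFun h i) j
      rw [← Ideal.Quotient.eq_zero_iff_mem]
      exact this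
    · intro h
      funext i j
      exact Ideal.Quotient.eq_zero_iff_mem.2 (h i j)
  have h2 : A.singularIdeal ≤ Ideal.torsionOf (MvPolynomial ι ℂ)
      (ι → ι → MvPolynomial ι ℂ ⧸ A.singularIdeal)
      (fun i j => Ideal.Quotient.mk A.singularIdeal (A.d i j)) := by
    intro f hf
    rw [h1]
    exact fun i j => Ideal.mul_mem_right _ _ hf
  rw [OneForm.kupkaIdeal, sup_eq_left.2 h2, h1]

theorem pullback_X (F : Fin m → MvPolynomial (Fin (n + 1)) ℂ) (i : Fin m) :
    pullback F (X i) = F i := aeval_X F i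

theorem pullback_C (F : Fin m → MvPolynomial (Fin (n + 1)) ℂ) (c : ℂ) :
    pullback F (C c) = C c := aeval_C F c

theorem eval_pullback (F : Fin m → MvPolynomial (Fin (n + 1)) ℂ) (x : Fin (n + 1) → ℂ)
    (f : MvPolynomial (Fin m) ℂ) :
    eval x (pullback F f) = eval (fun i => eval x (F i)) f := by
  induction f using MvPolynomial.induction_on with
  | C a => rw [pullback_C, eval_C, eval_C]
  | add p q hp hq => simp [hp, hq]
  | mul_X p i hp => rw [map_mul, map_mul, hp, pullback_X]; simp

theorem pderiv_X_eq_ite {σ R : Type} [CommRing R] [DecidableEq σ] (j i : σ) :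
    pderiv j (X i : MvPolynomial σ R) = if j = i then 1 else 0 := by
  rw [pderiv_X, Pi.single_apply]
  simp [eq_comm]

theorem pderiv_pullback (F : Fin m → MvPolynomial (Fin (n + 1)) ℂ) (k : Fin (n + 1))
    (f : MvPolynomial (Fin m) ℂ) :
    pderiv k (pullback F f) = ∑ i, pullback F (pderiv i f) * pderiv k (F i) := by
  induction f using MvPolynomial.induction_on with
  | C a => rw [pullback_C]; simp
  | add p q hp hq => simp [hp, hq, add_mul, Finset.sum_add_distrib]
  | mul_X p i hp =>
    rw [map_mul, pderiv_mul, hp, pullback_X, Finset.sum_mul]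
    have h1 : ∀ j, pullback F (pderiv j (p * X i)) * pderiv k (F j) =
        pullback F (pderiv j p) * pderiv k (F j) * F i +
          if j = i then pullback F p * pderiv k (F j) else 0 := by
      intro j
      rw [pderiv_mul, map_add, map_mul, map_mul, pullback_X, pderiv_X_eq_ite]
      split_ifs
      · rw [map_one]; ring
      · rw [map_zero]; ring
    simp only [h1, Finset.sum_add_distrib]
    simp

theorem sum_mul_sub_sum_swap {R ι : Type} [CommRing R] [Fintype ι] (a : ι → ι → R) (u v : ι → R) :
    ∑ i, ∑ j, a i j * (u i * v j) - ∑ i, ∑ j, a i j * (v i * u j) =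
      ∑ i, ∑ j, (a i j - a j i) * (u i * v j) := by
  rw [Finset.sum_comm (f := fun i j => a i j * (v i * u j)), ← Finset.sum_sub_distrib]
  refine Finset.sum_congr rfl fun i _ => ?_
  rw [← Finset.sum_sub_distrib]
  exact Finset.sum_congr rfl fun j _ => by ring

/-- Contraction of `α ∧ dα = 0` with the `p`-th coordinate field and with `u` and `v`: `A p` times
`dα(u, v)` is a combination of `α(u)` and `α(v)`. -/
theorem mul_sum_eq_of_integrable {R ι : Type} [CommRing R] [Fintype ι] (c : ι → ι → R)
    (A u v : ι → R) (p : ι) (h : ∀ i j, A p * c i j - A i * c p j + A j * c p i = 0) :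
    A p * ∑ i, ∑ j, c i j * (u i * v j) =
      (∑ j, c p j * v j) * (∑ i, A i * u i) - (∑ i, c p i * u i) * (∑ j, A j * v j) := by
  rw [Finset.sum_mul_sum, Finset.sum_mul_sum,
    Finset.sum_comm (f := fun i j => c p i * v i * (A j * u j)), ← Finset.sum_sub_distrib,
    Finset.mul_sum]
  refine Finset.sum_congr rfl fun i _ => ?_
  rw [← Finset.sum_sub_distrib, Finset.mul_sum]
  refine Finset.sum_congr rfl fun j _ => ?_
  linear_combination (u i * v j) * h i j

/-- The exterior derivative commutes with pullback: the second derivatives of `F` cancel by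
symmetry. -/
theorem d_pullbackForm (F : Fin m → MvPolynomial (Fin (n + 1)) ℂ) (A : OneForm (Fin m))
    (k l : Fin (n + 1)) :
    (pullbackForm F A).d k l =
      ∑ i, ∑ j, pullback F (A.d i j) * (pderiv k (F i) * pderiv l (F j)) := by
  have h : ∀ k l, pderiv k (pullbackForm F A l) =
      (∑ i, ∑ j, pullback F (pderiv i (A j)) * (pderiv k (F i) * pderiv l (F j))) +
        ∑ j, pullback F (A j) * pderiv k (pderiv l (F j)) := by
    intro k l
    have h1 : ∀ j, pderiv k (pullback F (A j) * pderiv l (F j)) =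
        (∑ i, pullback F (pderiv i (A j)) * (pderiv k (F i) * pderiv l (F j))) +
          pullback F (A j) * pderiv k (pderiv l (F j)) := by
      intro j
      rw [pderiv_mul, pderiv_pullback, Finset.sum_mul]
      simp only [mul_assoc]
    have h2 : pderiv k (pullbackForm F A l) =
        ∑ j, pderiv k (pullback F (A j) * pderiv l (F j)) := map_sum _ _ _
    refine h2.trans ((Finset.sum_congr rfl fun j _ => h1 j).trans
      (Finset.sum_add_distrib.trans (congrArg (· + _) Finset.sum_comm)))
  have h3 : ∑ j, pullback F (A j) * pderiv k (pderiv l (F j)) =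
      ∑ j, pullback F (A j) * pderiv l (pderiv k (F j)) :=
    Finset.sum_congr rfl fun j _ => congrArg (pullback F (A j) * ·) (pderiv_comm k l (F j))
  have h4 : (pullbackForm F A).d k l = _ - _ := congrArg₂ (· - ·) (h k l) (h l k)
  rw [h4, h3, add_sub_add_right_eq_sub]
  refine (sum_mul_sub_sum_swap (fun i j => pullback F (pderiv i (A j))) (fun i => pderiv k (F i))
    (fun i => pderiv l (F i))).trans ?_
  refine Finset.sum_congr rfl fun i _ => Finset.sum_congr rfl fun j _ => ?_
  rw [OneForm.d, map_sub]

/-- Multiplying the pulled back differential by a coefficient of the pulled back form lands in the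
singular ideal: this is the pulled back integrability condition. -/
theorem mul_d_pullbackForm_mem (F : Fin m → MvPolynomial (Fin (n + 1)) ℂ) {A : OneForm (Fin m)}
    (hA : A.IsIntegrable) (p : Fin m) (k l : Fin (n + 1)) :
    pullback F (A p) * (pullbackForm F A).d k l ∈ (pullbackForm F A).singularIdeal := by
  rw [d_pullbackForm, mul_sum_eq_of_integrable (fun i j => pullback F (A.d i j))
    (fun i => pullback F (A i)) _ _ p (fun i j => by
      rw [← map_mul, ← map_mul, ← map_mul, ← map_sub, ← map_add, hA p i j, map_zero])]
  exact sub_mem (Ideal.mul_mem_left _ _ (Ideal.subset_span ⟨k, rfl⟩))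
    (Ideal.mul_mem_left _ _ (Ideal.subset_span ⟨l, rfl⟩))

end Forms

/-! ### Weights of relations on the class group. -/

section Weights

variable {q m : ℕ} {X : CompleteSimplicialFan q m}

/-- Relations among the rays annihilate the divisors of characters, so each of them defines an
integral weight on the class group. -/
theorem sum_mul_eq_of_cls_eq {b b' : Fin m → ℤ} (h : X.cls b = X.cls b') {a : Fin m → ℤ}
    (ha : X.IsRelation a) : ∑ i, a i * b i = ∑ i, a i * b' i := by
  rw [CompleteSimplicialFan.cls, CompleteSimplicialFan.cls, QuotientAddGroup.eq] at h
  obtain ⟨u, hu⟩ := h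
  have h1 : ∀ i, b' i = b i + ∑ j, u j * X.v i j := by
    intro i
    have := congrFun hu i
    simp only [CompleteSimplicialFan.divisorOfCharacter, AddMonoidHom.coe_mk, ZeroHom.coe_mk,
      Pi.add_apply, Pi.neg_apply] at this
    rw [this]; ring
  simp only [h1, mul_add, Finset.sum_add_distrib]
  have h2 : ∑ i, a i * ∑ j, u j * X.v i j = ∑ j, u j * ∑ i, a i * X.v i j := by
    simp only [Finset.mul_sum]
    rw [Finset.sum_comm]
    exact Finset.sum_congr rfl fun j _ => Finset.sum_congr rfl fun i _ => by ring
  have h3 : ∀ j, ∑ i, a i * X.v i j = 0 := by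
    intro j
    have := congrFun ha j
    simpa [Finset.sum_apply] using this
  rw [h2]
  simp [h3]

/-- A degree `δ ∈ ℤ^m` representing the class of a foliation form. -/
theorem IsFoliationForm.exists_weight {D : X.Cl} {A : OneForm (Fin m)}
    (hA : IsFoliationForm X D A) : ∃ δ : Fin m → ℤ, ∀ i, ∀ b ∈ (A i).support, ∀ a,
      X.IsRelation a → ∑ k, a k * (b k : ℤ) = ∑ k, a k * δ k - a i := by
  obtain ⟨δ, rfl⟩ := QuotientAddGroup.mk_surjective D
  refine ⟨δ, fun i b hb a ha => ?_⟩
  have h1 : X.cls (fun k => (b k : ℤ)) = X.cls (δ - Pi.single i 1) := by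
    rw [hA.homogeneous i b hb]; rfl
  rw [sum_mul_eq_of_cls_eq h1 ha]
  simp only [Pi.sub_apply, mul_sub, Finset.sum_sub_distrib]
  simp [Pi.single_apply]

theorem sum_C_mul_X_mul_pderiv {f : MvPolynomial (Fin m) ℂ} {a : Fin m → ℤ} {c : ℤ}
    (h : ∀ b ∈ f.support, ∑ k, a k * (b k : ℤ) = c) :
    ∑ i, C (a i : ℂ) * MvPolynomial.X i * pderiv i f = C (c : ℂ) * f := by
  have h2 : ∀ b i, MvPolynomial.X i * pderiv i (monomial b (coeff b f)) =
      C (b i : ℂ) * monomial b (coeff b f) := by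
    intro b i
    rw [X_mul_pderiv_monomial, ← smul_eq_C_mul, ← Nat.cast_smul_eq_nsmul ℂ]
  conv_lhs => rw [f.as_sum]
  conv_rhs => rw [f.as_sum]
  simp only [map_sum, Finset.mul_sum, mul_assoc, h2]
  rw [Finset.sum_comm]
  refine Finset.sum_congr rfl fun b hb => ?_
  rw [← h b hb, Int.cast_sum, map_sum, Finset.sum_mul]
  refine Finset.sum_congr rfl fun i _ => ?_
  push_cast
  rw [C_mul, mul_assoc]

/-- Cartan's formula for the radial field of `a`: its contraction with `α` is zero, so its
contraction with `dα` is the Lie derivative, which is the weight times `α`. -/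
theorem IsFoliationForm.sum_mul_d {D : X.Cl} {A : OneForm (Fin m)} (hA : IsFoliationForm X D A)
    {δ : Fin m → ℤ} (hδ : ∀ i, ∀ b ∈ (A i).support, ∀ a,
      X.IsRelation a → ∑ k, a k * (b k : ℤ) = ∑ k, a k * δ k - a i)
    {a : Fin m → ℤ} (ha : X.IsRelation a) (j : Fin m) :
    ∑ i, C (a i : ℂ) * MvPolynomial.X i * A.d i j = C ((∑ k, a k * δ k : ℤ) : ℂ) * A j := by
  have h1 := sum_C_mul_X_mul_pderiv (f := A j) (fun b hb => hδ j b hb a ha)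
  have h2 := congrArg (pderiv j) (hA.descent a ha)
  simp only [map_sum, pderiv_mul, pderiv_C, zero_mul, zero_add, pderiv_X_eq_ite, map_zero,
    Finset.sum_add_distrib] at h2
  have h3 : ∑ i, C (a i : ℂ) * (if j = i then 1 else 0) * A i = C (a j : ℂ) * A j := by
    rw [Finset.sum_eq_single j]
    · simp
    · intro i _ hi
      rw [if_neg hi.symm]; simp
    · simp
  rw [h3] at h2
  simp only [OneForm.d, mul_sub, Finset.sum_sub_distrib]
  rw [h1]
  rw [Int.cast_sub, C_sub]
  linear_combination (-1 : MvPolynomial (Fin m) ℂ) * h2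

end Weights

end ToricKupka

namespace ToricKupka

open MvPolynomial

/-! ### Localisation with cleared denominators. -/

section Localization

/-- The hypothesis says that `D` lies in the radical of `J` after localisation at `P`; finitely many
generators of `D` have a common denominator. -/
theorem exists_mul_mem_radical {R : Type} [CommRing R] [IsNoetherianRing R] (J D P : Ideal R)
    [hP : P.IsPrime] (h : ∀ Q : Ideal R, Q.IsPrime → J ≤ Q → Q ≤ P → D ≤ Q) :
    ∃ t, t ∉ P ∧ ∀ f ∈ D, t * f ∈ J.radical := by
  classical
  have h1 : ∀ f ∈ D, ∃ t, t ∉ P ∧ t * f ∈ J.radical := by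
    intro f hf
    by_contra hcon
    push Not at hcon
    have hdisj : Disjoint (J : Set R) ((P.primeCompl ⊔ Submonoid.powers f : Submonoid R) : Set R) := by
      rw [Set.disjoint_left]
      intro z hzJ hz
      obtain ⟨t, ht, u, ⟨k, rfl⟩, rfl⟩ := Submonoid.mem_sup.1 hz
      refine hcon t ht (Ideal.mem_radical_iff.2 ⟨k + 1, ?_⟩)
      have : (t * f) ^ (k + 1) = t ^ k * f * (t * f ^ k) := by ring
      rw [this]
      exact Ideal.mul_mem_left _ _ hzJ
    obtain ⟨Q, hQ, hJQ, hd⟩ := Ideal.exists_le_prime_disjoint J _ hdisj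
    have hQP : Q ≤ P := by
      intro z hz
      by_contra hzP
      exact Set.disjoint_left.1 hd hz (Submonoid.mem_sup_left hzP)
    exact Set.disjoint_left.1 hd (h Q hQ hJQ hQP hf)
      (Submonoid.mem_sup_right (Submonoid.mem_powers f))
  obtain ⟨s, hs⟩ := (IsNoetherian.noetherian D : D.FG)
  have hsD : ∀ f ∈ s, f ∈ D := fun f hf => hs ▸ Submodule.subset_span hf
  choose! t ht htf using h1
  refine ⟨∏ f ∈ s, t f, ?_, fun f hf => ?_⟩
  · intro hprod
    obtain ⟨f, hf, hft⟩ := (hP.prod_mem_iff).1 hprod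
    exact ht f (hsD f hf) hft
  · have hle : D ≤ J.radical.colon {∏ f ∈ s, t f} := by
      rw [← hs, Submodule.span_le]
      intro g hg
      rw [SetLike.mem_coe, Submodule.mem_colon_singleton, smul_eq_mul,
        ← Finset.mul_prod_erase s t hg, ← mul_assoc, mul_comm g]
      exact Ideal.mul_mem_right _ _ (htf g (hsD g hg))
    have := hle hf
    rwa [Submodule.mem_colon_singleton, smul_eq_mul, mul_comm] at this

theorem IsReducedAt.exists_mul_mem {n : ℕ} {J : Ideal (MvPolynomial (Fin (n + 1)) ℂ)}
    {x : Fin (n + 1) → ℂ} (h : IsReducedAt J x) {f : MvPolynomial (Fin (n + 1)) ℂ}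
    (hf : f ∈ J.radical) : ∃ t, eval x t ≠ 0 ∧ t * f ∈ J := by
  obtain ⟨N, hN⟩ := Ideal.mem_radical_iff.1 hf
  have h0 : algebraMap _ (Localization.AtPrime (pointIdeal x)) f ^ N ∈
      J.map (algebraMap _ (Localization.AtPrime (pointIdeal x))) := by
    rw [← map_pow]
    exact Ideal.mem_map_of_mem _ hN
  have h1 := h (Ideal.mem_radical_iff.2 ⟨N, h0⟩)
  rw [IsLocalization.mem_map_algebraMap_iff (pointIdeal x).primeCompl] at h1
  obtain ⟨⟨a, s⟩, has⟩ := h1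
  rw [← map_mul, IsLocalization.eq_iff_exists (pointIdeal x).primeCompl] at has
  obtain ⟨c, hc⟩ := has
  refine ⟨c * s, ?_, ?_⟩
  · rw [map_mul]
    exact mul_ne_zero c.2 s.2
  · have : (c : MvPolynomial (Fin (n + 1)) ℂ) * s * f = c * (f * s) := by ring
    rw [this, hc]
    exact Ideal.mul_mem_left _ _ a.2

end Localization

/-! ### The pulled back form at noncritical points. -/

section Noncritical

variable {q m n : ℕ} (X : CompleteSimplicialFan q m) (F : Fin m → MvPolynomial (Fin (n + 1)) ℂ)

/-- The module spanned by the columns of the Jacobian matrix and the radial vector fields. -/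
noncomputable def columnModule :
    Submodule (MvPolynomial (Fin (n + 1)) ℂ) (Fin m → MvPolynomial (Fin (n + 1)) ℂ) :=
  Submodule.span _ (Set.range (fun k i => pderiv k (F i)) ∪
    {w | ∃ a, X.IsRelation a ∧ w = fun i => C (a i : ℂ) * F i})

variable {X F}

/-- Elements of the module lifting the standard basis at `x` form a square matrix that is the
identity at `x`. Cramer's rule writes its determinant times each basis vector through its rows. -/
theorem exists_single_mem_columnModule {x : Fin (n + 1) → ℂ} (hx : ¬ IsCriticalPoint X F x) :
    ∃ s : MvPolynomial (Fin (n + 1)) ℂ, eval x s = 1 ∧ ∀ i, Pi.single i s ∈ columnModule X F := by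
  rw [IsCriticalPoint, not_not] at hx
  have h1 : ∀ u : Fin m → ℂ, ∃ b ∈ columnModule X F, ∀ i, eval x (b i) = u i := by
    intro u
    have hu : u ∈ (⊤ : Submodule ℂ (Fin m → ℂ)) := trivial
    rw [← hx] at hu
    induction hu using Submodule.span_induction with
    | mem u hu =>
      rcases hu with ⟨k, rfl⟩ | ⟨a, ha, rfl⟩
      · exact ⟨_, Submodule.subset_span (Or.inl ⟨k, rfl⟩), fun i => rfl⟩
      · exact ⟨_, Submodule.subset_span (Or.inr ⟨a, ha, rfl⟩), fun i => by simp⟩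
    | zero => exact ⟨0, zero_mem _, by simp⟩
    | add u v _ _ hu hv =>
      obtain ⟨b, hb, hbu⟩ := hu
      obtain ⟨c, hc, hcv⟩ := hv
      exact ⟨b + c, add_mem hb hc, fun i => by simp [hbu, hcv]⟩
    | smul c u _ hu =>
      obtain ⟨b, hb, hbu⟩ := hu
      exact ⟨(C c : MvPolynomial (Fin (n + 1)) ℂ) • b, Submodule.smul_mem _ _ hb,
        fun i => by simp [hbu]⟩
  choose b hb hbx using fun j : Fin m => h1 (Pi.single j 1)
  refine ⟨(Matrix.of b).det, ?_, fun i => ?_⟩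
  · rw [RingHom.map_det]
    have : (eval x).mapMatrix (Matrix.of b) = 1 := by
      ext j i
      simp only [RingHom.mapMatrix_apply, Matrix.map_apply, Matrix.of_apply, hbx]
      rw [Matrix.one_apply, Pi.single_apply]
      simp [eq_comm]
    rw [this, Matrix.det_one]
  · have h2 : Pi.single i (Matrix.of b).det = ∑ j, (Matrix.of b).adjugate i j • b j := by
      funext l
      have h3 := congrFun (congrFun (Matrix.adjugate_mul (Matrix.of b)) i) l
      rw [Matrix.mul_apply] at h3
      simp only [Finset.sum_apply, Pi.smul_apply, smul_eq_mul]
      rw [Matrix.smul_apply, Matrix.one_apply, smul_eq_mul] at h3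
      simp only [Matrix.of_apply] at h3
      rw [h3, Pi.single_apply]
      simp [eq_comm]
    rw [h2]
    exact Submodule.sum_mem _ fun j _ => Submodule.smul_mem _ _ (hb j)

/-- The ideal generated by the coefficients of the exterior derivative. -/
noncomputable def OneForm.curlIdeal {ι : Type} (A : OneForm ι) : Ideal (MvPolynomial ι ℂ) :=
  Ideal.span (Set.range fun p : ι × ι => A.d p.1 p.2)

theorem OneForm.d_mem_curlIdeal {ι : Type} (A : OneForm ι) (i j : ι) : A.d i j ∈ A.curlIdeal :=
  Ideal.subset_span ⟨(i, j), rfl⟩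

theorem OneForm.d_swap {ι : Type} (A : OneForm ι) (i j : ι) : A.d i j = -A.d j i := by
  rw [OneForm.d, OneForm.d]; ring

variable {D : X.Cl} {A : OneForm (Fin m)}

theorem sum_mul_pullback_mem (hA : IsFoliationForm X D A)
    {b : Fin m → MvPolynomial (Fin (n + 1)) ℂ} (hb : b ∈ columnModule X F) :
    ∑ i, b i * pullback F (A i) ∈ (pullbackForm F A).singularIdeal := by
  have h : columnModule X F ≤ Submodule.comap
      (Fintype.linearCombination (MvPolynomial (Fin (n + 1)) ℂ) (fun i => pullback F (A i)))
      (pullbackForm F A).singularIdeal := by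
    rw [columnModule, Submodule.span_le]
    rintro _ (⟨k, rfl⟩ | ⟨a, ha, rfl⟩)
    · rw [SetLike.mem_coe, Submodule.mem_comap, Fintype.linearCombination_apply]
      refine Ideal.subset_span ⟨k, ?_⟩
      exact Finset.sum_congr rfl fun i _ => mul_comm _ _
    · rw [SetLike.mem_coe, Submodule.mem_comap, Fintype.linearCombination_apply]
      have h1 := congrArg (pullback F) (hA.descent a ha)
      rw [map_sum, map_zero] at h1
      have h2 : ∑ i, (C (a i : ℂ) * F i) • pullback F (A i) = 0 := by
        rw [← h1]
        refine Finset.sum_congr rfl fun i _ => ?_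
        rw [map_mul, map_mul, pullback_X, pullback_C, smul_eq_mul]
      rw [h2]
      exact zero_mem _
  exact h hb

theorem sum_radial_mul_pullback_d_mem (hA : IsFoliationForm X D A) {a : Fin m → ℤ}
    (ha : X.IsRelation a) (j : Fin m) :
    ∑ i, C (a i : ℂ) * F i * pullback F (A.d i j) ∈ A.singularIdeal.map (pullback F) := by
  obtain ⟨δ, hδ⟩ := hA.exists_weight
  have h1 := congrArg (pullback F) (hA.sum_mul_d hδ ha j)
  rw [map_sum] at h1
  have h2 : ∑ i, C (a i : ℂ) * F i * pullback F (A.d i j) = pullback F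
      (C ((∑ k, a k * δ k : ℤ) : ℂ) * A j) := by
    rw [← h1]
    refine Finset.sum_congr rfl fun i _ => ?_
    rw [map_mul, map_mul, pullback_X, pullback_C]
  rw [h2]
  exact Ideal.mem_map_of_mem _ (Ideal.mul_mem_left _ _ (Ideal.subset_span ⟨j, rfl⟩))

/-- Two Jacobian columns give a coefficient of `dω`. As soon as one of the vectors is radial,
Cartan's formula puts the value in the extension of `J(α)`. -/
theorem sum_mul_mul_pullback_d_mem (hA : IsFoliationForm X D A)
    {b c : Fin m → MvPolynomial (Fin (n + 1)) ℂ} (hb : b ∈ columnModule X F)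
    (hc : c ∈ columnModule X F) :
    ∑ i, ∑ j, pullback F (A.d i j) * (b i * c j) ∈
      (pullbackForm F A).curlIdeal ⊔ A.singularIdeal.map (pullback F) := by
  have hJ := (le_sup_right : A.singularIdeal.map (pullback F) ≤
    (pullbackForm F A).curlIdeal ⊔ A.singularIdeal.map (pullback F))
  have key : ∀ g ∈ (Set.range (fun k i => pderiv k (F i)) ∪
      {w | ∃ a, X.IsRelation a ∧ w = fun i => C (a i : ℂ) * F i}),
      ∀ c ∈ columnModule X F, ∑ i, ∑ j, pullback F (A.d i j) * (g i * c j) ∈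
      (pullbackForm F A).curlIdeal ⊔ A.singularIdeal.map (pullback F) := by
    intro g hg c hc
    rcases hg with ⟨k, rfl⟩ | ⟨a, ha, rfl⟩
    · induction hc using Submodule.span_induction with
      | mem c hc =>
        rcases hc with ⟨l, rfl⟩ | ⟨a, ha, rfl⟩
        · rw [← d_pullbackForm]
          exact Ideal.mem_sup_left (OneForm.d_mem_curlIdeal _ k l)
        · apply hJ
          refine Ideal.sum_mem _ fun i _ => ?_
          have h1 := sum_radial_mul_pullback_d_mem (F := F) hA ha i
          have h2 : ∑ j, pullback F (A.d i j) * (pderiv k (F i) * (C (a j : ℂ) * F j)) =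
              -pderiv k (F i) * ∑ j, C (a j : ℂ) * F j * pullback F (A.d j i) := by
            rw [Finset.mul_sum]
            refine Finset.sum_congr rfl fun j _ => ?_
            rw [OneForm.d_swap A i j, map_neg]; ring
          rw [h2]
          exact Ideal.mul_mem_left _ _ h1
      | zero => simp
      | add u v _ _ hu hv =>
        simp only [Pi.add_apply, mul_add, Finset.sum_add_distrib]
        exact add_mem hu hv
      | smul r u _ hu =>
        have h2 : ∑ i, ∑ j, pullback F (A.d i j) * (pderiv k (F i) * (r • u) j) =
            r * ∑ i, ∑ j, pullback F (A.d i j) * (pderiv k (F i) * u j) := by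
          simp only [Finset.mul_sum]
          refine Finset.sum_congr rfl fun i _ => Finset.sum_congr rfl fun j _ => ?_
          rw [Pi.smul_apply, smul_eq_mul]; ring
        rw [h2]
        exact Ideal.mul_mem_left _ _ hu
    · apply hJ
      rw [Finset.sum_comm]
      refine Ideal.sum_mem _ fun j _ => ?_
      have h2 : ∑ i, pullback F (A.d i j) * (C (a i : ℂ) * F i * c j) =
          c j * ∑ i, C (a i : ℂ) * F i * pullback F (A.d i j) := by
        rw [Finset.mul_sum]
        exact Finset.sum_congr rfl fun i _ => by ring
      rw [h2]
      exact Ideal.mul_mem_left _ _ (sum_radial_mul_pullback_d_mem (F := F) hA ha j)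
  induction hb using Submodule.span_induction with
  | mem g hg => exact key g hg c hc
  | zero => simp
  | add u v _ _ hu hv =>
    simp only [Pi.add_apply, add_mul, mul_add, Finset.sum_add_distrib]
    exact add_mem hu hv
  | smul r u _ hu =>
    have h2 : ∑ i, ∑ j, pullback F (A.d i j) * ((r • u) i * c j) =
        r * ∑ i, ∑ j, pullback F (A.d i j) * (u i * c j) := by
      simp only [Finset.mul_sum]
      refine Finset.sum_congr rfl fun i _ => Finset.sum_congr rfl fun j _ => ?_
      rw [Pi.smul_apply, smul_eq_mul]; ring
    rw [h2]
    exact Ideal.mul_mem_left _ _ hu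

/-- Near a noncritical point `J(ω)` and the extension of `J(α)` agree, and `dω` determines the
pullback of `dα` modulo the latter. The multiplier is squared in the second part because `dα` takes
two arguments. -/
theorem exists_eval_eq_one_of_not_critical (hA : IsFoliationForm X D A) {x : Fin (n + 1) → ℂ}
    (hx : ¬ IsCriticalPoint X F x) :
    ∃ s : MvPolynomial (Fin (n + 1)) ℂ, eval x s = 1 ∧
      (∀ f ∈ A.singularIdeal.map (pullback F), s * f ∈ (pullbackForm F A).singularIdeal) ∧
      ∀ i j, s ^ 2 * pullback F (A.d i j) ∈
        (pullbackForm F A).curlIdeal ⊔ A.singularIdeal.map (pullback F) := by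
  obtain ⟨s, hs, hsm⟩ := exists_single_mem_columnModule hx
  refine ⟨s, hs, ?_, fun i j => ?_⟩
  · have h1 : A.singularIdeal.map (pullback F) ≤
        (pullbackForm F A).singularIdeal.colon {s} := by
      rw [OneForm.singularIdeal, Ideal.map_span, Ideal.span_le]
      rintro _ ⟨_, ⟨i, rfl⟩, rfl⟩
      rw [SetLike.mem_coe, Submodule.mem_colon_singleton, smul_eq_mul]
      have := sum_mul_pullback_mem hA (hsm i)
      rw [Finset.sum_eq_single i] at this
      · rwa [Pi.single_eq_same, mul_comm] at this
      · intro j _ hj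
        rw [Pi.single_eq_of_ne hj, zero_mul]
      · simp
    intro f hf
    have := h1 hf
    rwa [Submodule.mem_colon_singleton, smul_eq_mul, mul_comm] at this
  · have := sum_mul_mul_pullback_d_mem hA (hsm i) (hsm j)
    rw [Finset.sum_eq_single i, Finset.sum_eq_single j] at this
    · rw [Pi.single_eq_same, Pi.single_eq_same] at this
      convert this using 1; ring
    · intro l _ hl
      rw [Pi.single_eq_of_ne hl]; ring
    · simp
    · intro l _ hl
      rw [Pi.single_eq_of_ne hl]; simp
    · simp

end Noncritical

end ToricKupka

namespace ToricKupka

open MvPolynomial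

/-! ### The Jacobian determinant at an isolated zero. -/

section ResidueAtPoint

variable {N : ℕ}

/-- Translation of the point `x` to the origin. -/
noncomputable def translate (x : Fin N → ℂ) : MvPolynomial (Fin N) ℂ →ₐ[ℂ] MvPolynomial (Fin N) ℂ :=
  aeval fun i => X i + C (x i)

theorem translate_X (x : Fin N → ℂ) (i : Fin N) : translate x (X i) = X i + C (x i) :=
  aeval_X _ _

theorem translate_C (x : Fin N → ℂ) (c : ℂ) : translate x (C c) = C c := aeval_C _ _

theorem constantCoeff_translate (x : Fin N → ℂ) (f : MvPolynomial (Fin N) ℂ) :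
    constantCoeff (translate x f) = eval x f := by
  induction f using MvPolynomial.induction_on with
  | C a => rw [translate_C]; simp
  | add p q hp hq => simp [hp, hq]
  | mul_X p i hp => rw [map_mul, map_mul, hp, translate_X]; simp

theorem pderiv_translate (x : Fin N → ℂ) (k : Fin N) (f : MvPolynomial (Fin N) ℂ) :
    pderiv k (translate x f) = translate x (pderiv k f) := by
  induction f using MvPolynomial.induction_on with
  | C a => rw [translate_C]; simp
  | add p q hp hq => simp [hp, hq]
  | mul_X p i hp =>
    rw [map_mul, pderiv_mul, hp, translate_X, pderiv_mul, map_add (pderiv k), map_add (translate x),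
      map_mul, map_mul, translate_X, pderiv_C, add_zero, pderiv_X_eq_ite]
    split_ifs <;> simp

/-- By `hX` the point `x` is an isolated zero of `g`; after translation to the origin the residue
argument applies. -/
theorem jacobian_not_mem {g : Fin N → MvPolynomial (Fin N) ℂ} {x : Fin N → ℂ}
    (hg : ∀ i, eval x (g i) = 0) {c : ℕ} (hc : 0 < c) {s s' : MvPolynomial (Fin N) ℂ}
    (hs : eval x s ≠ 0) (hs' : eval x s' ≠ 0)
    (hX : ∀ i, s * (X i - C (x i)) ^ c ∈ Ideal.span (Set.range g)) :
    s' * (Matrix.of fun i j => pderiv j (g i)).det ∉ Ideal.span (Set.range g) := by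
  intro hJ
  choose M hM using fun i => (Ideal.mem_span_range_iff_exists_fun).1 (hX i)
  refine residue_contradiction (fun i => translate x (g i)) (fun i => ?_) hc
    (s := translate x s) (s' := translate x s') ?_ ?_ (Matrix.of fun i j => translate x (M i j)) ?_ ?_
  · rw [constantCoeff_translate, hg]
  · rwa [constantCoeff_translate]
  · rwa [constantCoeff_translate]
  · funext i
    have := congrArg (translate x) (hM i)
    rw [map_sum] at this
    simp only [map_mul, map_pow, map_sub, translate_X, translate_C, add_sub_cancel_right] at this
    exact this
  · have h1 := Ideal.mem_map_of_mem (translate x) hJ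
    rw [Ideal.map_span, ← Set.range_comp, map_mul] at h1
    have h2 : translate x (Matrix.of fun i j => pderiv j (g i)).det =
        (Matrix.of fun i j => pderiv j (translate x (g i))).det := by
      rw [show ∀ f, translate x f = (translate x : _ →+* _) f from fun _ => rfl, RingHom.map_det]
      congr 1
      ext i j
      simp only [RingHom.mapMatrix_apply, Matrix.map_apply, Matrix.of_apply, pderiv_translate]
      rfl
    rw [h2] at h1
    exact h1

end ResidueAtPoint

/-! ### Critical points inside the singular locus. -/

section Key

variable {m n : ℕ}

theorem mem_span_sub_C_of_eval_eq_zero (y : Fin m → ℂ) {f : MvPolynomial (Fin m) ℂ}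
    (hf : eval y f = 0) (F : Fin m → MvPolynomial (Fin (n + 1)) ℂ) :
    pullback F f ∈ Ideal.span (Set.range fun i => F i - C (y i)) := by
  have h1 := sub_C_eval_mem_span y f
  rw [hf, C_0, sub_zero] at h1
  have h2 := Ideal.mem_map_of_mem (pullback F) h1
  rw [Ideal.map_span, ← Set.range_comp] at h2
  convert h2 using 3
  funext i
  simp only [Function.comp_apply, map_sub, pullback_X, pullback_C]

/-- The fibre of a flat morphism through `x` is, near `x`, a set theoretic complete intersection
point after cutting with complementary many functions. -/
theorem exists_complementary_of_flat (hmn : m ≤ n + 1)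
    (F : Fin m → MvPolynomial (Fin (n + 1)) ℂ) (hflat : (pullback F).Flat)
    (x : Fin (n + 1) → ℂ) :
    ∃ l : Fin (n + 1 - m) → MvPolynomial (Fin (n + 1)) ℂ, (∀ j, eval x (l j) = 0) ∧
      ∃ s : MvPolynomial (Fin (n + 1)) ℂ, eval x s ≠ 0 ∧ ∃ c, 0 < c ∧
        ∀ i, s * (X i - C (x i)) ^ c ∈
          Ideal.span (Set.range fun i => F i - C (eval x (F i))) ⊔ Ideal.span (Set.range l) := by
  classical
  let := (pullback F).toAlgebra
  have : Module.Flat (MvPolynomial (Fin m) ℂ) (MvPolynomial (Fin (n + 1)) ℂ) := hflat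
  set y : Fin m → ℂ := fun i => eval x (F i) with hy
  set p : Ideal (MvPolynomial (Fin m) ℂ) := RingHom.ker (eval y) with hp
  set P : Ideal (MvPolynomial (Fin (n + 1)) ℂ) := RingHom.ker (eval x) with hP
  have hpp : p.IsPrime := RingHom.ker_isPrime _
  have hPp : P.IsPrime := RingHom.ker_isPrime _
  have hover : P.LiesOver p := ⟨by
    ext f
    show eval y f = 0 ↔ eval x (pullback F f) = 0
    rw [eval_pullback]⟩
  -- Flatness gives going down, so the ideal of `x` has height exactly `n + 1 - m` in the ring of
  -- the fibre. By the converse of Krull's theorem that many functions cut `x` out of the fibre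
  -- locally.
  have hht := Ideal.height_eq_height_add_of_liesOver_of_hasGoingDown p P
  rw [hp, hP, height_pointIdeal, height_pointIdeal, ← hp, ← hP] at hht
  set 𝔪 := p.map (algebraMap (MvPolynomial (Fin m) ℂ) (MvPolynomial (Fin (n + 1)) ℂ)) with h𝔪
  have h𝔪P : 𝔪 ≤ P := by
    rw [h𝔪, Ideal.map_le_iff_le_comap]
    exact (hover.over).le
  have hP'p : (P.map (Ideal.Quotient.mk 𝔪)).IsPrime :=
    Ideal.map_isPrime_of_surjective Ideal.Quotient.mk_surjective (by rw [Ideal.mk_ker]; exact h𝔪P)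
  obtain ⟨t, htmin, htcard⟩ :=
    Ideal.exists_finset_card_eq_height_of_isNoetherianRing (P.map (Ideal.Quotient.mk 𝔪))
  rw [← htcard] at hht
  have hcard : t.card = n + 1 - m := by
    have : n + 1 = m + t.card := by exact_mod_cast hht
    omega
  let e : Fin (n + 1 - m) ≃ t := (Finset.equivFinOfCardEq hcard).symm
  choose l hl using fun j => Ideal.Quotient.mk_surjective (I := 𝔪) (e j).1
  have hlt : ∀ j, l j ∈ P := by
    intro j
    rw [← Ideal.mem_quotient_iff_mem h𝔪P, hl]
    exact htmin.1.2 (Ideal.subset_span (e j).2)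
  have hle : 𝔪 ≤ Ideal.span (Set.range fun i => F i - C (y i)) := by
    rw [h𝔪, Ideal.map_le_iff_le_comap]
    intro f hf
    exact mem_span_sub_C_of_eval_eq_zero y hf F
  have hmin : ∀ Q : Ideal (MvPolynomial (Fin (n + 1)) ℂ), Q.IsPrime →
      𝔪 ⊔ Ideal.span (Set.range l) ≤ Q → Q ≤ P → P ≤ Q := by
    intro Q hQ hJQ hQP
    have h𝔪Q : 𝔪 ≤ Q := le_sup_left.trans hJQ
    have hQ' : (Q.map (Ideal.Quotient.mk 𝔪)).IsPrime :=
      Ideal.map_isPrime_of_surjective Ideal.Quotient.mk_surjective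
        (by rw [Ideal.mk_ker]; exact h𝔪Q)
    have h1 : P.map (Ideal.Quotient.mk 𝔪) ≤ Q.map (Ideal.Quotient.mk 𝔪) := by
      refine htmin.2 ⟨hQ', ?_⟩ (Ideal.map_mono hQP)
      rw [Ideal.span_le]
      intro z hz
      obtain ⟨j, hj⟩ := e.surjective ⟨z, hz⟩
      have : z = Ideal.Quotient.mk 𝔪 (l j) := by rw [hl, hj]
      rw [this]
      exact Ideal.mem_map_of_mem _ (hJQ (Ideal.mem_sup_right (Ideal.subset_span ⟨j, rfl⟩)))
    intro f hf
    have := h1 (Ideal.mem_map_of_mem _ hf)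
    rwa [Ideal.mem_quotient_iff_mem h𝔪Q] at this
  obtain ⟨s, hsP, hs⟩ := exists_mul_mem_radical (𝔪 ⊔ Ideal.span (Set.range l)) P P hmin
  have hXP : ∀ i, (X i - C (x i) : MvPolynomial (Fin (n + 1)) ℂ) ∈ P := by
    intro i; simp [hP, RingHom.mem_ker]
  choose c hc using fun i => Ideal.mem_radical_iff.1 (hs _ (hXP i))
  -- The sum dominates every `c i`, and the added one keeps the exponent positive.
  refine ⟨l, fun j => hlt j, s ^ (∑ i, c i + 1), ?_, ∑ i, c i + 1, by omega, fun i => ?_⟩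
  · rw [map_pow]
    exact pow_ne_zero _ hsP
  · rw [← mul_pow]
    have h1 : c i ≤ ∑ i, c i + 1 :=
      (Finset.single_le_sum (fun _ _ => Nat.zero_le _) (Finset.mem_univ i)).trans (by omega)
    exact sup_le_sup_right hle _ (Ideal.pow_mem_of_pow_mem _ (hc i) h1)

variable {q : ℕ} {X' : CompleteSimplicialFan q m} {F : Fin m → MvPolynomial (Fin (n + 1)) ℂ}

theorem exists_dual_of_isCriticalPoint {x : Fin (n + 1) → ℂ} (hx : IsCriticalPoint X' F x) :
    ∃ w : Fin m → ℂ, w ≠ 0 ∧ (∀ k, ∑ i, w i * eval x (pderiv k (F i)) = 0) ∧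
      ∀ a, X'.IsRelation a → ∑ i, w i * ((a i : ℂ) * eval x (F i)) = 0 := by
  obtain ⟨w, hw, h⟩ := exists_dual_ne_zero_of_span_ne_top hx
  exact ⟨w, hw, fun k => h _ (Or.inl ⟨k, rfl⟩), fun a ha => h _ (Or.inr ⟨a, ha, rfl⟩)⟩

/-- The ideal of maximal minors of the Jacobian matrix. -/
noncomputable def jacobianIdeal (ι : Fin m → Fin (n + 1))
    (F : Fin m → MvPolynomial (Fin (n + 1)) ℂ) : Ideal (MvPolynomial (Fin (n + 1)) ℂ) :=
  Ideal.span {d | ∃ N : Matrix (Fin (n + 1)) (Fin (n + 1)) (MvPolynomial (Fin (n + 1)) ℂ),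
    (∀ i k, N (ι i) k = pderiv k (F i)) ∧ d = N.det}

theorem eval_eq_zero_of_mem_jacobianIdeal {ι : Fin m → Fin (n + 1)} (hι : Function.Injective ι)
    {x : Fin (n + 1) → ℂ} (hx : IsCriticalPoint X' F x) {f : MvPolynomial (Fin (n + 1)) ℂ}
    (hf : f ∈ jacobianIdeal ι F) : eval x f = 0 := by
  classical
  obtain ⟨w, hw, hwF, -⟩ := exists_dual_of_isCriticalPoint hx
  have hle : jacobianIdeal ι F ≤ RingHom.ker (eval x) := by
    rw [jacobianIdeal, Ideal.span_le]
    rintro _ ⟨N, hN, rfl⟩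
    rw [SetLike.mem_coe, RingHom.mem_ker, RingHom.map_det]
    rw [← Matrix.exists_vecMul_eq_zero_iff]
    -- The covector killing the Jacobian columns, extended by zero off the image of `ι`, is a left
    -- kernel vector at `x`.
    refine ⟨Function.extend ι w 0, ?_, ?_⟩
    · obtain ⟨i, hi⟩ := Function.ne_iff.1 hw
      intro h0
      apply hi
      have := congrFun h0 (ι i)
      rwa [hι.extend_apply] at this
    · funext k
      rw [Matrix.vecMul, dotProduct, Pi.zero_apply, ← hwF k]
      rw [← Finset.sum_subset (Finset.subset_univ (Finset.univ.image ι))]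
      · rw [Finset.sum_image (fun a _ b _ h => hι h)]
        refine Finset.sum_congr rfl fun i _ => ?_
        rw [hι.extend_apply, RingHom.mapMatrix_apply, Matrix.map_apply, hN]
      · intro j _ hj
        rw [Function.extend_apply', Pi.zero_apply, zero_mul]
        rintro ⟨i, rfl⟩
        exact hj (Finset.mem_image_of_mem ι (Finset.mem_univ i))
  exact hle hf

variable {D : X'.Cl} {A : OneForm (Fin m)}

/-- The singular scheme of the form has codimension two and the pullback is reduced along critical
points, so the pulled back singular locus has no component consisting of critical points. -/
theorem exists_not_critical (hmn : m ≤ n) (hn : 2 ≤ n) (hA : IsFoliationForm X' D A)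
    (hflat : (pullback F).Flat) (hJ : HeightGE (A.singularIdeal.map (pullback F)) 2)
    (hred : ∀ x : Fin (n + 1) → ℂ, x ≠ 0 → IsCriticalPoint X' F x →
      IsReducedAt (pullbackForm F A).singularIdeal x)
    (P : Ideal (MvPolynomial (Fin (n + 1)) ℂ)) [hP : P.IsPrime] (hPht : P.height ≤ 2)
    (hJP : A.singularIdeal.map (pullback F) ≤ P) :
    ∃ x : Fin (n + 1) → ℂ, (∀ p ∈ P, eval x p = 0) ∧ ¬ IsCriticalPoint X' F x := by
  by_contra hcrit
  push Not at hcrit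
  let ε : Fin (n + 1) ≃ Fin m ⊕ Fin (n + 1 - m) :=
    (finCongr (by omega)).trans finSumFinEquiv.symm
  let ι : Fin m → Fin (n + 1) := fun i => ε.symm (Sum.inl i)
  have hι : Function.Injective ι := ε.symm.injective.comp Sum.inl_injective
  have hJw : (pullbackForm F A).singularIdeal ≤ A.singularIdeal.map (pullback F) := by
    rw [OneForm.singularIdeal, Ideal.span_le]
    rintro _ ⟨k, rfl⟩
    exact Ideal.sum_mem _ fun i _ => Ideal.mul_mem_right _ _
      (Ideal.mem_map_of_mem _ (Ideal.subset_span ⟨i, rfl⟩))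
  -- Where `t` is nonzero, the Jacobian minors vanish on the zeros of `J(ω)`. A prime over `J(ω)`
  -- strictly inside `P` has height at most one, so it does not contain the extension of `J(α)`;
  -- since the two ideals agree near noncritical points, its zeros outside the zeros of that
  -- extension are critical.
  obtain ⟨t, htP, ht⟩ := exists_mul_mem_radical (pullbackForm F A).singularIdeal
    (jacobianIdeal ι F) P (by
      intro Q hQ hJQ hQP f hf
      by_contra hfQ
      by_cases hPQ : P ≤ Q
      · obtain ⟨x, hx, hxf⟩ := exists_eval_ne_zero Q hfQ
        exact hxf (eval_eq_zero_of_mem_jacobianIdeal hι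
          (hcrit x fun p hp => hx p (hPQ hp)) hf)
      · have hlt : Q < P := lt_of_le_not_ge hQP hPQ
        have h1 : ¬ A.singularIdeal.map (pullback F) ≤ Q := by
          intro hle
          have h2 := hJ Q hQ hle
          have h3 := ((add_le_add_left h2 1).trans
            (Ideal.height_add_one_le_of_lt_of_isPrime hlt)).trans hPht
          exact absurd h3 (by norm_num)
        obtain ⟨g, hg, hgQ⟩ := SetLike.not_le_iff_exists.1 h1
        obtain ⟨x, hx, hxf⟩ := exists_eval_ne_zero Q (f := f * g) fun h =>
          (hQ.mem_or_mem h).elim hfQ hgQ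
        rw [map_mul] at hxf
        by_cases hc : IsCriticalPoint X' F x
        · exact left_ne_zero_of_mul hxf (eval_eq_zero_of_mem_jacobianIdeal hι hc hf)
        · obtain ⟨s, hs, hsJ, -⟩ := exists_eval_eq_one_of_not_critical hA hc
          have := hx _ (hJQ (hsJ g hg))
          rw [map_mul, hs, one_mul] at this
          exact right_ne_zero_of_mul hxf this)
  obtain ⟨x, hx0, hxP, hxt⟩ := exists_ne_zero_of_height_lt P
    (lt_of_le_of_lt hPht (by exact_mod_cast (by omega : 2 < n + 1))) htP
  have hc := hcrit x hxP
  obtain ⟨l, hl, s, hs, c, hc0, hsc⟩ := exists_complementary_of_flat (by omega) F hflat x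
  -- The `m` equations of the fibre through `x`, placed in the rows `ι`, and the complementary
  -- functions: the Jacobian determinant of `g` is then one of the generators of `jacobianIdeal`.
  let g : Fin (n + 1) → MvPolynomial (Fin (n + 1)) ℂ := fun i =>
    Sum.elim (fun i => F i - C (eval x (F i))) l (ε i)
  have hspan : Ideal.span (Set.range g) =
      Ideal.span (Set.range fun i => F i - C (eval x (F i))) ⊔ Ideal.span (Set.range l) := by
    have : g = Sum.elim (fun i => F i - C (eval x (F i))) l ∘ ε := rfl
    rw [this, EquivLike.range_comp, Set.Sum.elim_range, Ideal.span_union]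
  have hdet : (Matrix.of fun i j => pderiv j (g i)).det ∈ jacobianIdeal ι F := by
    refine Ideal.subset_span ⟨_, fun i k => ?_, rfl⟩
    simp only [Matrix.of_apply, g, ι, Equiv.apply_symm_apply, Sum.elim_inl, map_sub, pderiv_C,
      sub_zero]
  -- Reducedness at `x` removes the radical. As all `A i` vanish at `F(x)`, the ideal `J(ω)` lies in
  -- the ideal of the fibre through `x`, so the Jacobian determinant of `g` would lie locally in
  -- `(g)`.
  obtain ⟨t', ht', htJ⟩ := (hred x hx0 hc).exists_mul_mem (ht _ hdet)
  refine jacobian_not_mem (g := g) (x := x) ?_ hc0 hs (s' := t' * t) ?_ (fun i => ?_) ?_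
  · intro i
    rcases h : ε i with j | j
    · simp [g, h]
    · simp [g, h, hl]
  · rw [map_mul]; exact mul_ne_zero ht' hxt
  · rw [hspan]; exact hsc i
  · rw [hspan, mul_assoc]
    refine Ideal.mem_sup_left ?_
    have hle : A.singularIdeal.map (pullback F) ≤
        Ideal.span (Set.range fun i => F i - C (eval x (F i))) := by
      rw [Ideal.map_le_iff_le_comap]
      intro f hf
      refine mem_span_sub_C_of_eval_eq_zero (fun i => eval x (F i)) ?_ F
      rw [← eval_pullback]
      exact hxP _ (hJP (Ideal.mem_map_of_mem _ hf))
    exact hle (hJw htJ)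

end Key

end ToricKupka

/-! ### Complete fans in the plane. -/

namespace ToricKupka

open MvPolynomial

/-- The determinant of two integral plane vectors. -/
def det2 (u v : Fin 2 → ℤ) : ℤ := u 0 * v 1 - u 1 * v 0

theorem det2_self (u : Fin 2 → ℤ) : det2 u u = 0 := by unfold det2; ring

theorem det2_swap (u v : Fin 2 → ℤ) : det2 u v = -det2 v u := by unfold det2; ring

namespace CompleteSimplicialFan

variable {m : ℕ} (X : CompleteSimplicialFan 2 m)

theorem v_ne_zero (i : Fin m) : X.v i ≠ 0 := fun h => by
  have := X.primitive i 0 0 (by simpa using h)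
  simp at this

theorem empty_mem (i : Fin m) : ∅ ∈ X.cones :=
  X.face_mem {i} (X.ray_mem i) ∅ (Finset.empty_subset _)

/-- Parallel primitive vectors agree up to sign, and different rays are not equal because their
cones meet only in the origin. -/
theorem eq_neg_of_det2_eq_zero {i j : Fin m} (hij : i ≠ j) (h : det2 (X.v i) (X.v j) = 0) :
    X.v j = -X.v i := by
  have hg : Int.gcd (X.v i 0) (X.v i 1) = 1 := by
    have hu := X.primitive i (Int.gcd (X.v i 0) (X.v i 1))
      (fun a => X.v i a / Int.gcd (X.v i 0) (X.v i 1)) (by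
        ext a
        have : (Int.gcd (X.v i 0) (X.v i 1) : ℤ) ∣ X.v i a := by
          fin_cases a
          · exact Int.gcd_dvd_left ..
          · exact Int.gcd_dvd_right ..
        simp [Int.mul_ediv_cancel' this])
    simpa [Int.isUnit_iff] using hu
  have hb := Int.gcd_eq_gcd_ab (X.v i 0) (X.v i 1)
  rw [hg] at hb
  set a := Int.gcdA (X.v i 0) (X.v i 1)
  set b := Int.gcdB (X.v i 0) (X.v i 1)
  have hd : X.v i 0 * X.v j 1 - X.v i 1 * X.v j 0 = 0 := h
  have hk : X.v j = (a * X.v j 0 + b * X.v j 1) • X.v i := by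
    ext c
    fin_cases c
    · simp only [Pi.smul_apply, smul_eq_mul, Fin.zero_eta, Fin.mk_one]
      push_cast at hb
      linear_combination X.v j 0 * hb - b * hd
    · simp only [Pi.smul_apply, smul_eq_mul, Fin.zero_eta, Fin.mk_one]
      push_cast at hb
      linear_combination X.v j 1 * hb + a * hd
  rcases Int.isUnit_iff.1 (X.primitive j _ _ hk) with h1 | h1
  · exfalso
    rw [h1, one_smul] at hk
    obtain ⟨e, -, he, hs⟩ := X.inter {i} (X.ray_mem i) {j} (X.ray_mem j) (Pi.single i 1)
      (Pi.single j 1) (fun k => by rw [Pi.single_apply]; split_ifs <;> norm_num)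
      (fun k hk => Pi.single_eq_of_ne (by simpa using hk) _)
      (fun k => by rw [Pi.single_apply]; split_ifs <;> norm_num)
      (fun k hk => Pi.single_eq_of_ne (by simpa using hk) _)
      (fun a => by simp [Pi.single_apply, hk])
    apply X.v_ne_zero i
    ext a
    have := hs a
    rw [Finset.sum_eq_zero (s := Finset.univ) (f := fun i => e i * (X.v i a : ℝ))] at this
    · simpa [Pi.single_apply] using this
    · intro k _
      rw [he k (by simp [Finset.singleton_inter_of_notMem, hij]), zero_mul]
  · rw [h1] at hk
    simpa using hk

theorem exists_det2_ne_zero (k : Fin m) : ∃ j, det2 (X.v k) (X.v j) ≠ 0 := by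
  by_contra! h
  -- If all rays were parallel to `v k`, no cone would contain a nonzero vector orthogonal to `v k`.
  obtain ⟨σ, -, c, -, -, hc⟩ := X.complete ![-(X.v k 1 : ℝ), (X.v k 0 : ℝ)]
  have h0 := hc 0
  have h1 := hc 1
  simp only [Matrix.cons_val_zero, Matrix.cons_val_one] at h0 h1
  have : (X.v k 0 : ℝ) * X.v k 0 + X.v k 1 * X.v k 1 = 0 := by
    calc (X.v k 0 : ℝ) * X.v k 0 + X.v k 1 * X.v k 1
        = X.v k 0 * (X.v k 0 : ℝ) - X.v k 1 * (-(X.v k 1 : ℝ)) := by ring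
      _ = ∑ i, c i * ((X.v k 0 : ℝ) * X.v i 1 - X.v k 1 * X.v i 0) := by
        rw [h0, h1, Finset.mul_sum, Finset.mul_sum, ← Finset.sum_sub_distrib]
        exact Finset.sum_congr rfl fun i _ => by ring
      _ = 0 := Finset.sum_eq_zero fun i _ => by
        have : ((X.v k 0 * X.v i 1 - X.v k 1 * X.v i 0 : ℤ) : ℝ) = 0 := by
          exact_mod_cast congrArg (Int.cast (R := ℝ)) (h i)
        push_cast at this
        rw [this, mul_zero]
  apply X.v_ne_zero k
  have h0' : (X.v k 0 : ℝ) = 0 := by nlinarith [mul_self_nonneg (X.v k 0 : ℝ), mul_self_nonneg (X.v k 1 : ℝ)]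
  have h1' : (X.v k 1 : ℝ) = 0 := by nlinarith [mul_self_nonneg (X.v k 0 : ℝ), mul_self_nonneg (X.v k 1 : ℝ)]
  ext a
  fin_cases a
  · exact_mod_cast h0'
  · exact_mod_cast h1'

theorem nonempty_rays {m : ℕ} (X : CompleteSimplicialFan 2 m) : Nonempty (Fin m) := by
  by_contra h
  rw [not_nonempty_iff] at h
  obtain ⟨σ, -, c, -, -, hc⟩ := X.complete (fun _ => 1)
  simpa using hc 0

theorem isRelation_plucker (i j k : Fin m) :
    X.IsRelation (det2 (X.v i) (X.v j) • Pi.single k 1 - det2 (X.v k) (X.v j) • Pi.single i 1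
      - det2 (X.v i) (X.v k) • Pi.single j 1) := by
  unfold IsRelation
  simp only [Pi.sub_apply, Pi.smul_apply, smul_eq_mul, sub_smul, Finset.sum_sub_distrib,
    mul_smul, ← Finset.smul_sum, Pi.single_apply, ite_smul, one_smul, zero_smul,
    Finset.sum_ite_eq', Finset.mem_univ, if_true]
  ext a
  fin_cases a <;> simp [det2] <;> ring

theorem isRelation_opposite {i j : Fin m} (h : X.v j = -X.v i) :
    X.IsRelation (Pi.single i 1 + Pi.single j 1) := by
  unfold IsRelation
  simp only [Pi.add_apply, add_smul, Finset.sum_add_distrib, Pi.single_apply, ite_smul, one_smul,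
    zero_smul, Finset.sum_ite_eq', Finset.mem_univ, if_true, h]
  simp

theorem two_lt_card {e : Fin m → ℕ} (he : X.IsRelation fun i => (e i : ℤ)) (hpos : ∀ i, 0 < e i) :
    3 ≤ m := by
  obtain ⟨i⟩ := X.nonempty_rays
  obtain ⟨j, hj⟩ := X.exists_det2_ne_zero i
  have hij : i ≠ j := fun h => hj (by rw [h, det2_self])
  by_contra hm
  have huniv : (Finset.univ : Finset (Fin m)) = {i, j} := by
    symm
    apply Finset.eq_univ_of_card
    rw [Finset.card_pair hij, Fintype.card_fin]
    have := i.2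
    have := j.2
    have : (i : ℕ) ≠ j := fun h => hij (Fin.ext h)
    omega
  unfold IsRelation at he
  rw [huniv, Finset.sum_pair hij] at he
  have h0 := congrFun he 0
  have h1 := congrFun he 1
  simp only [Pi.add_apply, Pi.smul_apply, smul_eq_mul, Pi.zero_apply] at h0 h1
  have : (e i : ℤ) * det2 (X.v i) (X.v j) = 0 := by
    unfold det2; linear_combination X.v j 1 * h0 - X.v j 0 * h1
  rcases mul_eq_zero.1 this with h | h
  · have := hpos i; omega
  · exact hj h

/-- The empty cone yields one variable in `P`, and the ray of that variable yields another. -/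
theorem two_le_height_of_irrelevantIdeal_le {P : Ideal (MvPolynomial (Fin m) ℂ)} [P.IsPrime]
    (h : X.irrelevantIdeal ≤ P) : 2 ≤ P.height := by
  obtain ⟨i₀⟩ := X.nonempty_rays
  have key : ∀ σ ∈ X.cones, ∃ i ∉ σ, MvPolynomial.X i ∈ P := fun σ hσ => by
    have := h (Ideal.subset_span ⟨σ, hσ, rfl⟩)
    obtain ⟨i, hi, hP⟩ := (Ideal.IsPrime.prod_mem_iff).1 this
    exact ⟨i, by simpa using hi, hP⟩
  obtain ⟨i, -, hi⟩ := key ∅ (X.empty_mem i₀)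
  obtain ⟨j, hj, hj'⟩ := key {i} (X.ray_mem i)
  have := card_le_height_of_X_mem {i, j} P (by
    intro k hk
    rcases Finset.mem_insert.1 hk with rfl | hk
    · exact hi
    · rw [Finset.mem_singleton.1 hk]; exact hj')
  rw [Finset.card_pair (by rintro rfl; simp at hj)] at this
  exact_mod_cast this

/-- A prime over `J` contains either the saturation or the irrelevant ideal, and in the latter case
its height is at least two anyway. -/
theorem heightGE_of_saturation {J : Ideal (MvPolynomial (Fin m) ℂ)}
    (h : 2 ≤ (saturation J X.irrelevantIdeal).height) : HeightGE J 2 := by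
  intro P hP hJP
  by_cases hI : X.irrelevantIdeal ≤ P
  · exact X.two_le_height_of_irrelevantIdeal_le hI
  · refine h.trans (Ideal.height_mono (iSup_le fun d f hf => ?_))
    obtain ⟨g, hg, hgP⟩ := SetLike.not_le_iff_exists.1 hI
    have : f * g ^ d ∈ J := by
      have := Submodule.mem_colon.1 hf (g ^ d) (Ideal.pow_mem_pow hg d)
      simpa using this
    exact (hP.mem_or_mem (hJP this)).resolve_right fun h' => hgP (hP.mem_of_pow_mem d h')

end CompleteSimplicialFan

theorem pullback_injective {m n : ℕ} {F : Fin m → MvPolynomial (Fin (n + 1)) ℂ}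
    (hflat : (pullback F).Flat) : Function.Injective (pullback F) := by
  algebraize [pullback F]
  exact FaithfulSMul.algebraMap_injective (MvPolynomial (Fin m) ℂ) (MvPolynomial (Fin (n + 1)) ℂ)

/-- A flat pullback is injective, so no `F i` is constant. -/
theorem IsLifting.pos {q m n : ℕ} {X : CompleteSimplicialFan q m} {e : Fin m → ℕ}
    {F : Fin m → MvPolynomial (Fin (n + 1)) ℂ} (hF : IsLifting X e F)
    (hflat : (pullback F).Flat) (i : Fin m) : 0 < e i := by
  by_contra h
  have hF0 := hF.homogeneous i
  rw [Nat.eq_zero_of_not_pos h] at hF0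
  obtain ⟨c, hc⟩ : ∃ c, F i = C c := by
    exact ⟨_, (MvPolynomial.totalDegree_eq_zero_iff_eq_C).1 (Nat.le_zero.1 hF0.totalDegree_le)⟩
  have : (MvPolynomial.X i : MvPolynomial (Fin m) ℂ) = C c :=
    pullback_injective hflat (by rw [pullback_X, pullback_C, hc])
  have h1 := congrArg (pderiv i) this
  simp at h1

end ToricKupka

/-! ### Rows with projective syzygies. -/

namespace ToricKupka

theorem projective_ker_of_surjective {R M N : Type} [CommRing R] [AddCommGroup M] [AddCommGroup N]
    [Module R M] [Module R N] [Module.Projective R M] [Module.Projective R N] (f : M →ₗ[R] N)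
    (hf : Function.Surjective f) : Module.Projective R (LinearMap.ker f) := by
  obtain ⟨h, hh⟩ := Module.projective_lifting_property f LinearMap.id hf
  have hh' : ∀ y, f (h y) = y := fun y => LinearMap.congr_fun hh y
  refine Module.Projective.of_split (LinearMap.ker f).subtype
    (LinearMap.codRestrict (LinearMap.ker f) (LinearMap.id - h ∘ₗ f) fun x => by simp [hh']) ?_
  ext x
  have : f x = 0 := x.2
  simp [this]

section

variable {R ι : Type} [CommRing R]

/-- The determinant of a plane vector over `R` and an integral plane vector. -/
def detLeft (w : Fin 2 → R) (u : Fin 2 → ℤ) : R := w 0 * u 1 - w 1 * u 0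

theorem detLeft_int (u u' : Fin 2 → ℤ) : detLeft (fun a => (u a : R)) u' = (det2 u u' : ℤ) := by
  simp [detLeft, det2]

theorem det2_mul_eq (w : Fin 2 → R) (u u' : Fin 2 → ℤ) (a : Fin 2) :
    (det2 u u' : R) * w a = detLeft w u' * u a - detLeft w u * u' a := by
  fin_cases a <;> simp [detLeft, det2] <;> ring

variable [Fintype ι] [DecidableEq ι]

/-- A row `A` whose entries are, up to the pairwise coprime factors `ζ i`, the determinants of a
vector field `w = ∑ ℓ i (∏_{k ≠ i} ζ k) v i` and the vectors `v i`. -/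
structure IsRowSystem (v : ι → Fin 2 → ℤ) (ζ A ℓ : ι → R) (w : Fin 2 → R) : Prop where
  ne_zero : ∀ i, ζ i ≠ 0
  isRelPrime : ∀ i j, i ≠ j → IsRelPrime (ζ i) (ζ j)
  mul_eq : ∀ i, ζ i * A i = detLeft w (v i)
  eq_sum : ∀ a, w a = ∑ i, ℓ i * (v i a * ∏ k ∈ Finset.univ.erase i, ζ k)
  isUnit : ∀ p, (∀ i, p ∣ A i) → IsUnit p

namespace IsRowSystem

variable {v : ι → Fin 2 → ℤ} {ζ A ℓ : ι → R} {w : Fin 2 → R}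

theorem detLeft_sum (s : ι → R) (u : Fin 2 → ℤ) :
    detLeft (fun a => ∑ i, s i * (v i a * ∏ k ∈ Finset.univ.erase i, ζ k)) u =
      ∑ i, s i * ((det2 (v i) u : ℤ) * ∏ k ∈ Finset.univ.erase i, ζ k) := by
  unfold detLeft
  rw [Finset.sum_mul, Finset.sum_mul, ← Finset.sum_sub_distrib]
  refine Finset.sum_congr rfl fun i _ => ?_
  simp only [det2]; push_cast; ring

variable [IsDomain R]

theorem prod_ne_zero (h : IsRowSystem v ζ A ℓ w) (s : Finset ι) : ∏ k ∈ s, ζ k ≠ 0 :=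
  Finset.prod_ne_zero_iff.2 fun i _ => h.ne_zero i

theorem prod_mul_sum (h : IsRowSystem v ζ A ℓ w) (s : ι → R) :
    (∏ k, ζ k) * ∑ i, s i * A i =
      w 0 * (∑ i, s i * (v i 1 * ∏ k ∈ Finset.univ.erase i, ζ k)) -
      w 1 * (∑ i, s i * (v i 0 * ∏ k ∈ Finset.univ.erase i, ζ k)) := by
  rw [Finset.mul_sum, Finset.mul_sum, Finset.mul_sum, ← Finset.sum_sub_distrib]
  refine Finset.sum_congr rfl fun i _ => ?_
  rw [← Finset.mul_prod_erase _ _ (Finset.mem_univ i)]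
  have := h.mul_eq i
  unfold detLeft at this
  linear_combination (s i * ∏ k ∈ Finset.univ.erase i, ζ k) * this

theorem sum_eq_zero (h : IsRowSystem v ζ A ℓ w) : ∑ i, ℓ i * A i = 0 := by
  refine (mul_eq_zero.1 ((h.prod_mul_sum ℓ).trans ?_)).resolve_left (h.prod_ne_zero _)
  rw [← h.eq_sum, ← h.eq_sum]; ring

theorem sum_mul_eq_zero (h : IsRowSystem v ζ A ℓ w) {t : ι → R}
    (ht : ∀ a, ∑ i, t i * v i a = 0) : ∑ i, ζ i * t i * A i = 0 := by
  calc ∑ i, ζ i * t i * A i = w 0 * ∑ i, t i * v i 1 - w 1 * ∑ i, t i * v i 0 := by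
        rw [Finset.mul_sum, Finset.mul_sum, ← Finset.sum_sub_distrib]
        refine Finset.sum_congr rfl fun i _ => ?_
        have := h.mul_eq i
        unfold detLeft at this
        linear_combination t i * this
    _ = 0 := by rw [ht, ht]; ring

theorem exists_ne_zero (h : IsRowSystem v ζ A ℓ w) : ∃ i, A i ≠ 0 := by
  by_contra! h0
  exact not_isUnit_zero (h.isUnit 0 fun i => by rw [h0])

/-- Let `y` be the vector on the left. The product of all `ζ k` times `∑ s i * A i` is the
determinant of `w` and `y`, so the two are parallel. Each `A j` clears the denominator of their
ratio, and the `A j` have no common factor, so `y` is a multiple of `w`. -/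
theorem exists_eq_mul [UniqueFactorizationMonoid R] (h : IsRowSystem v ζ A ℓ w) {s : ι → R}
    (hs : ∑ i, s i * A i = 0) :
    ∃ κ, ∀ a, ∑ i, s i * (v i a * ∏ k ∈ Finset.univ.erase i, ζ k) = κ * w a := by
  set y : Fin 2 → R := fun a => ∑ i, s i * (v i a * ∏ k ∈ Finset.univ.erase i, ζ k) with hy
  have hwy : w 0 * y 1 = w 1 * y 0 := by
    have := h.prod_mul_sum s
    rw [hs, mul_zero] at this
    simp only [hy]
    linear_combination -this
  have hq : ∀ j, ∃ q, ∀ a, A j * y a = q * w a := by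
    intro j
    refine ⟨∑ i, s i * ((det2 (v i) (v j) : ℤ) * ∏ k ∈ (Finset.univ.erase i).erase j, ζ k),
      fun a => ?_⟩
    apply mul_left_cancel₀ (h.ne_zero j)
    have h1 : ζ j * ∑ i, s i * ((det2 (v i) (v j) : ℤ) *
        ∏ k ∈ (Finset.univ.erase i).erase j, ζ k) = detLeft y (v j) := by
      rw [hy, detLeft_sum, Finset.mul_sum]
      refine Finset.sum_congr rfl fun i _ => ?_
      rcases eq_or_ne i j with rfl | hij
      · rw [det2_self]; simp
      · rw [← Finset.mul_prod_erase (Finset.univ.erase i) ζ (a := j) (by simp [hij.symm])]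
        ring
    rw [← mul_assoc, h.mul_eq, ← mul_assoc, h1]
    unfold detLeft
    fin_cases a
    · simp only [Fin.zero_eta]; linear_combination (v j 0 : R) * hwy
    · simp only [Fin.mk_one]; linear_combination (v j 1 : R) * hwy
  choose q hq using hq
  obtain ⟨j₀, hj₀⟩ := h.exists_ne_zero
  obtain ⟨a₀, ha₀⟩ : ∃ a, w a ≠ 0 := by
    by_contra! h0
    have := h.mul_eq j₀
    rw [detLeft, h0, h0, zero_mul, zero_mul, sub_zero] at this
    exact mul_ne_zero (h.ne_zero _) hj₀ this
  obtain ⟨b, c, g, hbc, hb, hc⟩ := UniqueFactorizationMonoid.exists_reduced_factors (w a₀) ha₀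
    (y a₀)
  have hg : g ≠ 0 := by rintro rfl; simp at hb; exact ha₀ hb.symm
  have hbu : IsUnit b := h.isUnit b fun j => by
    have : A j * c = q j * b := by
      apply mul_left_cancel₀ hg
      have := hq j a₀
      rw [← hb, ← hc] at this
      linear_combination this
    exact hbc.dvd_of_dvd_mul_right (Dvd.intro_left _ this.symm)
  obtain ⟨u, rfl⟩ := hbu
  refine ⟨(↑u⁻¹ : R) * c, fun a => ?_⟩
  apply mul_left_cancel₀ hj₀
  have h1 : q j₀ = ↑u⁻¹ * c * A j₀ := by
    apply mul_right_cancel₀ ha₀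
    rw [← hq j₀ a₀, ← hb, ← hc]
    linear_combination -(A j₀ * g * c) * u.inv_mul
  change A j₀ * y a = _
  rw [hq, h1]; ring

/-- The map `(κ, t) ↦ κ ℓ + ζ t`, with `t` running through the relations among the `v i` over `R`,
is an isomorphism onto the syzygies: a tangent field of the foliation and, when `ζ` consists of the
coordinates, the radial fields. For surjectivity, a multiple of `ℓ` is subtracted to make the vector
sum vanish; coprimality then makes each remaining entry divisible by its `ζ j`. The relations are
the kernel of a split surjection onto the plane. -/
theorem projective_ker [UniqueFactorizationMonoid R] (hR : ∀ n : ℤ, n ≠ 0 → IsUnit (n : R))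
    (h : IsRowSystem v ζ A ℓ w) (hv : ∀ i, v i ≠ 0) (hind : ∃ i j, det2 (v i) (v j) ≠ 0) :
    Module.Projective R (LinearMap.ker (Fintype.linearCombination R A)) := by
  set T : (ι → R) →ₗ[R] (Fin 2 → R) := Fintype.linearCombination R fun i a => (v i a : R) with hT
  have hTa : ∀ t a, T t a = ∑ i, t i * v i a := fun t a => by
    simp [hT, Fintype.linearCombination_apply]
  have hTs : Function.Surjective T := by
    obtain ⟨i, j, hij⟩ := hind
    obtain ⟨u, hu⟩ := hR _ hij
    intro y
    refine ⟨(↑u⁻¹ : R) • (detLeft y (v j) • Pi.single i 1 - detLeft y (v i) • Pi.single j 1), ?_⟩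
    ext a
    rw [map_smul, Pi.smul_apply, hTa, smul_eq_mul]
    rw [show ∑ k, (detLeft y (v j) • Pi.single i 1 - detLeft y (v i) • Pi.single j 1 : ι → R) k *
      (v k a : R) = (det2 (v i) (v j) : R) * y a from ?_]
    · rw [← hu]; rw [← mul_assoc, u.inv_mul, one_mul]
    · rw [det2_mul_eq]
      simp [sub_mul, Finset.sum_sub_distrib, Pi.single_apply]
  have := projective_ker_of_surjective T hTs
  let Φ : (R × LinearMap.ker T) →ₗ[R] LinearMap.ker (Fintype.linearCombination R A) :=
    LinearMap.codRestrict _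
      ((LinearMap.toSpanSingleton R (ι → R) ℓ).coprod
        ((LinearMap.pi fun i => ζ i • LinearMap.proj i) ∘ₗ (LinearMap.ker T).subtype)) (by
      rintro ⟨κ, t, ht⟩
      have ht' : ∀ a, ∑ i, t i * v i a = 0 := fun a => by
        rw [← hTa, LinearMap.mem_ker.1 ht]; rfl
      simp only [LinearMap.mem_ker, LinearMap.coprod_apply, map_add,
        Fintype.linearCombination_apply]
      have h1 := h.sum_eq_zero
      have h2 := h.sum_mul_eq_zero ht'
      simp [mul_assoc, ← Finset.mul_sum, h1] at h2 ⊢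
      exact h2)
  have hΦ : ∀ κ t i, (Φ (κ, t) : ι → R) i = κ * ℓ i + ζ i * (t : ι → R) i := fun κ t i => by
    simp [Φ]
  have hprod : ∀ (t : ι → R) a, ∑ i, ζ i * t i * (v i a * ∏ k ∈ Finset.univ.erase i, ζ k) =
      (∏ k, ζ k) * T t a := fun t a => by
    rw [hTa, Finset.mul_sum]
    refine Finset.sum_congr rfl fun i _ => ?_
    rw [← Finset.mul_prod_erase _ _ (Finset.mem_univ i)]; ring
  have hinj : Function.Injective Φ := by
    rw [← LinearMap.ker_eq_bot, LinearMap.ker_eq_bot']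
    rintro ⟨κ, t⟩ h0
    have h1 : ∀ i, κ * ℓ i + ζ i * (t : ι → R) i = 0 := fun i => by
      rw [← hΦ, h0]; rfl
    have hκw : ∀ a, κ * w a = 0 := fun a => by
      have h2 : ∑ i, (κ * ℓ i + ζ i * (t : ι → R) i) *
          (v i a * ∏ k ∈ Finset.univ.erase i, ζ k) = 0 :=
        Finset.sum_eq_zero fun i _ => by rw [h1, zero_mul]
      simp only [add_mul, Finset.sum_add_distrib, mul_assoc, ← Finset.mul_sum] at h2
      have h3 := hprod t a
      rw [LinearMap.mem_ker.1 t.2] at h3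
      simp only [mul_assoc] at h3
      rw [h3] at h2
      rw [h.eq_sum a]
      simpa using h2
    have hκ : κ = 0 := by
      by_contra hκ
      obtain ⟨j₀, hj₀⟩ := h.exists_ne_zero
      have := h.mul_eq j₀
      rw [detLeft, (mul_eq_zero.1 (hκw 0)).resolve_left hκ,
        (mul_eq_zero.1 (hκw 1)).resolve_left hκ, zero_mul, zero_mul, sub_zero] at this
      exact mul_ne_zero (h.ne_zero _) hj₀ this
    refine Prod.ext hκ (Subtype.ext (funext fun i => ?_))
    have := h1 i
    rw [hκ, zero_mul, zero_add] at this
    exact (mul_eq_zero.1 this).resolve_left (h.ne_zero i)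
  have hsurj : Function.Surjective Φ := by
    rintro ⟨s, hs⟩
    rw [LinearMap.mem_ker, Fintype.linearCombination_apply] at hs
    obtain ⟨κ, hκ⟩ := h.exists_eq_mul hs
    have h0 : ∀ a, ∑ i, (s i - κ * ℓ i) * (v i a * ∏ k ∈ Finset.univ.erase i, ζ k) = 0 := fun a => by
      simp only [sub_mul, Finset.sum_sub_distrib, hκ, mul_assoc, ← Finset.mul_sum]
      rw [h.eq_sum a, sub_self]
    have hdvd : ∀ j, ζ j ∣ s j - κ * ℓ j := by
      intro j
      obtain ⟨a, ha⟩ := Function.ne_iff.1 (hv j)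
      have h1 := h0 a
      rw [← Finset.add_sum_erase _ _ (Finset.mem_univ j)] at h1
      have h2 : ζ j ∣ (s j - κ * ℓ j) * (v j a * ∏ k ∈ Finset.univ.erase j, ζ k) := by
        rw [eq_neg_of_add_eq_zero_left h1, dvd_neg]
        refine Finset.dvd_sum fun i hi => Dvd.dvd.mul_left (Dvd.dvd.mul_left ?_ _) _
        exact Finset.dvd_prod_of_mem _ (by simpa using (Finset.ne_of_mem_erase hi).symm)
      have h3 : IsRelPrime (ζ j) (∏ k ∈ Finset.univ.erase j, ζ k) :=
        IsRelPrime.prod_right fun i hi => h.isRelPrime j i (Finset.ne_of_mem_erase hi).symm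
      refine h3.dvd_of_dvd_mul_right ((hR _ ha).dvd_mul_left.1 ?_)
      rwa [mul_left_comm] at h2
    choose t ht using hdvd
    refine ⟨(κ, ⟨t, ?_⟩), Subtype.ext (funext fun i => ?_)⟩
    · rw [LinearMap.mem_ker]
      ext a
      have := h0 a
      simp only [ht, hprod] at this
      exact (mul_eq_zero.1 this).resolve_left (h.prod_ne_zero _)
    · rw [hΦ, ← ht]; simp
  exact Module.Projective.of_equiv (LinearEquiv.ofBijective Φ ⟨hinj, hsurj⟩)

end IsRowSystem

end

end ToricKupka

/-! ### Foliation forms on a toric surface as rows. -/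

namespace ToricKupka

open MvPolynomial

theorem isUnit_intCast {σ : Type} {n : ℤ} (hn : n ≠ 0) : IsUnit (n : MvPolynomial σ ℂ) := by
  rw [show (n : MvPolynomial σ ℂ) = C (n : ℂ) by simp]
  exact (isUnit_iff_ne_zero.2 (Int.cast_ne_zero.2 hn)).map C

theorem isRelPrime_X {σ : Type} {i j : σ} (h : i ≠ j) :
    IsRelPrime (X i : MvPolynomial σ ℂ) (X j) := by
  have hp : Prime (X i : MvPolynomial σ ℂ) := X_prime (R := ℂ) (i := i)
  rw [hp.irreducible.isRelPrime_iff_not_dvd, X_dvd_X]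
  simpa using h

theorem prod_X_dvd_monomial {σ : Type} (s : Finset σ) (b : σ →₀ ℕ) (h : ∀ k ∈ s, b k ≠ 0) :
    ∏ k ∈ s, (X k : MvPolynomial σ ℂ) ∣ monomial b 1 := by
  refine Finset.prod_dvd_of_isRelPrime (fun i _ j _ hij => isRelPrime_X hij) fun k hk => ?_
  rw [X_dvd_monomial]
  exact Or.inr (h k hk)

theorem coeff_detLeft {σ : Type} (w : Fin 2 → MvPolynomial σ ℂ) (u : Fin 2 → ℤ) (b : σ →₀ ℕ) :
    coeff b (detLeft w u) = detLeft (fun a => coeff b (w a)) u := by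
  have h : ∀ (n : ℤ) (f : MvPolynomial σ ℂ), coeff b (f * (n : MvPolynomial σ ℂ)) = coeff b f * n := fun n f => by
    rw [show (n : MvPolynomial σ ℂ) = C (n : ℂ) by simp, mul_comm, coeff_C_mul, mul_comm]
  simp only [detLeft, coeff_sub, h]

theorem exists_eq_mul_of_detLeft_eq_zero {R : Type} [CommRing R]
    (hR : ∀ n : ℤ, n ≠ 0 → IsUnit (n : R)) {w : Fin 2 → R} {u : Fin 2 → ℤ} (hu : u ≠ 0)
    (h : detLeft w u = 0) : ∃ c, ∀ a, w a = c * u a := by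
  unfold detLeft at h
  obtain ⟨a, ha⟩ := Function.ne_iff.1 hu
  obtain ⟨y, hy⟩ := hR _ ha
  have hy' := y.inv_mul
  rw [hy] at hy'
  refine ⟨w a * ↑y⁻¹, ?_⟩
  rw [Fin.forall_fin_two]
  fin_cases a
  · simp only [Fin.zero_eta] at hy' ⊢
    exact ⟨by linear_combination -w 0 * hy', by linear_combination -w 1 * hy' - ↑y⁻¹ * h⟩
  · simp only [Fin.mk_one] at hy' ⊢
    exact ⟨by linear_combination -w 0 * hy' + ↑y⁻¹ * h, by linear_combination -w 1 * hy'⟩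

namespace CompleteSimplicialFan

variable {m : ℕ} (X : CompleteSimplicialFan 2 m)

theorem plucker_eq {R : Type} [CommRing R] {f : Fin m → R}
    (hf : ∀ a, X.IsRelation a → ∑ i, (a i : R) * f i = 0) (i j k : Fin m) :
    (det2 (X.v i) (X.v j) : R) * f k =
      det2 (X.v k) (X.v j) * f i + det2 (X.v i) (X.v k) * f j := by
  have := hf _ (X.isRelation_plucker i j k)
  simp [sub_mul, Finset.sum_sub_distrib, Pi.single_apply] at this
  linear_combination this

/-- A row killed by all relations comes from the plane: Cramer's rule at two independent rays
determines `w`. -/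
theorem exists_detLeft_eq {f : Fin m → MvPolynomial (Fin m) ℂ}
    (hf : ∀ a, X.IsRelation a → ∑ i, (a i : MvPolynomial (Fin m) ℂ) * f i = 0) :
    ∃ w, ∀ k, f k = detLeft w (X.v k) := by
  obtain ⟨i⟩ := X.nonempty_rays
  obtain ⟨j, hij⟩ := X.exists_det2_ne_zero i
  obtain ⟨y, hy⟩ := isUnit_intCast (σ := Fin m) hij
  refine ⟨fun a => (↑y⁻¹ : MvPolynomial (Fin m) ℂ) * (f j * X.v i a - f i * X.v j a),
    fun k => ?_⟩
  have h1 := X.plucker_eq hf i j k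
  rw [← hy] at h1
  have h2 := y.inv_mul
  simp only [det2] at h1
  push_cast at h1
  unfold detLeft
  linear_combination (↑y⁻¹ : MvPolynomial (Fin m) ℂ) * h1 - f k * h2

theorem exists_detLeft_ne_zero {w : Fin 2 → ℂ} (hw : w ≠ 0) : ∃ k, detLeft w (X.v k) ≠ 0 := by
  by_contra! h
  obtain ⟨i⟩ := X.nonempty_rays
  obtain ⟨j, hij⟩ := X.exists_det2_ne_zero i
  apply hw
  ext a
  have := det2_mul_eq w (X.v i) (X.v j) a
  rw [h, h, zero_mul, zero_mul, sub_zero] at this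
  exact (mul_eq_zero.1 this).resolve_left (Int.cast_ne_zero.2 hij)

/-- A vector field all of whose monomials are combinations of the admissible `v i` is a
combination of the `(∏_{k ≠ i} ζ k) v i`. -/
theorem exists_eq_sum_of_span {ζ : Fin m → MvPolynomial (Fin m) ℂ}
    {w : Fin 2 → MvPolynomial (Fin m) ℂ}
    (h : ∀ b, (fun a => coeff b (w a)) ∈ Submodule.span ℂ
      {u | ∃ i, (∏ k ∈ Finset.univ.erase i, ζ k ∣ monomial b 1) ∧ u = fun a => (X.v i a : ℂ)}) :
    ∃ ℓ : Fin m → MvPolynomial (Fin m) ℂ,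
      ∀ a, w a = ∑ i, ℓ i * (X.v i a * ∏ k ∈ Finset.univ.erase i, ζ k) := by
  set L := Fintype.linearCombination (MvPolynomial (Fin m) ℂ)
    (fun i : Fin m => fun a : Fin 2 =>
      (X.v i a : MvPolynomial (Fin m) ℂ) * ∏ k ∈ Finset.univ.erase i, ζ k) with hL
  suffices hw : w ∈ LinearMap.range L by
    obtain ⟨ℓ, hℓ⟩ := hw
    refine ⟨ℓ, fun a => ?_⟩
    rw [← hℓ]
    simp [hL, Fintype.linearCombination_apply]
  have hb : ∀ b, ∀ u ∈ Submodule.span ℂ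
      {u | ∃ i, (∏ k ∈ Finset.univ.erase i, ζ k ∣ monomial b 1) ∧ u = fun a => (X.v i a : ℂ)},
      (fun a => monomial b (u a)) ∈ LinearMap.range L := by
    intro b u hu
    induction hu using Submodule.span_induction with
    | mem u hu =>
      obtain ⟨i, ⟨q, hq⟩, rfl⟩ := hu
      refine ⟨Pi.single i q, ?_⟩
      ext1 a
      rw [hL, Fintype.linearCombination_apply]
      simp only [Finset.sum_apply, Pi.smul_apply, Pi.single_apply, ite_smul, zero_smul, smul_eq_mul]
      rw [Finset.sum_eq_single i (fun k _ hk => by rw [if_neg hk]; rfl) (by simp)]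
      rw [if_pos rfl, Pi.smul_apply, smul_eq_mul, ← mul_one (X.v i a : ℂ), ← C_mul_monomial, hq]
      simp
      ring
    | zero => simp only [Pi.zero_apply, map_zero]; exact Submodule.zero_mem _
    | add u u' _ _ h1 h2 =>
      simp only [Pi.add_apply, map_add]
      exact Submodule.add_mem _ h1 h2
    | smul c u _ h1 =>
      have := Submodule.smul_mem _ (C c) h1
      convert this using 1
      ext1 a
      simp [C_mul_monomial]
  have : w = ∑ b ∈ (w 0).support ∪ (w 1).support, fun a => monomial b (coeff b (w a)) := by
    ext1 a
    rw [Finset.sum_apply]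
    conv_lhs => rw [(w a).as_sum]
    refine Finset.sum_subset ?_ fun b _ hb => ?_
    · fin_cases a
      · exact Finset.subset_union_left
      · exact Finset.subset_union_right
    · rw [notMem_support_iff.1 hb, map_zero]
  rw [this]
  exact Submodule.sum_mem _ fun b _ => hb b _ (h b)

end CompleteSimplicialFan

section

variable {m : ℕ} {X : CompleteSimplicialFan 2 m} {A : OneForm (Fin m)}
  {w : Fin 2 → MvPolynomial (Fin m) ℂ}

theorem IsFoliationForm.exists_detLeft_eq {D : X.Cl} (hA : IsFoliationForm X D A) :
    ∃ w, ∀ k, MvPolynomial.X k * A k = detLeft w (X.v k) :=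
  X.exists_detLeft_eq fun a ha => by
    rw [← hA.descent a ha]
    exact Finset.sum_congr rfl fun i _ => by simp [mul_assoc]

/-- A monomial without `X k` does not occur in `X k * A k`. -/
theorem detLeft_coeff_eq_zero (hw : ∀ k, MvPolynomial.X k * A k = detLeft w (X.v k))
    {b : Fin m →₀ ℕ} {k : Fin m} (hb : b k = 0) :
    detLeft (fun a => coeff b (w a)) (X.v k) = 0 := by
  rw [← coeff_detLeft, ← hw, coeff_X_mul', if_neg (by simpa using hb)]

theorem det2_eq_zero_of_coeff (hw : ∀ k, MvPolynomial.X k * A k = detLeft w (X.v k))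
    {b : Fin m →₀ ℕ} (hb : (fun a => coeff b (w a)) ≠ 0) {i j : Fin m} (hi : b i = 0)
    (hj : b j = 0) : det2 (X.v i) (X.v j) = 0 := by
  by_contra h
  apply hb
  ext a
  have := det2_mul_eq (fun a => coeff b (w a)) (X.v i) (X.v j) a
  rw [detLeft_coeff_eq_zero hw hi, detLeft_coeff_eq_zero hw hj, zero_mul, zero_mul, sub_zero] at this
  exact (mul_eq_zero.1 this).resolve_left (Int.cast_ne_zero.2 h)

theorem weight_of_coeff_ne_zero (hw : ∀ k, MvPolynomial.X k * A k = detLeft w (X.v k))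
    {δ : Fin m → ℤ} (hδ : ∀ i, ∀ b ∈ (A i).support, ∀ a,
      X.IsRelation a → ∑ k, a k * (b k : ℤ) = ∑ k, a k * δ k - a i)
    {b : Fin m →₀ ℕ} (hb : (fun a => coeff b (w a)) ≠ 0) {a : Fin m → ℤ} (ha : X.IsRelation a) :
    ∑ k, a k * (b k : ℤ) = ∑ k, a k * δ k := by
  obtain ⟨k, hk⟩ := X.exists_detLeft_ne_zero hb
  rw [← coeff_detLeft, ← hw, coeff_X_mul'] at hk
  split_ifs at hk with hbk
  · have h1 := hδ k _ (mem_support_iff.2 hk) a ha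
    have h2 : b = (b - Finsupp.single k 1) + Finsupp.single k 1 := by
      ext l
      rcases eq_or_ne l k with rfl | hl
      · have := Finsupp.mem_support_iff.1 hbk
        simp; omega
      · simp [Finsupp.single_eq_of_ne hl]
    rw [h2]
    simp only [Finsupp.add_apply, Nat.cast_add, mul_add, Finset.sum_add_distrib, h1]
    simp [Finsupp.single_apply]
  · exact absurd rfl hk

theorem isUnit_of_forall_dvd (hJ : HeightGE A.singularIdeal 2) {p : MvPolynomial (Fin m) ℂ}
    (hp : ∀ i, p ∣ A i) : IsUnit p := by
  refine hJ.isUnit_of_dvd fun f hf => ?_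
  rw [← Ideal.mem_span_singleton]
  refine (Ideal.span_le.2 ?_ : A.singularIdeal ≤ _) hf
  rintro _ ⟨i, rfl⟩
  exact Ideal.mem_span_singleton.2 (hp i)

/-- If the coefficient of `α` at a ray with an opposite ray vanishes, then `α` is the pullback of
the pencil form of the corresponding ruling. -/
theorem exists_eq_of_coefficient_eq_zero (hJ : HeightGE A.singularIdeal 2)
    (hw : ∀ k, MvPolynomial.X k * A k = detLeft w (X.v k)) {i j : Fin m} (hij : i ≠ j)
    (hopp : det2 (X.v i) (X.v j) = 0) (h0 : A i = 0) :
    ∃ c, IsUnit c ∧ ∀ a, w a = c * ((X.v i a : MvPolynomial (Fin m) ℂ) *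
      ∏ k ∈ (Finset.univ.erase i).erase j, MvPolynomial.X k) := by
  obtain ⟨u, hu⟩ := exists_eq_mul_of_detLeft_eq_zero (fun n hn => isUnit_intCast hn) (X.v_ne_zero i)
    (by rw [← hw, h0, mul_zero])
  have hXA : ∀ k, MvPolynomial.X k * A k = (det2 (X.v i) (X.v k) : MvPolynomial (Fin m) ℂ) * u := fun k => by
    rw [hw]; unfold detLeft det2; rw [hu, hu]; push_cast; ring
  have hdvd : ∏ k ∈ (Finset.univ.erase i).erase j, MvPolynomial.X k ∣ u := by
    refine Finset.prod_dvd_of_isRelPrime (fun i _ j _ hij => isRelPrime_X hij) fun k hk => ?_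
    have hk' : det2 (X.v i) (X.v k) ≠ 0 := fun h => by
      have h1 := X.eq_neg_of_det2_eq_zero hij hopp
      have hki : i ≠ k := by rintro rfl; simp at hk
      have hkj : j ≠ k := by rintro rfl; simp at hk
      have h2 := X.eq_neg_of_det2_eq_zero hki h
      have h3 := X.eq_neg_of_det2_eq_zero hkj (by rw [h1, h2]; unfold det2; simp; ring)
      have h4 : X.v i = 0 := by
        ext a
        have e1 := congrFun h1 a
        have e2 := congrFun h2 a
        have e3 := congrFun h3 a
        simp only [Pi.neg_apply, Pi.zero_apply] at e1 e2 e3 ⊢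
        omega
      exact X.v_ne_zero i h4
    exact (isUnit_intCast hk').dvd_mul_left.1 (Dvd.intro _ (hXA k))
  obtain ⟨c, rfl⟩ := hdvd
  refine ⟨c, isUnit_of_forall_dvd hJ fun k => ?_, fun a => by rw [hu]; ring⟩
  rcases eq_or_ne k i with rfl | hki
  · rw [h0]; exact dvd_zero _
  rcases eq_or_ne k j with rfl | hkj
  · have := hXA k
    rw [hopp, Int.cast_zero, zero_mul] at this
    rw [(mul_eq_zero.1 this).resolve_left (X_ne_zero k)]
    exact dvd_zero _
  have := hXA k
  rw [← Finset.mul_prod_erase _ _ (a := k) (by simp [hki, hkj])] at this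
  refine ⟨(det2 (X.v i) (X.v k) : MvPolynomial (Fin m) ℂ) * ∏ k ∈ ((Finset.univ.erase i).erase j).erase k, MvPolynomial.X k, ?_⟩
  apply mul_left_cancel₀ (X_ne_zero (R := ℂ) k)
  rw [this]; ring

/-- The monomials of `w` have to be distributed among the rays. If a monomial misses exactly one
variable `X i`, its coefficient is parallel to `v i` and the other variables divide it; if it misses
none, two independent rays serve. A monomial missing two variables forces opposite rays `i`, `j` and
weight zero for their relation, so the monomials of `A i` and `A j` would have negative weight.
Hence these coefficients vanish, `α` comes from a ruling, and `ζ i = ζ j = 1`. -/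
theorem IsFoliationForm.exists_isRowSystem {D : X.Cl} (hA : IsFoliationForm X D A)
    (hJ : HeightGE A.singularIdeal 2) :
    ∃ ζ ℓ w, IsRowSystem X.v ζ A ℓ w ∧ ∀ i, ζ i = MvPolynomial.X i ∨ ζ i = 1 := by
  obtain ⟨w, hw⟩ := hA.exists_detLeft_eq
  by_cases hp : ∃ b : Fin m →₀ ℕ, (fun a => coeff b (w a)) ≠ 0 ∧ ∃ i j, i ≠ j ∧ b i = 0 ∧ b j = 0
  · obtain ⟨b, hb, i, j, hij, hi, hj⟩ := hp
    have hd := det2_eq_zero_of_coeff hw hb hi hj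
    have hrel := X.isRelation_opposite (X.eq_neg_of_det2_eq_zero hij hd)
    obtain ⟨δ, hδ⟩ := hA.exists_weight
    have hsum : ∀ b : Fin m →₀ ℕ,
        ∑ k, (Pi.single i 1 + Pi.single j 1 : Fin m → ℤ) k * (b k : ℤ) = b i + b j := fun b => by
      simp [add_mul, Finset.sum_add_distrib, Pi.single_apply]
    have hw0 := weight_of_coeff_ne_zero hw hδ hb hrel
    rw [hsum, hi, hj] at hw0
    have hA0 : ∀ k, k = i ∨ k = j → A k = 0 := by
      intro k hk
      by_contra h
      obtain ⟨b', hb'⟩ := ne_zero_iff.1 h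
      have h1 := hδ k b' (mem_support_iff.2 hb') _ hrel
      rw [← hw0, hsum] at h1
      rcases hk with rfl | rfl
      · rw [Pi.add_apply, Pi.single_eq_same, Pi.single_eq_of_ne hij] at h1
        push_cast at h1; omega
      · rw [Pi.add_apply, Pi.single_eq_same, Pi.single_eq_of_ne hij.symm] at h1
        push_cast at h1; omega
    obtain ⟨c, -, hc⟩ := exists_eq_of_coefficient_eq_zero hJ hw hij hd (hA0 i (Or.inl rfl))
    refine ⟨fun k => if k = i ∨ k = j then 1 else MvPolynomial.X k, Pi.single i c, w,
      ⟨fun k => ?_, fun k l hkl => ?_, fun k => ?_, fun a => ?_,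
        fun p hp => isUnit_of_forall_dvd hJ hp⟩, fun k => ?_⟩
    · split_ifs
      · exact one_ne_zero
      · exact X_ne_zero k
    · split_ifs
      · exact isRelPrime_one_left
      · exact isRelPrime_one_left
      · exact isRelPrime_one_right
      · exact isRelPrime_X hkl
    · split_ifs with h
      · rw [← hw, hA0 k h, mul_zero, mul_zero]
      · exact hw k
    · rw [hc, Finset.sum_eq_single i (fun k _ hk => by rw [Pi.single_eq_of_ne hk, zero_mul])
        (by simp), Pi.single_eq_same,
        ← Finset.mul_prod_erase (Finset.univ.erase i) _ (a := j) (by simp [hij.symm]),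
        if_pos (Or.inr rfl), one_mul]
      congr 2
      refine Finset.prod_congr rfl fun k hk => ?_
      simp only [Finset.mem_erase, Finset.mem_univ, and_true] at hk
      rw [if_neg (by tauto)]
    · by_cases h : k = i ∨ k = j
      · exact Or.inr (if_pos h)
      · exact Or.inl (if_neg h)
  · push Not at hp
    obtain ⟨ℓ, hℓ⟩ := X.exists_eq_sum_of_span (ζ := MvPolynomial.X) (w := w) fun b => by
      by_cases hb : (fun a => coeff b (w a)) = 0
      · rw [hb]; exact Submodule.zero_mem _
      by_cases hN : ∃ i, b i = 0
      · obtain ⟨i, hi⟩ := hN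
        obtain ⟨c, hc⟩ := exists_eq_mul_of_detLeft_eq_zero
          (fun n hn => isUnit_iff_ne_zero.2 (Int.cast_ne_zero.2 hn)) (X.v_ne_zero i)
          (detLeft_coeff_eq_zero hw hi)
        have : (fun a => coeff b (w a)) = c • fun a => (X.v i a : ℂ) := by
          ext a; rw [hc]; rfl
        rw [this]
        refine Submodule.smul_mem _ _ (Submodule.subset_span ⟨i, ?_, rfl⟩)
        refine prod_X_dvd_monomial _ _ fun k hk => ?_
        exact hp b hb i k (Finset.ne_of_mem_erase hk).symm hi
      · push Not at hN
        obtain ⟨i⟩ := X.nonempty_rays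
        obtain ⟨j, hij⟩ := X.exists_det2_ne_zero i
        have hmem : ∀ k, (fun a => (X.v k a : ℂ)) ∈ Submodule.span ℂ
            {u | ∃ i, (∏ k ∈ Finset.univ.erase i, (MvPolynomial.X k : MvPolynomial (Fin m) ℂ) ∣
              monomial b 1) ∧ u = fun a => (X.v i a : ℂ)} := fun k =>
          Submodule.subset_span ⟨k, prod_X_dvd_monomial _ _ fun l _ => hN l, rfl⟩
        have : (fun a => coeff b (w a)) = (det2 (X.v i) (X.v j) : ℂ)⁻¹ •
            (detLeft (fun a => coeff b (w a)) (X.v j) • (fun a => (X.v i a : ℂ)) -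
              detLeft (fun a => coeff b (w a)) (X.v i) • (fun a => (X.v j a : ℂ))) := by
          ext a
          simp only [Pi.smul_apply, Pi.sub_apply, smul_eq_mul]
          rw [← det2_mul_eq, inv_mul_cancel_left₀ (Int.cast_ne_zero.2 hij)]
        rw [this]
        exact Submodule.smul_mem _ _ (Submodule.sub_mem _ (Submodule.smul_mem _ _ (hmem i))
          (Submodule.smul_mem _ _ (hmem j)))
    exact ⟨MvPolynomial.X, ℓ, w, ⟨fun k => X_ne_zero k, fun k l hkl => isRelPrime_X hkl, hw, hℓ,
      fun p hp => isUnit_of_forall_dvd hJ hp⟩, fun i => Or.inl rfl⟩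

end

end ToricKupka

/-! ### Syzygies after pullback, and division by the variables of opposite rays. -/

namespace ToricKupka

open MvPolynomial

section

variable {m n : ℕ} {X : CompleteSimplicialFan 2 m} {A : OneForm (Fin m)} {D : X.Cl}
  {F : Fin m → MvPolynomial (Fin (n + 1)) ℂ}

theorem map_detLeft {S R : Type} [CommRing S] [CommRing R] (φ : S →+* R) (w : Fin 2 → S)
    (u : Fin 2 → ℤ) : φ (detLeft w u) = detLeft (fun a => φ (w a)) u := by
  simp [detLeft]

theorem heightGE_span_pair_X {i j : Fin m} (hij : i ≠ j) :
    HeightGE (Ideal.span {(MvPolynomial.X i : MvPolynomial (Fin m) ℂ), MvPolynomial.X j}) 2 := by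
  intro P hP h
  have := card_le_height_of_X_mem {i, j} P (by
    intro k hk
    apply h
    rcases Finset.mem_insert.1 hk with rfl | hk
    · exact Ideal.subset_span (by simp)
    · rw [Finset.mem_singleton.1 hk]; exact Ideal.subset_span (by simp))
  rw [Finset.card_pair hij] at this
  exact_mod_cast this

/-- Flat pullback keeps the ideal of two variables at height two. -/
theorem isRelPrime_of_flat (hflat : (pullback F).Flat) {i j : Fin m} (hij : i ≠ j) :
    IsRelPrime (F i) (F j) := by
  intro p hi hj
  refine ((heightGE_span_pair_X hij).map_of_flat _ hflat).isUnit_of_dvd fun f hf => ?_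
  rw [← Ideal.mem_span_singleton]
  refine (Ideal.map_le_iff_le_comap.2 (Ideal.span_le.2 ?_) :
    Ideal.map (pullback F) (Ideal.span {MvPolynomial.X i, MvPolynomial.X j}) ≤ _) hf
  rintro x (rfl | hx)
  · simpa [pullback_X, Ideal.mem_span_singleton] using hi
  · rw [Set.mem_singleton_iff.1 hx]
    simpa [pullback_X, Ideal.mem_span_singleton] using hj

/-- The identities of a row system pull back under any ring map; the nonvanishing and coprimality
conditions survive because the pullback is flat. -/
theorem projective_ker_pullback (hA : IsFoliationForm X D A) (hJ : HeightGE A.singularIdeal 2)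
    (hflat : (pullback F).Flat) :
    Module.Projective (MvPolynomial (Fin (n + 1)) ℂ)
      (LinearMap.ker (Fintype.linearCombination (MvPolynomial (Fin (n + 1)) ℂ)
        fun i => pullback F (A i))) := by
  obtain ⟨ζ, ℓ, w, h, hζ⟩ := hA.exists_isRowSystem hJ
  obtain ⟨i⟩ := X.nonempty_rays
  have hrow : IsRowSystem X.v (fun i => pullback F (ζ i)) (fun i => pullback F (A i))
      (fun i => pullback F (ℓ i)) (fun a => pullback F (w a)) := by
    refine ⟨fun i => ?_, fun i j hij => ?_, fun i => ?_, fun a => ?_, fun p hp => ?_⟩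
    · exact (map_ne_zero_iff _ (pullback_injective hflat)).2 (h.ne_zero i)
    · rcases hζ i with hi | hi
      · rcases hζ j with hj | hj
        · rw [hi, hj, pullback_X, pullback_X]; exact isRelPrime_of_flat hflat hij
        · rw [hj, map_one]; exact isRelPrime_one_right
      · rw [hi, map_one]; exact isRelPrime_one_left
    · rw [← map_mul, h.mul_eq, map_detLeft]
    · rw [h.eq_sum]; simp [map_sum, map_prod]
    · refine (hJ.map_of_flat _ hflat).isUnit_of_dvd fun f hf => ?_
      rw [← Ideal.mem_span_singleton]
      refine (Ideal.map_le_iff_le_comap.2 (Ideal.span_le.2 ?_) :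
        Ideal.map (pullback F) A.singularIdeal ≤ _) hf
      rintro _ ⟨i, rfl⟩
      simpa [Ideal.mem_span_singleton] using hp i
  exact hrow.projective_ker (fun n hn => isUnit_intCast hn) X.v_ne_zero
    ⟨i, X.exists_det2_ne_zero i⟩

namespace CompleteSimplicialFan

variable (X)

theorem det2_eq_zero_trans {i j k : Fin m} (h1 : det2 (X.v i) (X.v j) = 0)
    (h2 : det2 (X.v j) (X.v k) = 0) : det2 (X.v i) (X.v k) = 0 := by
  rcases eq_or_ne i j with rfl | hij
  · exact h2
  · rw [X.eq_neg_of_det2_eq_zero hij h1] at h2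
    unfold det2 at h2 ⊢
    simp only [Pi.neg_apply] at h2
    linarith

end CompleteSimplicialFan

/-- The coefficients of `α` divided by the variables of the opposite rays form a row whose kernel
is projective. -/
theorem exists_block_isRowSystem (hJ : HeightGE A.singularIdeal 2)
    {w : Fin 2 → MvPolynomial (Fin m) ℂ}
    (hw : ∀ k, MvPolynomial.X k * A k = detLeft w (X.v k)) :
    ∃ ζ B ℓ, IsRowSystem X.v ζ B ℓ w ∧
      (∀ k j, det2 (X.v k) (X.v j) ≠ 0 → ∃ q, ζ k * MvPolynomial.X j * q = ∏ i, MvPolynomial.X i) ∧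
      (∀ i, A i ∈ Ideal.span (Set.range B)) ∧
      ∀ i j, i ≠ j → det2 (X.v i) (X.v j) = 0 →
        ∃ G ∈ Ideal.span (Set.range B), MvPolynomial.X i * MvPolynomial.X j * G =
          detLeft w (X.v i) := by
  classical
  -- Classes of parallel rays: a ray and possibly its opposite. The smallest index represents its
  -- class, so that every variable enters exactly one `ζ`.
  set M : Fin m → Finset (Fin m) := fun i => {k | det2 (X.v i) (X.v k) = 0} with hM
  have hmem : ∀ i k, k ∈ M i ↔ det2 (X.v i) (X.v k) = 0 := fun i k => by simp [hM]
  have hsymm : ∀ i k, k ∈ M i → i ∈ M k := fun i k h => by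
    rw [hmem] at h ⊢; rw [det2_swap, h, neg_zero]
  have htrans : ∀ i j k, j ∈ M i → k ∈ M j → k ∈ M i := fun i j k h1 h2 => by
    rw [hmem] at *; exact X.det2_eq_zero_trans h1 h2
  have hself : ∀ i, i ∈ M i := fun i => by rw [hmem, det2_self]
  have hdvd : ∀ i, ∏ k ∈ M i, MvPolynomial.X k ∣ detLeft w (X.v i) := fun i => by
    refine Finset.prod_dvd_of_isRelPrime (fun i _ j _ hij => isRelPrime_X hij) fun k hk => ?_
    rcases eq_or_ne i k with rfl | hik
    · exact Dvd.intro _ (hw i)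
    · have := X.eq_neg_of_det2_eq_zero hik ((hmem i k).1 hk)
      refine ⟨-A k, ?_⟩
      rw [mul_neg, hw, this]
      unfold detLeft; simp; ring
  choose G hG using hdvd
  set rep : Fin m → Prop := fun i => ∀ k ∈ M i, i ≤ k with hrep
  have hexrep : ∀ i, ∃ r ∈ M i, rep r := fun i => by
    have hne : (M i).Nonempty := ⟨i, hself i⟩
    exact ⟨(M i).min' hne, (M i).min'_mem hne, fun k hk =>
      (M i).min'_le _ (htrans _ _ _ ((M i).min'_mem hne) hk)⟩
  have hrepeq : ∀ i j, rep i → rep j → j ∈ M i → i = j := fun i j hi hj h =>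
    le_antisymm (hi j h) (hj i (hsymm _ _ h))
  set ζ : Fin m → MvPolynomial (Fin m) ℂ :=
    fun i => if rep i then ∏ k ∈ M i, MvPolynomial.X k else 1 with hζ
  set B : Fin m → MvPolynomial (Fin m) ℂ :=
    fun i => if rep i then G i else detLeft w (X.v i) with hB
  have hζB : ∀ i, ζ i * B i = detLeft w (X.v i) := fun i => by
    simp only [hζ, hB]
    split_ifs
    · exact (hG i).symm
    · exact one_mul _
  have hζ0 : ∀ i, ζ i ≠ 0 := fun i => by
    simp only [hζ]
    split_ifs
    · exact Finset.prod_ne_zero_iff.2 fun k _ => X_ne_zero k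
    · exact one_ne_zero
  have hζrel : ∀ i j, i ≠ j → IsRelPrime (ζ i) (ζ j) := fun i j hij => by
    simp only [hζ]
    split_ifs with hi hj
    · refine IsRelPrime.prod_left fun k hk => IsRelPrime.prod_right fun l hl => isRelPrime_X ?_
      rintro rfl
      exact hij (hrepeq i j hi hj (htrans _ _ _ hk (hsymm _ _ hl)))
    · exact isRelPrime_one_right
    · exact isRelPrime_one_left
    · exact isRelPrime_one_left
  have hζdvd : ∀ k (b : Fin m →₀ ℕ), (∀ l ∈ M k, b l ≠ 0) → ζ k ∣ monomial b 1 := by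
    intro k b h
    simp only [hζ]
    split_ifs
    · exact prod_X_dvd_monomial _ _ h
    · exact one_dvd _
  have hprod : ∀ (s : Finset (Fin m)) (b : Fin m →₀ ℕ), (∀ k ∈ s, rep k → ∀ l ∈ M k, b l ≠ 0) →
      ∏ k ∈ s, ζ k ∣ monomial b 1 := fun s b h => by
    refine Finset.prod_dvd_of_isRelPrime (fun i _ j _ hij => hζrel i j hij) fun k hk => ?_
    by_cases hk' : rep k
    · exact hζdvd k b (h k hk hk')
    · simp only [hζ, if_neg hk']; exact one_dvd _
  -- The variables missing from a monomial of `w` belong to a single class, so the factors of all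
  -- other classes divide it. Grouping the variables in this way leaves no exceptional case.
  obtain ⟨ℓ, hℓ⟩ := X.exists_eq_sum_of_span (ζ := ζ) (w := w) fun b => by
    by_cases hb : (fun a => coeff b (w a)) = 0
    · rw [hb]; exact Submodule.zero_mem _
    by_cases hN : ∃ i, b i = 0
    · obtain ⟨i, hi⟩ := hN
      obtain ⟨r, hri, hr⟩ := hexrep i
      have hdr : detLeft (fun a => coeff b (w a)) (X.v r) = 0 := by
        rcases eq_or_ne i r with rfl | hir
        · exact detLeft_coeff_eq_zero hw hi
        · have h1 := detLeft_coeff_eq_zero hw hi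
          rw [X.eq_neg_of_det2_eq_zero hir ((hmem _ _).1 hri)]
          unfold detLeft at h1 ⊢
          simp only [Pi.neg_apply, Int.cast_neg]
          linear_combination -h1
      obtain ⟨c, hc⟩ := exists_eq_mul_of_detLeft_eq_zero
        (fun n hn => isUnit_iff_ne_zero.2 (Int.cast_ne_zero.2 hn)) (X.v_ne_zero r) hdr
      have : (fun a => coeff b (w a)) = c • fun a => (X.v r a : ℂ) := by
        ext a; rw [hc]; rfl
      rw [this]
      refine Submodule.smul_mem _ _ (Submodule.subset_span ⟨r, ?_, rfl⟩)
      refine hprod _ _ fun k hk hk' l hl h0 => Finset.ne_of_mem_erase hk ?_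
      have h1 := (hmem i l).2 (det2_eq_zero_of_coeff hw hb hi h0)
      exact (hrepeq r k hr hk' (htrans _ _ _ (hsymm _ _ hri) (htrans _ _ _ h1 (hsymm _ _ hl)))).symm
    · push Not at hN
      obtain ⟨i⟩ := X.nonempty_rays
      obtain ⟨j, hij⟩ := X.exists_det2_ne_zero i
      have hmem' : ∀ k, (fun a => (X.v k a : ℂ)) ∈ Submodule.span ℂ
          {u | ∃ i, (∏ k ∈ Finset.univ.erase i, ζ k ∣ monomial b 1) ∧
            u = fun a => (X.v i a : ℂ)} := fun k =>
        Submodule.subset_span ⟨k, hprod _ _ fun k _ _ l _ => hN l, rfl⟩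
      have : (fun a => coeff b (w a)) = (det2 (X.v i) (X.v j) : ℂ)⁻¹ •
          (detLeft (fun a => coeff b (w a)) (X.v j) • (fun a => (X.v i a : ℂ)) -
            detLeft (fun a => coeff b (w a)) (X.v i) • (fun a => (X.v j a : ℂ))) := by
        ext a
        simp only [Pi.smul_apply, Pi.sub_apply, smul_eq_mul]
        rw [← det2_mul_eq, inv_mul_cancel_left₀ (Int.cast_ne_zero.2 hij)]
      rw [this]
      exact Submodule.smul_mem _ _ (Submodule.sub_mem _ (Submodule.smul_mem _ _ (hmem' i))
        (Submodule.smul_mem _ _ (hmem' j)))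
  have hspan : ∀ i r, r ∈ M i → rep r → ∃ c, (∏ k ∈ M r, MvPolynomial.X k) * (c * B r) =
      detLeft w (X.v i) := by
    intro i r hri hr
    have hBr : B r = G r := if_pos hr
    rcases eq_or_ne i r with rfl | hir
    · exact ⟨1, by rw [hBr, one_mul, ← hG]⟩
    · refine ⟨-1, ?_⟩
      have := X.eq_neg_of_det2_eq_zero hir ((hmem _ _).1 hri)
      rw [hBr, neg_one_mul, mul_neg, ← hG, this]
      unfold detLeft; simp; ring
  have hAB : ∀ i, A i ∈ Ideal.span (Set.range B) := fun i => by
    obtain ⟨r, hri, hr⟩ := hexrep i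
    obtain ⟨c, hc⟩ := hspan i r hri hr
    rw [← hw, ← Finset.mul_prod_erase _ _ (hsymm _ _ hri), mul_assoc] at hc
    rw [← mul_left_cancel₀ (X_ne_zero i) hc]
    exact Ideal.mul_mem_left _ _ (Ideal.mul_mem_left _ _ (Ideal.subset_span ⟨r, rfl⟩))
  refine ⟨ζ, B, ℓ, ⟨hζ0, hζrel, hζB, hℓ, fun p hp => isUnit_of_forall_dvd hJ fun i => ?_⟩,
    fun k j hkj => ?_, hAB, fun i j hij hd => ?_⟩
  · rw [← Ideal.mem_span_singleton]
    refine (Ideal.span_le.2 ?_ : Ideal.span (Set.range B) ≤ _) (hAB i)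
    rintro _ ⟨i, rfl⟩
    exact Ideal.mem_span_singleton.2 (hp i)
  · simp only [hζ]
    split_ifs with hk
    · refine ⟨∏ i ∈ ((M k)ᶜ).erase j, MvPolynomial.X i, ?_⟩
      rw [mul_assoc, Finset.mul_prod_erase _ _ (by rw [Finset.mem_compl, hmem]; exact hkj),
        Finset.prod_mul_prod_compl]
    · exact ⟨_, by rw [one_mul, Finset.mul_prod_erase _ _ (Finset.mem_univ j)]⟩
  · obtain ⟨r, hri, hr⟩ := hexrep i
    obtain ⟨c, hc⟩ := hspan i r hri hr
    have hi := hsymm _ _ hri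
    have hj : j ∈ M r := htrans _ _ _ hi ((hmem _ _).2 hd)
    rw [← Finset.mul_prod_erase _ _ hi, ← Finset.mul_prod_erase _ _
      (Finset.mem_erase.2 ⟨hij.symm, hj⟩)] at hc
    exact ⟨(∏ k ∈ ((M r).erase i).erase j, MvPolynomial.X k) * (c * B r),
      Ideal.mul_mem_left _ _ (Ideal.mul_mem_left _ _ (Ideal.subset_span ⟨r, rfl⟩)),
      by rw [← hc]; ring⟩

end

end ToricKupka

/-! ### The two inclusions of Kupka ideals. -/

namespace ToricKupka

open MvPolynomial

section

variable {m n : ℕ} {X : CompleteSimplicialFan 2 m} {A : OneForm (Fin m)} {D : X.Cl}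
  {F : Fin m → MvPolynomial (Fin (n + 1)) ℂ}

theorem singularIdeal_pullbackForm_le (F : Fin m → MvPolynomial (Fin (n + 1)) ℂ)
    (A : OneForm (Fin m)) :
    (pullbackForm F A).singularIdeal ≤ A.singularIdeal.map (pullback F) := by
  refine Ideal.span_le.2 ?_
  rintro _ ⟨k, rfl⟩
  exact Ideal.sum_mem _ fun i _ => Ideal.mul_mem_right _ _
    (Ideal.mem_map_of_mem _ (Ideal.subset_span ⟨i, rfl⟩))

theorem range_linearCombination_eq (F : Fin m → MvPolynomial (Fin (n + 1)) ℂ)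
    (A : OneForm (Fin m)) :
    LinearMap.range (Fintype.linearCombination (MvPolynomial (Fin (n + 1)) ℂ)
        fun i => pullback F (A i)) = A.singularIdeal.map (pullback F) := by
  rw [Fintype.range_linearCombination, OneForm.singularIdeal, Ideal.map_span, ← Set.range_comp]
  rfl

/-- Suppose that `h` times the pullback of a coefficient of `dα` is outside the extension of `J(α)`.
Unmixedness gives a prime of height at most two over its conductor, and this prime has a noncritical
zero. The multiplier `s` there has its square in the conductor, although its value at the zero is
one. Flat base change of conductors then finishes. -/
theorem kupkaIdeal_pullbackForm_le (hmn : m ≤ n) (hn : 2 ≤ n) (hA : IsFoliationForm X D A)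
    (hflat : (pullback F).Flat) (hJ : HeightGE A.singularIdeal 2)
    (hred : ∀ x : Fin (n + 1) → ℂ, x ≠ 0 → IsCriticalPoint X F x →
      IsReducedAt (pullbackForm F A).singularIdeal x) :
    (pullbackForm F A).kupkaIdeal ≤ A.kupkaIdeal.map (pullback F) := by
  intro h hh
  rw [mem_kupkaIdeal] at hh
  have hle := singularIdeal_pullbackForm_le F A
  have key : ∀ c : Fin m × Fin m,
      h * pullback F (A.d c.1 c.2) ∈ A.singularIdeal.map (pullback F) := by
    rintro ⟨i, j⟩
    dsimp only
    by_contra hy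
    have := projective_ker_pullback hA hJ hflat
    rw [← range_linearCombination_eq] at hy
    obtain ⟨P, hP, hP2, hPt⟩ := exists_prime_height_le_two _ hy
    rw [range_linearCombination_eq] at hPt
    obtain ⟨x, hx, hxc⟩ := exists_not_critical hmn hn hA hflat (hJ.map_of_flat _ hflat) hred P hP2
      fun t ht => hPt t (Ideal.mul_mem_right _ _ ht)
    obtain ⟨s, hs, -, hs2⟩ := exists_eval_eq_one_of_not_critical hA hxc
    have hmem : s ^ 2 * (h * pullback F (A.d i j)) ∈ A.singularIdeal.map (pullback F) := by
      obtain ⟨u, hu, v, hv, huv⟩ := Submodule.mem_sup.1 (hs2 i j)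
      rw [mul_left_comm, ← huv, mul_add]
      refine Ideal.add_mem _ ?_ (Ideal.mul_mem_left _ _ hv)
      have : (pullbackForm F A).curlIdeal ≤
          (A.singularIdeal.map (pullback F)).colon {h} := by
        refine Ideal.span_le.2 ?_
        rintro _ ⟨⟨k, l⟩, rfl⟩
        rw [SetLike.mem_coe, Submodule.mem_colon_singleton, smul_eq_mul, mul_comm]
        exact hle (hh k l)
      have := Submodule.mem_colon_singleton.1 (this hu)
      rwa [smul_eq_mul, mul_comm] at this
    have := hx _ (hPt _ hmem)
    rw [map_pow, hs] at this
    norm_num at this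
  refine Ideal.map_mono ?_ (mem_map_colon_of_flat (pullback F) hflat A.singularIdeal
    (fun c : Fin m × Fin m => A.d c.1 c.2) key)
  intro f hf
  rw [mem_kupkaIdeal]
  exact fun i j => Submodule.mem_colon.1 hf _ ⟨(i, j), rfl⟩

theorem pullback_mul_d_mem (F : Fin m → MvPolynomial (Fin (n + 1)) ℂ)
    {g : MvPolynomial (Fin m) ℂ} (hg : g ∈ A.kupkaIdeal) (k l : Fin (n + 1)) :
    pullback F g * (pullbackForm F A).d k l ∈ A.singularIdeal.map (pullback F) := by
  rw [d_pullbackForm, Finset.mul_sum]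
  refine Ideal.sum_mem _ fun i _ => ?_
  rw [Finset.mul_sum]
  refine Ideal.sum_mem _ fun j _ => ?_
  rw [← mul_assoc, ← map_mul]
  exact Ideal.mul_mem_right _ _ (Ideal.mem_map_of_mem _ (mem_kupkaIdeal.1 hg i j))

theorem mul_d_mem_of_mem_map (hA : IsFoliationForm X D A)
    (F : Fin m → MvPolynomial (Fin (n + 1)) ℂ) {y : MvPolynomial (Fin (n + 1)) ℂ}
    (hy : y ∈ A.singularIdeal.map (pullback F)) (k l : Fin (n + 1)) :
    y * (pullbackForm F A).d k l ∈ (pullbackForm F A).singularIdeal := by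
  have : A.singularIdeal.map (pullback F) ≤
      (pullbackForm F A).singularIdeal.colon {(pullbackForm F A).d k l} := by
    refine Ideal.map_le_iff_le_comap.2 (Ideal.span_le.2 ?_)
    rintro _ ⟨p, rfl⟩
    exact Submodule.mem_colon_singleton.2 (mul_d_pullbackForm_mem F hA.integrable p k l)
  exact Submodule.mem_colon_singleton.1 (this hy)

/-- The elements `y` in question lie in the extension of `J(α)`, which multiplies `dω` into `J(ω)`,
so `y ^ 2 ∈ J(ω)`. Locally `y ∈ J(ω)`: at critical points by reducedness, elsewhere because the two
ideals agree. So no maximal ideal contains the conductor of `y`. -/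
theorem map_kupkaIdeal_le_of_not_critical_zero (hA : IsFoliationForm X D A)
    (hred : ∀ x : Fin (n + 1) → ℂ, x ≠ 0 → IsCriticalPoint X F x →
      IsReducedAt (pullbackForm F A).singularIdeal x) (h0 : ¬ IsCriticalPoint X F 0) :
    A.kupkaIdeal.map (pullback F) ≤ (pullbackForm F A).kupkaIdeal := by
  refine Ideal.map_le_iff_le_comap.2 fun g hg => mem_kupkaIdeal.2 fun k l => ?_
  set y := pullback F g * (pullbackForm F A).d k l with hy
  have hyJ : y ∈ A.singularIdeal.map (pullback F) := pullback_mul_d_mem F hg k l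
  by_contra hyn
  obtain ⟨M, hM, hIM⟩ := Ideal.exists_le_maximal ((pullbackForm F A).singularIdeal.colon {y})
    fun h => hyn (by
      have := Submodule.mem_colon_singleton.1 (h ▸ Submodule.mem_top :
        (1 : MvPolynomial (Fin (n + 1)) ℂ) ∈ (pullbackForm F A).singularIdeal.colon {y})
      simpa using this)
  have := hM.isPrime
  obtain ⟨x, hx, -⟩ := exists_eval_ne_zero M (f := 1) (M.one_notMem)
  have hcol : ∀ t, t * y ∈ (pullbackForm F A).singularIdeal → eval x t = 0 := fun t ht =>
    hx t (hIM (Submodule.mem_colon_singleton.2 ht))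
  by_cases hc : IsCriticalPoint X F x
  · have hx0 : x ≠ 0 := by rintro rfl; exact h0 hc
    have hrad : y ∈ (pullbackForm F A).singularIdeal.radical := by
      refine ⟨2, ?_⟩
      rw [pow_two]
      nth_rw 2 [hy]
      rw [mul_left_comm]
      exact Ideal.mul_mem_left _ _ (mul_d_mem_of_mem_map hA F hyJ k l)
    obtain ⟨t, ht, hty⟩ := (hred x hx0 hc).exists_mul_mem hrad
    exact ht (hcol t hty)
  · obtain ⟨s, hs, hsJ, -⟩ := exists_eval_eq_one_of_not_critical hA hc
    have := hcol s (hsJ y hyJ)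
    rw [hs] at this
    exact one_ne_zero this

/-- The identity `g dα = β ∧ α` pulls back to `F^*g · dω = F^*β ∧ ω`, whose coefficients lie in
`J(ω)` whatever the critical points are. -/
theorem map_kupkaIdeal_le_of_exists_eq (F : Fin m → MvPolynomial (Fin (n + 1)) ℂ)
    (h : ∀ g ∈ A.kupkaIdeal, ∃ β : Fin m → MvPolynomial (Fin m) ℂ,
      ∀ i j, g * A.d i j = β i * A j - β j * A i) :
    A.kupkaIdeal.map (pullback F) ≤ (pullbackForm F A).kupkaIdeal := by
  refine Ideal.map_le_iff_le_comap.2 fun g hg => mem_kupkaIdeal.2 fun k l => ?_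
  obtain ⟨β, hβ⟩ := h g hg
  have : pullback F g * (pullbackForm F A).d k l =
      (∑ i, pullback F (β i) * pderiv k (F i)) * pullbackForm F A l -
      (∑ i, pullback F (β i) * pderiv l (F i)) * pullbackForm F A k := by
    rw [d_pullbackForm]
    unfold pullbackForm
    rw [Finset.sum_mul_sum, Finset.sum_mul_sum, Finset.sum_comm (f := fun i j =>
      pullback F (β i) * pderiv l (F i) * (pullback F (A j) * pderiv k (F j))),
      ← Finset.sum_sub_distrib, Finset.mul_sum]
    refine Finset.sum_congr rfl fun i _ => ?_
    rw [← Finset.sum_sub_distrib, Finset.mul_sum]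
    refine Finset.sum_congr rfl fun j _ => ?_
    have := congrArg (pullback F) (hβ i j)
    simp only [map_mul, map_sub] at this
    linear_combination (pderiv k (F i) * pderiv l (F j)) * this
  rw [this]
  exact Ideal.sub_mem _ (Ideal.mul_mem_left _ _ (Ideal.subset_span ⟨l, rfl⟩))
    (Ideal.mul_mem_left _ _ (Ideal.subset_span ⟨k, rfl⟩))

end

end ToricKupka

/-! ### Contractions with radial fields. -/

namespace ToricKupka

open MvPolynomial

section

variable {m : ℕ} {X : CompleteSimplicialFan 2 m} {A : OneForm (Fin m)} {D : X.Cl}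

theorem CompleteSimplicialFan.sum_mul_detLeft_eq_zero {R : Type} [CommRing R] {a : Fin m → ℤ}
    (ha : X.IsRelation a) (y : Fin 2 → R) : ∑ k, (a k : R) * detLeft y (X.v k) = 0 := by
  have h : ∀ c, ∑ k, (a k : R) * X.v k c = 0 := fun c => by
    have := congrArg (Int.cast (R := R)) (congrFun ha c)
    simpa [Finset.sum_apply] using this
  calc ∑ k, (a k : R) * detLeft y (X.v k)
      = y 0 * ∑ k, (a k : R) * X.v k 1 - y 1 * ∑ k, (a k : R) * X.v k 0 := by
        rw [Finset.mul_sum, Finset.mul_sum, ← Finset.sum_sub_distrib]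
        exact Finset.sum_congr rfl fun k _ => by unfold detLeft; ring
    _ = 0 := by rw [h, h]; ring

/-- A functional vanishing on the relations supported in `N` is there given by a plane vector. -/
theorem CompleteSimplicialFan.exists_detLeft_eq_on (X : CompleteSimplicialFan 2 m) (δ : Fin m → ℤ)
    (N : Fin m → Prop)
    (h : ∀ a, X.IsRelation a → (∀ k, a k ≠ 0 → N k) → ∑ k, a k * δ k = 0) :
    ∃ y : Fin 2 → ℂ, ∀ k, N k → (δ k : ℂ) = detLeft y (X.v k) := by
  by_cases hN : ∃ p, N p
  swap
  · exact ⟨0, fun k hk => absurd ⟨k, hk⟩ hN⟩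
  obtain ⟨p, hp⟩ := hN
  by_cases hq : ∃ q, N q ∧ det2 (X.v p) (X.v q) ≠ 0
  · obtain ⟨q, hq, hpq⟩ := hq
    have hpq' : (det2 (X.v p) (X.v q) : ℂ) ≠ 0 := Int.cast_ne_zero.2 hpq
    refine ⟨fun a => (det2 (X.v p) (X.v q) : ℂ)⁻¹ * (δ q * X.v p a - δ p * X.v q a), fun k hk => ?_⟩
    have h1 := h _ (X.isRelation_plucker p q k) fun l hl => by
      by_contra hl'
      have h1 : l ≠ k := by rintro rfl; exact hl' hk
      have h2 : l ≠ p := by rintro rfl; exact hl' hp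
      have h3 : l ≠ q := by rintro rfl; exact hl' hq
      simp [Pi.single_apply, h1, h2, h3] at hl
    simp [sub_mul, Finset.sum_sub_distrib, Pi.single_apply] at h1
    have h2 : (det2 (X.v p) (X.v q) : ℂ) * δ k - det2 (X.v k) (X.v q) * δ p -
        det2 (X.v p) (X.v k) * δ q = 0 := by exact_mod_cast h1
    apply mul_left_cancel₀ hpq'
    have h3 : detLeft (fun a => (det2 (X.v p) (X.v q) : ℂ)⁻¹ * (δ q * X.v p a - δ p * X.v q a))
        (X.v k) = (det2 (X.v p) (X.v q) : ℂ)⁻¹ *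
          (det2 (X.v k) (X.v q) * δ p + det2 (X.v p) (X.v k) * δ q) := by
      simp only [detLeft, det2]; push_cast; ring
    rw [h3, mul_inv_cancel_left₀ hpq']
    linear_combination h2
  · push Not at hq
    obtain ⟨j, hj⟩ := X.exists_det2_ne_zero p
    have hj' : (det2 (X.v p) (X.v j) : ℂ) ≠ 0 := Int.cast_ne_zero.2 hj
    have hpp : detLeft (fun a => (det2 (X.v p) (X.v j) : ℂ)⁻¹ * (-δ p * X.v j a)) (X.v p) = δ p := by
      apply mul_left_cancel₀ hj'
      have : detLeft (fun a => (det2 (X.v p) (X.v j) : ℂ)⁻¹ * (-δ p * X.v j a)) (X.v p) =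
          (det2 (X.v p) (X.v j) : ℂ)⁻¹ * (det2 (X.v p) (X.v j) * δ p) := by
        simp only [detLeft, det2]; push_cast; ring
      rw [this, mul_inv_cancel_left₀ hj']
    refine ⟨fun a => (det2 (X.v p) (X.v j) : ℂ)⁻¹ * (-δ p * X.v j a), fun k hk => ?_⟩
    rcases eq_or_ne p k with rfl | hpk
    · exact hpp.symm
    · have hv := X.eq_neg_of_det2_eq_zero hpk (hq k hk)
      have h1 := h _ (X.isRelation_opposite hv) fun l hl => by
        by_contra hl'
        have h1 : l ≠ k := by rintro rfl; exact hl' hk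
        have h2 : l ≠ p := by rintro rfl; exact hl' hp
        simp [Pi.single_apply, h1, h2] at hl
      simp [add_mul, Finset.sum_add_distrib, Pi.single_apply] at h1
      have h2 : (δ p : ℂ) + δ k = 0 := by exact_mod_cast h1
      have h3 : ∀ y : Fin 2 → ℂ, detLeft y (X.v k) = -detLeft y (X.v p) := fun y => by
        rw [hv]; simp [detLeft]; ring
      rw [h3, hpp]
      linear_combination h2

/-- By Cartan's formula, `g` times the weight times `A j` is a contraction of `g dα` with the radial
field of `a`. It is thus a combination of the `A k` with coefficients in the coordinate prime, and
the determinant trick applies; the weight is a nonzero constant. -/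
theorem mem_span_X_of_isRelation (hA : IsFoliationForm X D A) (hne : ∃ i, A i ≠ 0)
    {δ : Fin m → ℤ} (hδ : ∀ i, ∀ b ∈ (A i).support, ∀ a,
      X.IsRelation a → ∑ k, a k * (b k : ℤ) = ∑ k, a k * δ k - a i)
    {g : MvPolynomial (Fin m) ℂ} (hg : g ∈ A.kupkaIdeal) {a : Fin m → ℤ} (ha : X.IsRelation a)
    (hD : ∑ k, a k * δ k ≠ 0) :
    g ∈ Ideal.span ((MvPolynomial.X : Fin m → MvPolynomial (Fin m) ℂ) '' {i | a i ≠ 0}) := by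
  have hP := isPrime_span_X_image (k := ℂ) {i | a i ≠ 0}
  set P := Ideal.span ((MvPolynomial.X : Fin m → MvPolynomial (Fin m) ℂ) '' {i | a i ≠ 0})
  obtain ⟨i₀, hi₀⟩ := hne
  have hc : ∀ i j, ∃ c : Fin m → MvPolynomial (Fin m) ℂ, ∑ k, c k * A k = g * A.d i j := fun i j =>
    Ideal.mem_span_range_iff_exists_fun.1 (mem_kupkaIdeal.1 hg i j)
  choose c hc using hc
  have hX : ∀ i, C (a i : ℂ) * MvPolynomial.X i ∈ P := fun i => by
    by_cases h : a i = 0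
    · rw [h]; simp
    · exact Ideal.mul_mem_left _ _ (Ideal.subset_span ⟨i, h, rfl⟩)
  have := mem_prime_of_smul_eq_sum P A hi₀ (g * C ((∑ k, a k * δ k : ℤ) : ℂ))
    (Matrix.of fun j k => ∑ i, C (a i : ℂ) * MvPolynomial.X i * c i j k)
    (fun j k => by
      rw [Matrix.of_apply]
      exact Ideal.sum_mem _ fun i _ => Ideal.mul_mem_right _ _ (hX i)) fun j => by
      rw [mul_assoc, ← hA.sum_mul_d hδ ha j, Finset.mul_sum]
      simp only [Matrix.of_apply, Finset.sum_mul]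
      rw [Finset.sum_comm]
      refine Finset.sum_congr rfl fun i _ => ?_
      simp only [mul_assoc, ← Finset.mul_sum]
      rw [hc]; ring
  refine (hP.mem_or_mem this).resolve_right fun h => hP.ne_top ?_
  exact Ideal.eq_top_of_isUnit_mem _ h ((isUnit_iff_ne_zero.2 (Int.cast_ne_zero.2 hD)).map C)

/-- The prescribed contractions are those that `β ∧ α` needs in order to match `g dα`. For a
monomial `b` of `g`, `mem_span_X_of_isRelation` shows that relations supported where `b` vanishes
have weight zero, so on these rays `δ` comes from a plane vector. Subtracting that vector changes no
weight of a relation, and it makes the `i`-th entry zero whenever the monomial cannot be divided by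
`X i`. -/
theorem exists_sum_mul_eq (hA : IsFoliationForm X D A) (hne : ∃ i, A i ≠ 0)
    {δ : Fin m → ℤ} (hδ : ∀ i, ∀ b ∈ (A i).support, ∀ a,
      X.IsRelation a → ∑ k, a k * (b k : ℤ) = ∑ k, a k * δ k - a i)
    {g : MvPolynomial (Fin m) ℂ} (hg : g ∈ A.kupkaIdeal) :
    ∃ β : Fin m → MvPolynomial (Fin m) ℂ, ∀ a, X.IsRelation a →
      ∑ i, C (a i : ℂ) * MvPolynomial.X i * β i = C ((∑ k, a k * δ k : ℤ) : ℂ) * g := by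
  have hγ : ∀ b ∈ g.support, ∃ y : Fin 2 → ℂ, ∀ k, b k = 0 → (δ k : ℂ) = detLeft y (X.v k) := by
    intro b hb
    refine X.exists_detLeft_eq_on δ (fun k => b k = 0) fun a ha hs => ?_
    by_contra hD
    obtain ⟨i, hi, hbi⟩ := (mem_ideal_span_X_image.1
      (mem_span_X_of_isRelation hA hne hδ hg ha hD)) b hb
    exact hbi (hs i hi)
  choose! y hy using hγ
  set γ : (Fin m →₀ ℕ) → Fin m → ℂ := fun b k => δ k - detLeft (y b) (X.v k)
  refine ⟨fun i => ∑ b ∈ g.support, monomial (b - Finsupp.single i 1) (coeff b g * γ b i),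
    fun a ha => ?_⟩
  have hX : ∀ i, MvPolynomial.X i * (∑ b ∈ g.support,
      monomial (b - Finsupp.single i 1) (coeff b g * γ b i)) =
      ∑ b ∈ g.support, monomial b (coeff b g * γ b i) := fun i => by
    rw [Finset.mul_sum]
    refine Finset.sum_congr rfl fun b hb => ?_
    by_cases hbi : b i = 0
    · have : γ b i = 0 := sub_eq_zero.2 (hy b hb i hbi)
      rw [this, mul_zero, map_zero, map_zero, mul_zero]
    · rw [MvPolynomial.X, monomial_mul, one_mul, add_tsub_cancel_of_le]
      exact Finsupp.single_le_iff.2 (Nat.one_le_iff_ne_zero.2 hbi)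
  simp only [mul_assoc, hX]
  simp only [Finset.mul_sum, C_mul_monomial]
  rw [Finset.sum_comm]
  conv_rhs => rw [g.as_sum, Finset.mul_sum]
  refine Finset.sum_congr rfl fun b _ => ?_
  rw [← map_sum, C_mul_monomial]
  congr 1
  have h1 := CompleteSimplicialFan.sum_mul_detLeft_eq_zero ha (y b)
  calc ∑ i, (a i : ℂ) * (coeff b g * γ b i)
      = coeff b g * (∑ i, (a i : ℂ) * δ i - ∑ i, (a i : ℂ) * detLeft (y b) (X.v i)) := by
        rw [← Finset.sum_sub_distrib, Finset.mul_sum]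
        exact Finset.sum_congr rfl fun i _ => by simp only [γ]; ring
    _ = _ := by rw [h1]; push_cast; ring

/-- A skew form annihilated by the radial vector fields is a multiple of the volume form of the
toric surface. -/
theorem exists_mul_eq_det2_mul {κ : Fin m → Fin m → MvPolynomial (Fin m) ℂ}
    (hskew : ∀ i j, κ i j = -κ j i)
    (hκ : ∀ a, X.IsRelation a → ∀ j, ∑ i, (a i : MvPolynomial (Fin m) ℂ) *
      (MvPolynomial.X i * κ i j) = 0) :
    ∃ u, ∀ i j, MvPolynomial.X i * MvPolynomial.X j * κ i j =
      (det2 (X.v i) (X.v j) : MvPolynomial (Fin m) ℂ) * (u * ∏ k, MvPolynomial.X k) := by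
  obtain ⟨p⟩ := X.nonempty_rays
  obtain ⟨q, hpq⟩ := X.exists_det2_ne_zero p
  obtain ⟨y, hy⟩ := isUnit_intCast (σ := Fin m) hpq
  have hpl := fun l k => X.plucker_eq (f := fun i => MvPolynomial.X i * κ i l)
    (fun a ha => hκ a ha l) p q k
  have hpp : κ p p = 0 := by
    have := hskew p p
    have h2 : (2 : MvPolynomial (Fin m) ℂ) * κ p p = 0 := by linear_combination this
    exact (mul_eq_zero.1 h2).resolve_left two_ne_zero
  have hqq : κ q q = 0 := by
    have := hskew q q
    have h2 : (2 : MvPolynomial (Fin m) ℂ) * κ q q = 0 := by linear_combination this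
    exact (mul_eq_zero.1 h2).resolve_left two_ne_zero
  -- The Plücker relations in both indices reduce every entry to the one at two independent rays.
  have hU : ∀ i j, (det2 (X.v p) (X.v q) : MvPolynomial (Fin m) ℂ) *
      (MvPolynomial.X i * MvPolynomial.X j * κ i j) =
      (det2 (X.v i) (X.v j) : MvPolynomial (Fin m) ℂ) *
        (MvPolynomial.X p * MvPolynomial.X q * κ p q) := fun i j => by
    apply mul_left_cancel₀ (isUnit_intCast (σ := Fin m) hpq).ne_zero
    have h1 := hpl j i
    have h2 := hpl p j
    have h3 := hpl q j
    rw [hpp] at h2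
    rw [hqq] at h3
    rw [hskew j p, hskew q p] at h2
    rw [hskew j q] at h3
    have h4 : (det2 (X.v p) (X.v q) * det2 (X.v i) (X.v j) : MvPolynomial (Fin m) ℂ) =
        det2 (X.v i) (X.v q) * det2 (X.v p) (X.v j) - det2 (X.v p) (X.v i) * det2 (X.v j) (X.v q) := by
      simp only [det2]; push_cast; ring
    linear_combination ((det2 (X.v p) (X.v q) : MvPolynomial (Fin m) ℂ) * MvPolynomial.X j) * h1
      - ((det2 (X.v i) (X.v q) : MvPolynomial (Fin m) ℂ) * MvPolynomial.X p) * h2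
      - ((det2 (X.v p) (X.v i) : MvPolynomial (Fin m) ℂ) * MvPolynomial.X q) * h3
      - (MvPolynomial.X p * MvPolynomial.X q * κ p q) * h4
  -- Comparison with the entry at `i` and a ray independent of it shows that `X i` divides.
  have hdvd : ∏ k, MvPolynomial.X k ∣ MvPolynomial.X p * MvPolynomial.X q * κ p q := by
    refine Finset.prod_dvd_of_isRelPrime (fun i _ j _ hij => isRelPrime_X hij) fun i _ => ?_
    obtain ⟨j, hj⟩ := X.exists_det2_ne_zero i
    refine (isUnit_intCast hj).dvd_mul_left.1 (Dvd.intro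
      ((det2 (X.v p) (X.v q) : MvPolynomial (Fin m) ℂ) * (MvPolynomial.X j * κ i j)) ?_)
    rw [← hU]; ring
  obtain ⟨u, hu⟩ := hdvd
  refine ⟨↑y⁻¹ * u, fun i j => ?_⟩
  have h1 := hU i j
  rw [hu, ← hy] at h1
  have h2 := y.inv_mul
  linear_combination (↑y⁻¹ : MvPolynomial (Fin m) ℂ) * h1 -
    (MvPolynomial.X i * MvPolynomial.X j * κ i j) * h2

end

end ToricKupka

/-! ### Dividing `g dα` by `α`. -/

namespace ToricKupka

open MvPolynomial

section

variable {m : ℕ} {X : CompleteSimplicialFan 2 m} {A : OneForm (Fin m)} {D : X.Cl}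

/-- A prime of height at most two containing the volume coefficients of the toric surface is
generated by the variables of two opposite rays. -/
theorem exists_eq_span_X_pair {P : Ideal (MvPolynomial (Fin m) ℂ)} [hP : P.IsPrime]
    (hP2 : P.height ≤ 2)
    (h : ∀ i j, det2 (X.v i) (X.v j) ≠ 0 →
      ∏ k ∈ (Finset.univ.erase i).erase j, MvPolynomial.X k ∈ P) :
    ∃ i j, i ≠ j ∧ det2 (X.v i) (X.v j) = 0 ∧
      P = Ideal.span ((MvPolynomial.X : Fin m → MvPolynomial (Fin m) ℂ) '' {i, j}) := by
  have key : ∀ i j, det2 (X.v i) (X.v j) ≠ 0 → ∃ k, k ≠ i ∧ k ≠ j ∧ MvPolynomial.X k ∈ P :=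
    fun i j hij => by
      obtain ⟨k, hk, hkP⟩ := Ideal.IsPrime.prod_mem_iff.1 (h i j hij)
      simp only [Finset.mem_erase, Finset.mem_univ, and_true] at hk
      exact ⟨k, hk.2, hk.1, hkP⟩
  obtain ⟨i₀⟩ := X.nonempty_rays
  obtain ⟨j₀, hij₀⟩ := X.exists_det2_ne_zero i₀
  obtain ⟨p, -, -, hp⟩ := key i₀ j₀ hij₀
  obtain ⟨q, hq⟩ := X.exists_det2_ne_zero p
  obtain ⟨r, hrp, -, hr⟩ := key p q hq
  refine ⟨p, r, hrp.symm, ?_, ?_⟩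
  · by_contra hpr
    -- A third variable in `P` would raise the height to three.
    obtain ⟨s, hsp, hsr, hs⟩ := key p r hpr
    have := card_le_height_of_X_mem {p, r, s} P (by
      intro k hk
      simp only [Finset.mem_insert, Finset.mem_singleton] at hk
      rcases hk with rfl | rfl | rfl <;> assumption)
    rw [Finset.card_eq_three.2 ⟨p, r, s, hrp.symm, hsp.symm, hsr.symm, rfl⟩] at this
    have := this.trans hP2
    norm_cast at this
  · have hI := isPrime_span_X_image (k := ℂ) ({p, r} : Set (Fin m))
    have hle : Ideal.span ((MvPolynomial.X : Fin m → MvPolynomial (Fin m) ℂ) '' {p, r}) ≤ P := by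
      refine Ideal.span_le.2 ?_
      rintro _ ⟨k, rfl | hk, rfl⟩
      · exact hp
      · rw [Set.mem_singleton_iff.1 hk]; exact hr
    by_contra hne
    have hlt := Ideal.height_add_one_le_of_lt_of_isPrime (lt_of_le_of_ne hle (Ne.symm hne))
    have h2 := card_le_height_of_X_mem {p, r}
      (Ideal.span ((MvPolynomial.X : Fin m → MvPolynomial (Fin m) ℂ) '' {p, r})) (by
        intro k hk
        exact Ideal.subset_span ⟨k, by simpa using hk, rfl⟩)
    rw [Finset.card_pair hrp.symm] at h2
    have h3 := ((add_le_add_left h2 1).trans hlt).trans hP2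
    norm_cast at h3

/-- Elements of the Kupka ideal divide: `g dα = β ∧ α`. -/
theorem exists_eq_wedge_of_mem_kupkaIdeal (hA : IsFoliationForm X D A)
    {w : Fin 2 → MvPolynomial (Fin m) ℂ}
    (hw : ∀ k, MvPolynomial.X k * A k = detLeft w (X.v k))
    {ζ B ℓ : Fin m → MvPolynomial (Fin m) ℂ} (hB : IsRowSystem X.v ζ B ℓ w)
    (hζ : ∀ k j, det2 (X.v k) (X.v j) ≠ 0 →
      ∃ q, ζ k * MvPolynomial.X j * q = ∏ i, MvPolynomial.X i)
    (hAB : ∀ i, A i ∈ Ideal.span (Set.range B))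
    (hexcl : ∀ i j, i ≠ j → det2 (X.v i) (X.v j) = 0 →
      ¬ Ideal.span (Set.range B) ≤
        Ideal.span ((MvPolynomial.X : Fin m → MvPolynomial (Fin m) ℂ) '' {i, j}))
    {g : MvPolynomial (Fin m) ℂ} (hg : g ∈ A.kupkaIdeal) :
    ∃ β : Fin m → MvPolynomial (Fin m) ℂ, ∀ i j, g * A.d i j = β i * A j - β j * A i := by
  have hJB : A.singularIdeal ≤ Ideal.span (Set.range B) := by
    refine Ideal.span_le.2 ?_
    rintro _ ⟨i, rfl⟩
    exact hAB i
  have hne : ∃ i, A i ≠ 0 := by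
    by_contra! h0
    obtain ⟨k, hk⟩ := hB.exists_ne_zero
    have h1 := hB.mul_eq k
    rw [← hw, h0, mul_zero] at h1
    exact mul_ne_zero (hB.ne_zero k) hk h1
  obtain ⟨δ, hδ⟩ := hA.exists_weight
  obtain ⟨β, hβ⟩ := exists_sum_mul_eq hA hne hδ hg
  -- By the choice of `β`, the form `κ = g dα - β ∧ α` is annihilated by the radial fields, so it is
  -- `u` times the volume form of the surface.
  set κ : Fin m → Fin m → MvPolynomial (Fin m) ℂ :=
    fun i j => g * A.d i j - (β i * A j - β j * A i) with hκ
  obtain ⟨u, hu⟩ := exists_mul_eq_det2_mul (X := X) (κ := κ)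
    (fun i j => by simp only [hκ]; rw [A.d_swap i j]; ring)
    (fun a ha j => by
      have h1 := hA.sum_mul_d hδ ha j
      have h2 := hβ a ha
      have h3 := hA.descent a ha
      calc ∑ i, (a i : MvPolynomial (Fin m) ℂ) * (MvPolynomial.X i * κ i j)
          = g * ∑ i, C (a i : ℂ) * MvPolynomial.X i * A.d i j -
            A j * ∑ i, C (a i : ℂ) * MvPolynomial.X i * β i +
            β j * ∑ i, C (a i : ℂ) * MvPolynomial.X i * A i := by
            rw [Finset.mul_sum, Finset.mul_sum, Finset.mul_sum, ← Finset.sum_sub_distrib,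
              ← Finset.sum_add_distrib]
            refine Finset.sum_congr rfl fun i _ => ?_
            simp only [hκ, map_intCast]; ring
        _ = 0 := by rw [h1, h2, h3]; ring)
  have hκJ : ∀ i j, κ i j ∈ Ideal.span (Set.range B) := fun i j =>
    Ideal.sub_mem _ (hJB (mem_kupkaIdeal.1 hg i j))
      (Ideal.sub_mem _ (Ideal.mul_mem_left _ _ (hAB j)) (Ideal.mul_mem_left _ _ (hAB i)))
  -- By unmixedness, an obstruction is a prime of height at most two containing the coefficients of
  -- the volume form. Such a prime is generated by two opposite variables, which `hexcl` excludes.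
  have huJ : u ∈ Ideal.span (Set.range B) := by
    by_contra hun
    obtain ⟨i₀⟩ := X.nonempty_rays
    have := hB.projective_ker (fun n hn => isUnit_intCast hn) X.v_ne_zero
      ⟨i₀, X.exists_det2_ne_zero i₀⟩
    have hrange : LinearMap.range (Fintype.linearCombination (MvPolynomial (Fin m) ℂ) B) =
        Ideal.span (Set.range B) := Fintype.range_linearCombination _ _
    rw [← hrange] at hun
    obtain ⟨P, hP, hP2, hPt⟩ := exists_prime_height_le_two _ hun
    rw [hrange] at hPt
    obtain ⟨i, j, hij, hd, rfl⟩ := exists_eq_span_X_pair (X := X) hP2 fun i j hij => by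
      have hij' : i ≠ j := by rintro rfl; exact hij (det2_self _)
      refine hPt _ ?_
      obtain ⟨y, hy⟩ := isUnit_intCast (σ := Fin m) hij
      have h1 := hu i j
      rw [← Finset.mul_prod_erase _ _ (Finset.mem_univ i), ← Finset.mul_prod_erase _ _
        (Finset.mem_erase.2 ⟨hij'.symm, Finset.mem_univ j⟩), ← hy] at h1
      have h2 : (∏ k ∈ (Finset.univ.erase i).erase j, MvPolynomial.X k) * u =
          (↑y⁻¹ : MvPolynomial (Fin m) ℂ) * κ i j := by
        apply mul_left_cancel₀ (mul_ne_zero (X_ne_zero (R := ℂ) i) (X_ne_zero j))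
        have h3 := y.inv_mul
        linear_combination -(↑y⁻¹ : MvPolynomial (Fin m) ℂ) * h1 - (MvPolynomial.X i *
          MvPolynomial.X j * u * ∏ k ∈ (Finset.univ.erase i).erase j, MvPolynomial.X k) * h3
      rw [h2]
      exact Ideal.mul_mem_left _ _ (hκJ i j)
    exact hexcl i j hij hd fun t ht => hPt t (Ideal.mul_mem_right _ _ ht)
  obtain ⟨h, hh⟩ := Ideal.mem_span_range_iff_exists_fun.1 huJ
  -- `H k` is the 1-form for which `α ∧ H k` is `B k` times the volume form, as `hkey` verifies by a
  -- Plücker identity. So `u ∈ (B)` makes `κ` a multiple of `α`, which is absorbed into `β`.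
  have hH : ∀ k j, ∃ H, ζ k * MvPolynomial.X j * H =
      (det2 (X.v k) (X.v j) : MvPolynomial (Fin m) ℂ) * ∏ i, MvPolynomial.X i := fun k j => by
    by_cases hd : det2 (X.v k) (X.v j) = 0
    · exact ⟨0, by rw [hd]; simp⟩
    · obtain ⟨q, hq⟩ := hζ k j hd
      exact ⟨(det2 (X.v k) (X.v j) : MvPolynomial (Fin m) ℂ) * q, by rw [← hq]; ring⟩
  choose H hH using hH
  refine ⟨fun i => β i - ∑ k, h k * H k i, fun i j => ?_⟩
  have hkey : ∀ k, MvPolynomial.X i * MvPolynomial.X j * (H k j * A i - H k i * A j) =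
      (det2 (X.v i) (X.v j) : MvPolynomial (Fin m) ℂ) * (B k * ∏ l, MvPolynomial.X l) := fun k => by
    apply mul_left_cancel₀ (hB.ne_zero k)
    have h1 := hw i
    have h2 := hw j
    have h3 := hB.mul_eq k
    have h4 := hH k i
    have h5 := hH k j
    have h6 : (det2 (X.v i) (X.v j) : MvPolynomial (Fin m) ℂ) * detLeft w (X.v k) =
        detLeft w (X.v i) * (det2 (X.v k) (X.v j) : MvPolynomial (Fin m) ℂ) -
        detLeft w (X.v j) * (det2 (X.v k) (X.v i) : MvPolynomial (Fin m) ℂ) := by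
      simp only [det2, detLeft]; push_cast; ring
    rw [← h1, ← h2, ← h3] at h6
    linear_combination (MvPolynomial.X i * A i) * h5 - (MvPolynomial.X j * A j) * h4 -
      (∏ l, MvPolynomial.X l) * h6
  have hκeq : κ i j = ∑ k, h k * (H k j * A i - H k i * A j) := by
    apply mul_left_cancel₀ (mul_ne_zero (X_ne_zero (R := ℂ) i) (X_ne_zero j))
    rw [hu, ← hh, Finset.mul_sum, Finset.sum_mul, Finset.mul_sum]
    refine Finset.sum_congr rfl fun k _ => ?_
    linear_combination -h k * hkey k
  have : κ i j = (∑ k, h k * H k j) * A i - (∑ k, h k * H k i) * A j := by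
    rw [hκeq, Finset.sum_mul, Finset.sum_mul, ← Finset.sum_sub_distrib]
    exact Finset.sum_congr rfl fun k _ => by ring
  simp only [hκ] at this
  linear_combination this

end

end ToricKupka

/-! ### Critical points over the intersection of two opposite divisors. -/

namespace ToricKupka

open MvPolynomial

section

variable {m n : ℕ} {X : CompleteSimplicialFan 2 m} {A : OneForm (Fin m)} {D : X.Cl}
  {F : Fin m → MvPolynomial (Fin (n + 1)) ℂ} {e : Fin m → ℕ}

theorem isCriticalPoint_of_dual {x : Fin (n + 1) → ℂ} {w : Fin m → ℂ} (hw : w ≠ 0)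
    (hF : ∀ k, ∑ i, w i * eval x (pderiv k (F i)) = 0)
    (hX : ∀ a, X.IsRelation a → ∑ i, w i * ((a i : ℂ) * eval x (F i)) = 0) :
    IsCriticalPoint X F x := by
  intro htop
  apply hw
  have key : ∀ u ∈ (⊤ : Submodule ℂ (Fin m → ℂ)), ∑ i, w i * u i = 0 := by
    intro u hu
    rw [← htop] at hu
    induction hu using Submodule.span_induction with
    | mem u hu =>
      rcases hu with ⟨k, rfl⟩ | ⟨a, ha, rfl⟩
      · exact hF k
      · exact hX a ha
    | zero => simp
    | add u v _ _ hu hv => simp [mul_add, Finset.sum_add_distrib, hu, hv]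
    | smul c u _ hu =>
      simp only [Pi.smul_apply, smul_eq_mul, mul_left_comm _ c, ← Finset.mul_sum, hu, mul_zero]
  ext i
  have := key (Pi.single i 1) Submodule.mem_top
  simpa [Pi.single_apply] using this

/-- The Jacobian matrix of `F` together with the columns of the radial vector fields of the
relations between `v p`, `v i` and `v k`, where `k` is not in `s`. -/
noncomputable def criticalMatrix (X : CompleteSimplicialFan 2 m)
    (F : Fin m → MvPolynomial (Fin (n + 1)) ℂ) (i p : Fin m) (s : Finset (Fin m)) :
    Matrix (Fin m) (Fin (n + 1 + s.card)) (MvPolynomial (Fin (n + 1)) ℂ) :=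
  Matrix.of fun k c => Sum.elim (fun l => pderiv l (F k))
    (fun q => C (((det2 (X.v i) (X.v p) • Pi.single (s.equivFin.symm q : Fin m) 1 -
      det2 (X.v (s.equivFin.symm q)) (X.v p) • Pi.single i 1 -
      det2 (X.v i) (X.v (s.equivFin.symm q)) • Pi.single p 1 : Fin m → ℤ) k : ℤ) : ℂ) * F k)
    (finSumFinEquiv.symm c)

theorem rankDrops_of_isCriticalPoint {x : Fin (n + 1) → ℂ} (hx : IsCriticalPoint X F x)
    (i p : Fin m) (s : Finset (Fin m)) :
    RankDrops (criticalMatrix X F i p s) (RingHom.ker (eval x)) := by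
  obtain ⟨w, hw, hwF, hwX⟩ := exists_dual_of_isCriticalPoint hx
  obtain ⟨k, hk⟩ := Function.ne_iff.1 hw
  refine ⟨fun k => C (w k), ⟨k, by simpa [RingHom.mem_ker] using hk⟩, fun c => ?_⟩
  obtain ⟨c, rfl⟩ := finSumFinEquiv.surjective c
  rw [RingHom.mem_ker, map_sum]
  rcases c with l | q
  · simpa [criticalMatrix] using hwF l
  · have := hwX _ (X.isRelation_plucker i p (s.equivFin.symm q))
    simpa only [criticalMatrix, Matrix.of_apply, Equiv.symm_apply_apply, Sum.elim_inr, map_mul,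
      eval_C] using this

/-- A few radial columns suffice. For `μ k = w k * F k` at `x`, the radial conditions say that `μ k`
is proportional to the determinant of `v i` and `v k`. At `i` and `j` this holds because `F i` and
`F j` vanish, and at the omitted `q` it follows from Euler's formula, since `e q > 0`. -/
theorem isCriticalPoint_of_rankDrops (hF : IsLifting X e F) (hpos : ∀ k, 0 < e k)
    {i j p q : Fin m} (hij : i ≠ j) (hd : det2 (X.v i) (X.v j) = 0)
    (hp : det2 (X.v i) (X.v p) ≠ 0) (hqi : q ≠ i) (hqj : q ≠ j) (hqp : q ≠ p)
    {x : Fin (n + 1) → ℂ} (hi : eval x (F i) = 0) (hj : eval x (F j) = 0)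
    (h : RankDrops (criticalMatrix X F i p {i, j, p, q}ᶜ) (RingHom.ker (eval x))) :
    IsCriticalPoint X F x := by
  obtain ⟨w, ⟨k₀, hk₀⟩, hw⟩ := h
  have hw1 : ∀ l, ∑ k, eval x (w k) * eval x (pderiv l (F k)) = 0 := fun l => by
    have := hw (finSumFinEquiv (Sum.inl l))
    rw [RingHom.mem_ker, map_sum] at this
    simpa [criticalMatrix] using this
  set μ : Fin m → ℂ := fun k => eval x (w k) * eval x (F k) with hμ
  have hμi : μ i = 0 := by simp [hμ, hi]
  have hμj : μ j = 0 := by simp [hμ, hj]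
  have hEuler : ∑ k, (e k : ℂ) * μ k = 0 := by
    have h1 : ∀ k, (e k : ℂ) * eval x (F k) = ∑ l, x l * eval x (pderiv l (F k)) := fun k => by
      have := congrArg (eval x) (hF.homogeneous k).sum_X_mul_pderiv
      simpa [map_sum] using this.symm
    calc ∑ k, (e k : ℂ) * μ k = ∑ k, ∑ l, x l * (eval x (w k) * eval x (pderiv l (F k))) := by
          refine Finset.sum_congr rfl fun k _ => ?_
          have := h1 k
          rw [show (e k : ℂ) * μ k = eval x (w k) * ((e k : ℂ) * eval x (F k)) by
            simp only [hμ]; ring, this, Finset.mul_sum]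
          exact Finset.sum_congr rfl fun l _ => by ring
      _ = 0 := by
        rw [Finset.sum_comm]
        refine Finset.sum_eq_zero fun l _ => ?_
        rw [← Finset.mul_sum, hw1, mul_zero]
  have hs : ∀ k, k ≠ q → (det2 (X.v i) (X.v p) : ℂ) * μ k = det2 (X.v i) (X.v k) * μ p := by
    intro k hkq
    by_cases hks : k ∈ ({i, j, p, q}ᶜ : Finset (Fin m))
    · have := hw (finSumFinEquiv (Sum.inr (({i, j, p, q}ᶜ : Finset (Fin m)).equivFin ⟨k, hks⟩)))
      rw [RingHom.mem_ker, map_sum] at this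
      simp only [criticalMatrix, Matrix.of_apply, Equiv.symm_apply_apply, Sum.elim_inr, map_mul,
        eval_C] at this
      have h2 : ∀ l, eval x (w l) * ((((det2 (X.v i) (X.v p) • Pi.single k 1 -
          det2 (X.v k) (X.v p) • Pi.single i 1 - det2 (X.v i) (X.v k) • Pi.single p 1 :
          Fin m → ℤ) l : ℤ) : ℂ) * eval x (F l)) =
          (((det2 (X.v i) (X.v p) • Pi.single k 1 -
          det2 (X.v k) (X.v p) • Pi.single i 1 - det2 (X.v i) (X.v k) • Pi.single p 1 :
          Fin m → ℤ) l : ℤ) : ℂ) * μ l := fun l => by simp only [hμ]; ring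
      simp only [h2] at this
      simp [sub_mul, Finset.sum_sub_distrib, Pi.single_apply, hμi] at this
      linear_combination this
    · simp only [Finset.mem_compl, Finset.mem_insert, Finset.mem_singleton, not_not] at hks
      rcases hks with rfl | rfl | rfl | rfl
      · rw [hμi, det2_self]; simp
      · rw [hμj, hd]; simp
      · rfl
      · exact absurd rfl hkq
  have hall : ∀ k, (det2 (X.v i) (X.v p) : ℂ) * μ k = det2 (X.v i) (X.v k) * μ p := by
    intro k
    rcases eq_or_ne k q with rfl | hkq
    · have h1 : ∑ l, (e l : ℂ) * ((det2 (X.v i) (X.v p) : ℂ) * μ l -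
          det2 (X.v i) (X.v l) * μ p) = 0 := by
        have h2 := CompleteSimplicialFan.sum_mul_detLeft_eq_zero hF.relation
          (fun a => (X.v i a : ℂ))
        simp only [detLeft_int] at h2
        calc _ = (det2 (X.v i) (X.v p) : ℂ) * ∑ l, (e l : ℂ) * μ l -
              (∑ l, ((e l : ℤ) : ℂ) * (det2 (X.v i) (X.v l) : ℂ)) * μ p := by
              rw [Finset.mul_sum, Finset.sum_mul, ← Finset.sum_sub_distrib]
              exact Finset.sum_congr rfl fun l _ => by push_cast; ring
          _ = 0 := by rw [hEuler, h2]; ring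
      rw [Finset.sum_eq_single k (fun l _ hl => by rw [hs l hl, sub_self, mul_zero])
        (by simp)] at h1
      exact sub_eq_zero.1 ((mul_eq_zero.1 h1).resolve_left
        (Nat.cast_ne_zero.2 (hpos k).ne'))
    · exact hs k hkq
  refine isCriticalPoint_of_dual (w := fun k => eval x (w k))
    (fun h0 => hk₀ (congrFun h0 k₀)) hw1 fun a ha => ?_
  apply (mul_eq_zero.1 (?_ : (det2 (X.v i) (X.v p) : ℂ) * _ = 0)).resolve_left
    (Int.cast_ne_zero.2 hp)
  have h2 := CompleteSimplicialFan.sum_mul_detLeft_eq_zero ha (fun a => (X.v i a : ℂ))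
  simp only [detLeft_int] at h2
  calc _ = ∑ k, (a k : ℂ) * ((det2 (X.v i) (X.v p) : ℂ) * μ k) := by
        rw [Finset.mul_sum]
        exact Finset.sum_congr rfl fun k _ => by simp only [hμ]; ring
    _ = (∑ k, (a k : ℂ) * (det2 (X.v i) (X.v k) : ℂ)) * μ p := by
        rw [Finset.sum_mul]
        exact Finset.sum_congr rfl fun k _ => by rw [hall]; ring
    _ = 0 := by rw [h2, zero_mul]

/-- If the vertex of the cone is critical, then so is a point of projective space at which the
coordinates of two opposite rays vanish. -/
theorem exists_isCriticalPoint_of_zero (hF : IsLifting X e F) (hpos : ∀ k, 0 < e k)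
    (hmn : m ≤ n) (h0 : IsCriticalPoint X F 0) {i j : Fin m} (hij : i ≠ j)
    (hd : det2 (X.v i) (X.v j) = 0) :
    ∃ x : Fin (n + 1) → ℂ, x ≠ 0 ∧ eval x (F i) = 0 ∧ eval x (F j) = 0 ∧
      IsCriticalPoint X F x := by
  classical
  obtain ⟨p, hp⟩ := X.exists_det2_ne_zero i
  have hpi : p ≠ i := by rintro rfl; exact hp (det2_self _)
  have hpj : p ≠ j := by rintro rfl; exact hp hd
  -- Otherwise the relation `e`, paired with `v i`, would reduce to its term at `p`, which is
  -- nonzero.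
  obtain ⟨q, hqi, hqj, hqp⟩ : ∃ q, q ≠ i ∧ q ≠ j ∧ q ≠ p := by
    by_contra! hq
    have h2 := CompleteSimplicialFan.sum_mul_detLeft_eq_zero hF.relation
      (fun a => (X.v i a : ℂ))
    simp only [detLeft_int] at h2
    rw [Finset.sum_eq_single p (fun l _ hl => ?_) (by simp)] at h2
    · rcases mul_eq_zero.1 h2 with h | h
      · have := hpos p
        have : e p = 0 := by exact_mod_cast h
        omega
      · exact hp (by exact_mod_cast h)
    · by_cases hli : l = i
      · rw [hli, det2_self]; simp
      by_cases hlj : l = j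
      · rw [hlj, hd]; simp
      exact absurd (hq l hli hlj) hl
  set s : Finset (Fin m) := {i, j, p, q}ᶜ with hs
  set M := criticalMatrix X F i p s with hM
  have hscard : s.card + 4 = m := by
    have h4 : ({i, j, p, q} : Finset (Fin m)).card = 4 := by
      rw [Finset.card_insert_of_notMem, Finset.card_insert_of_notMem,
        Finset.card_pair hqp.symm]
      · simp [hpj.symm, hqj.symm]
      · simp [hij, hpi.symm, hqi.symm]
    have := Finset.card_compl_add_card ({i, j, p, q} : Finset (Fin m))
    rw [h4, Fintype.card_fin] at this
    exact this
  set T : Finset (MvPolynomial (Fin (n + 1)) ℂ) := {F i, F j} with hT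
  have hker : (RingHom.ker (eval (0 : Fin (n + 1) → ℂ))).IsPrime := RingHom.ker_isPrime _
  have hF0 : ∀ k, eval (0 : Fin (n + 1) → ℂ) (F k) = 0 := fun k => by
    rw [eval_zero, constantCoeff_eq]
    refine (hF.homogeneous k).coeff_eq_zero ?_
    simpa using (hpos k).ne
  have hle : Ideal.span ((T : Set (MvPolynomial (Fin (n + 1)) ℂ)) ∪
      Set.range fun f : Fin m → Fin (n + 1 + s.card) => (M.submatrix id f).det) ≤
      RingHom.ker (eval (0 : Fin (n + 1) → ℂ)) := by
    refine Ideal.span_le.2 (Set.union_subset ?_ ?_)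
    · intro f hf
      simp only [hT, Finset.coe_insert, Finset.coe_singleton, Set.mem_insert_iff,
        Set.mem_singleton_iff] at hf
      rcases hf with rfl | rfl
      · exact hF0 i
      · exact hF0 j
    · rintro _ ⟨f, rfl⟩
      exact (rankDrops_of_isCriticalPoint h0 i p s).det_mem f
  obtain ⟨P, hP, -⟩ := Ideal.exists_minimalPrimes_le hle
  have hPprime := hP.1.1
  have hPle := hP.1.2
  have hmin : IsMinimalDrop M T P := by
    refine ⟨hPprime, fun f hf => hPle (Ideal.subset_span (Or.inl hf)),
      rankDrops_of_det_mem fun f => hPle (Ideal.subset_span (Or.inr ⟨f, rfl⟩)),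
      fun Q hQ hTQ hMQ hQP => hP.2 ⟨hQ, Ideal.span_le.2 (Set.union_subset hTQ ?_)⟩ hQP⟩
    rintro _ ⟨f, rfl⟩
    exact hMQ.det_mem f
  -- The matrix has `m` rows and `n + 1 + (m - 4)` columns, so its drop locus has codimension at
  -- most `n - 2`. The equations `F i` and `F j` raise this to at most `n`, which leaves a zero
  -- besides the vertex.
  have hht : P.height < ((n + 1 : ℕ) : ℕ∞) := by
    have h1 := hmin.height_add_le (by omega)
    have h2 : T.card ≤ 2 := Finset.card_le_two
    by_contra h3
    push Not at h3
    have h4 : (((n + 1 : ℕ) : ℕ∞) + m) ≤ ((n + 1 + s.card : ℕ) : ℕ∞) + 1 + T.card :=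
      (add_le_add_left h3 _).trans h1
    norm_cast at h4
    omega
  obtain ⟨x, hx, hxP, -⟩ := exists_ne_zero_of_height_lt P hht (f := 1) P.one_notMem
  have hx' : (RingHom.ker (eval x)).IsPrime := RingHom.ker_isPrime _
  have hFi := hxP _ (hmin.subset (by simp [hT] : F i ∈ (T : Set _)))
  have hFj := hxP _ (hmin.subset (by simp [hT] : F j ∈ (T : Set _)))
  exact ⟨x, hx, hFi, hFj, isCriticalPoint_of_rankDrops hF hpos hij hd hp hqi hqj hqp hFi hFj
    (hmin.drops.mono fun f hf => hxP f hf)⟩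

end

end ToricKupka

/-! ### Excluding the ideals of two opposite variables. -/

namespace ToricKupka

open MvPolynomial

section

variable {m n : ℕ} {X : CompleteSimplicialFan 2 m} {A : OneForm (Fin m)} {D : X.Cl}
  {F : Fin m → MvPolynomial (Fin (n + 1)) ℂ} {e : Fin m → ℕ}

theorem X_notMem_span_X_image {σ : Type} {s : Set σ} {k : σ} (hk : k ∉ s) :
    (MvPolynomial.X k : MvPolynomial σ ℂ) ∉ Ideal.span (MvPolynomial.X '' s) := by
  intro h
  obtain ⟨i, hi, hki⟩ := mem_ideal_span_X_image.1 h (Finsupp.single k 1)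
    (by rw [support_X]; simp)
  apply hk
  by_cases h : k = i
  · exact h ▸ hi
  · exact absurd (Finsupp.single_eq_of_ne (Ne.symm h)) hki

theorem monomial_mem_span_X_pair {σ : Type} {i j : σ} {b : σ →₀ ℕ} (c : ℂ) (h : 1 ≤ b i + b j) :
    monomial b c ∈ Ideal.span (MvPolynomial.X '' {i, j} : Set (MvPolynomial σ ℂ)) := by
  rw [mem_ideal_span_X_image]
  intro b' hb'
  rw [Finset.mem_singleton.1 (support_monomial_subset hb')]
  by_cases hi : b i = 0
  · exact ⟨j, by simp, by omega⟩
  · exact ⟨i, by simp, hi⟩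

theorem monomial_mem_span_X_pair_sq {σ : Type} {i j : σ} (hij : i ≠ j) {b : σ →₀ ℕ} (c : ℂ)
    (h : 2 ≤ b i + b j) :
    monomial b c ∈ (Ideal.span (MvPolynomial.X '' {i, j} : Set (MvPolynomial σ ℂ))) ^ 2 := by
  obtain ⟨k, hk, hbk, hk'⟩ : ∃ k ∈ ({i, j} : Set σ), b k ≠ 0 ∧
      1 ≤ (b - Finsupp.single k 1 : σ →₀ ℕ) i + (b - Finsupp.single k 1 : σ →₀ ℕ) j := by
    by_cases hi : b i = 0
    · refine ⟨j, by simp, by omega, ?_⟩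
      simp [Finsupp.single_apply, hij.symm]
      omega
    · refine ⟨i, by simp, hi, ?_⟩
      simp [Finsupp.single_apply, hij]
      omega
  have : monomial b c = MvPolynomial.X k * monomial (b - Finsupp.single k 1) c := by
    rw [MvPolynomial.X, monomial_mul, one_mul, add_tsub_cancel_of_le]
    exact Finsupp.single_le_iff.2 (Nat.one_le_iff_ne_zero.2 hbk)
  rw [this, pow_two]
  exact Ideal.mul_mem_mul (Ideal.subset_span ⟨k, hk, rfl⟩) (monomial_mem_span_X_pair c hk')

/-- A foliation form which is singular along the intersection of two opposite divisors, also after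
division by their equations, is singular there to second order. -/
theorem singularIdeal_le_span_X_pair_sq (hA : IsFoliationForm X D A)
    (hJ : HeightGE A.singularIdeal 2) {w : Fin 2 → MvPolynomial (Fin m) ℂ}
    (hw : ∀ k, MvPolynomial.X k * A k = detLeft w (X.v k)) {i j : Fin m} (hij : i ≠ j)
    (hd : det2 (X.v i) (X.v j) = 0) {G : MvPolynomial (Fin m) ℂ}
    (hG : MvPolynomial.X i * MvPolynomial.X j * G = detLeft w (X.v i))
    (hGp : G ∈ Ideal.span (MvPolynomial.X '' {i, j} : Set (MvPolynomial (Fin m) ℂ)))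
    (hJp : A.singularIdeal ≤
      Ideal.span (MvPolynomial.X '' {i, j} : Set (MvPolynomial (Fin m) ℂ))) :
    A.singularIdeal ≤ (Ideal.span (MvPolynomial.X '' {i, j} :
      Set (MvPolynomial (Fin m) ℂ))) ^ 2 := by
  have hAi : A i = MvPolynomial.X j * G := by
    apply mul_left_cancel₀ (X_ne_zero (R := ℂ) i)
    rw [hw, ← hG]; ring
  have hp := isPrime_span_X_image (k := ℂ) ({i, j} : Set (Fin m))
  -- For `G = 0` the form comes from a ruling, and one of its coefficients is outside the ideal of
  -- the two variables.
  have hG0 : G ≠ 0 := by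
    rintro rfl
    rw [mul_zero] at hAi
    obtain ⟨c, hc, hcw⟩ := exists_eq_of_coefficient_eq_zero hJ hw hij hd hAi
    obtain ⟨q, hq⟩ := X.exists_det2_ne_zero i
    have h1 : MvPolynomial.X q * A q = c * (det2 (X.v i) (X.v q) : MvPolynomial (Fin m) ℂ) *
        ∏ k ∈ (Finset.univ.erase i).erase j, MvPolynomial.X k := by
      rw [hw]; unfold detLeft det2; rw [hcw, hcw]; push_cast; ring
    have h2 := Ideal.mul_mem_left _ (MvPolynomial.X q) (hJp (Ideal.subset_span ⟨q, rfl⟩))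
    rw [h1] at h2
    rcases hp.mem_or_mem h2 with h3 | h3
    · exact hp.ne_top (Ideal.eq_top_of_isUnit_mem _ h3 (hc.mul (isUnit_intCast hq)))
    · obtain ⟨k, hk, hkp⟩ := Ideal.IsPrime.prod_mem_iff.1 h3
      simp only [Finset.mem_erase, Finset.mem_univ, and_true] at hk
      exact X_notMem_span_X_image (by simp [hk.1, hk.2]) hkp
  obtain ⟨δ, hδ⟩ := hA.exists_weight
  have hrel := X.isRelation_opposite (X.eq_neg_of_det2_eq_zero hij hd)
  have hsum : ∀ b : Fin m →₀ ℕ,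
      ∑ k, (Pi.single i 1 + Pi.single j 1 : Fin m → ℤ) k * (b k : ℤ) = b i + b j := fun b => by
    simp [add_mul, Finset.sum_add_distrib, Pi.single_apply]
  obtain ⟨b, hb⟩ := ne_zero_iff.1 hG0
  have hb1 : 1 ≤ b i + b j := by
    obtain ⟨k, hk, hbk⟩ := mem_ideal_span_X_image.1 hGp b (mem_support_iff.2 hb)
    rcases hk with rfl | hk
    · omega
    · rw [Set.mem_singleton_iff.1 hk] at hbk; omega
  -- `A i = X j * G` has a monomial of degree at least two in the two variables, and this degree is
  -- the weight minus one. So the weight is at least three, and then every monomial of every `A k`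
  -- has degree at least two.
  have hΔ : 3 ≤ ∑ k, (Pi.single i 1 + Pi.single j 1 : Fin m → ℤ) k * δ k := by
    have h1 := hδ i (Finsupp.single j 1 + b) (by
      rw [mem_support_iff, hAi, coeff_X_mul]; exact hb) _ hrel
    rw [hsum, Pi.add_apply, Pi.single_eq_same, Pi.single_eq_of_ne hij] at h1
    simp [Finsupp.single_apply, hij.symm] at h1
    simp only [Pi.add_apply] at h1 ⊢
    omega
  refine Ideal.span_le.2 ?_
  rintro _ ⟨k, rfl⟩
  rw [SetLike.mem_coe, (A k).as_sum]
  refine Ideal.sum_mem _ fun b hb => monomial_mem_span_X_pair_sq hij _ ?_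
  have h1 := hδ k b hb _ hrel
  rw [hsum] at h1
  have h2 : (Pi.single i 1 + Pi.single j 1 : Fin m → ℤ) k ≤ 1 := by
    rw [Pi.add_apply, Pi.single_apply, Pi.single_apply]
    split_ifs with h h'
    · exact absurd (h.symm.trans h') hij
    all_goals norm_num
  omega

theorem exists_eq_add_of_mem_span_pair_sq {R : Type} [CommRing R] {a b y : R}
    (h : y ∈ (Ideal.span {a, b}) ^ 2) :
    ∃ u ∈ Ideal.span {a, b}, ∃ v ∈ Ideal.span {a, b}, y = u * a + v * b := by
  rw [pow_two] at h
  nth_rw 2 [Ideal.span_insert] at h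
  rw [Ideal.mul_sup] at h
  obtain ⟨y₁, h₁, y₂, h₂, rfl⟩ := Submodule.mem_sup.1 h
  obtain ⟨u, hu, rfl⟩ := Ideal.mem_mul_span_singleton.1 h₁
  obtain ⟨v, hv, rfl⟩ := Ideal.mem_mul_span_singleton.1 h₂
  exact ⟨u, hu, v, hv, rfl⟩

/-- If the vertex of the cone is critical, the divided coefficients of `α` do not all vanish along
the intersection of two opposite divisors. -/
theorem not_le_span_X_pair_of_critical_zero (hmn : m ≤ n) (hn : 2 ≤ n)
    (hA : IsFoliationForm X D A) (hF : IsLifting X e F) (hpos : ∀ k, 0 < e k)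
    (hflat : (pullback F).Flat) (hJ : HeightGE A.singularIdeal 2)
    (hred : ∀ x : Fin (n + 1) → ℂ, x ≠ 0 → IsCriticalPoint X F x →
      IsReducedAt (pullbackForm F A).singularIdeal x)
    (h0 : IsCriticalPoint X F 0) {w : Fin 2 → MvPolynomial (Fin m) ℂ}
    (hw : ∀ k, MvPolynomial.X k * A k = detLeft w (X.v k)) {J' : Ideal (MvPolynomial (Fin m) ℂ)}
    (hAJ' : ∀ k, A k ∈ J') {i j : Fin m} (hij : i ≠ j) (hd : det2 (X.v i) (X.v j) = 0)
    (hG : ∃ G ∈ J', MvPolynomial.X i * MvPolynomial.X j * G = detLeft w (X.v i)) :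
    ¬ J' ≤ Ideal.span (MvPolynomial.X '' {i, j} : Set (MvPolynomial (Fin m) ℂ)) := by
  intro hJ'
  obtain ⟨G, hGJ, hG⟩ := hG
  have hsq := singularIdeal_le_span_X_pair_sq hA hJ hw hij hd hG (hJ' hGJ)
    (Ideal.span_le.2 (by rintro _ ⟨k, rfl⟩; exact hJ' (hAJ' k)))
  set I : Ideal (MvPolynomial (Fin (n + 1)) ℂ) := Ideal.span {F i, F j} with hI
  have hJI : A.singularIdeal.map (pullback F) ≤ I ^ 2 := by
    refine (Ideal.map_mono hsq).trans_eq ?_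
    rw [Ideal.map_pow, Ideal.map_span, Set.image_image, Set.image_pair, pullback_X, pullback_X]
  obtain ⟨x, hx, hFi, hFj, hxc⟩ := exists_isCriticalPoint_of_zero hF hpos hmn h0 hij hd
  have hker : (RingHom.ker (eval x)).IsPrime := RingHom.ker_isPrime _
  have hIx : I ≤ RingHom.ker (eval x) := by
    refine Ideal.span_le.2 ?_
    rintro f (rfl | hf)
    · exact hFi
    · rw [Set.mem_singleton_iff.1 hf]; exact hFj
  -- A component, through the critical point `x`, of the common zeros of `F i` and `F j`. By
  -- `exists_not_critical` it also has noncritical points.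
  obtain ⟨P, hP, hPx⟩ := Ideal.exists_minimalPrimes_le hIx
  have hPprime := hP.1.1
  have hIP : I ≤ P := hP.1.2
  have hP2 : P.height ≤ 2 := by
    classical
    have : P ∈ (Ideal.span (({F i, F j} : Finset (MvPolynomial (Fin (n + 1)) ℂ)) :
      Set (MvPolynomial (Fin (n + 1)) ℂ))).minimalPrimes := by simpa [hI] using hP
    refine (Ideal.height_le_card_of_mem_minimalPrimes_span_finset this).trans ?_
    exact_mod_cast Finset.card_le_two
  have hJ1 := hJ.map_of_flat _ hflat
  have hJP : A.singularIdeal.map (pullback F) ≤ P :=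
    hJI.trans ((Ideal.pow_le_self two_ne_zero).trans hIP)
  obtain ⟨x', hx', hxc'⟩ := exists_not_critical hmn hn hA hflat hJ1 hred P hP2 hJP
  obtain ⟨s, hs, hsJ, -⟩ := exists_eval_eq_one_of_not_critical hA hxc'
  have hsP : s ∉ P := fun h => by
    have := hx' s h
    rw [hs] at this
    exact one_ne_zero this
  -- Near the generic point of `P` the ideals `J(ω)` and the extension of `J(α)` agree, so by height
  -- `P` is minimal over `J(ω)`.
  obtain ⟨t, htP, ht⟩ := exists_mul_mem_radical (pullbackForm F A).singularIdeal P P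
    fun Q hQ hJQ hQP => by
      have hle : A.singularIdeal.map (pullback F) ≤ Q := fun f hf =>
        (hQ.mem_or_mem (hJQ (hsJ f hf))).resolve_left fun h => hsP (hQP h)
      by_contra hne
      have h1 := Ideal.height_add_one_le_of_lt_of_isPrime
        (lt_of_le_of_ne hQP fun h => hne h.ge)
      have h2 := ((add_le_add_left (hJ1 Q hQ hle) 1).trans h1).trans hP2
      norm_cast at h2
  -- Reducedness at `x` puts `P`, localised at `P`, in `J(ω)` and hence in the square of `(F i, F
  -- j)`.
  have key : ∀ f ∈ P, ∃ τ, τ ∉ P ∧ τ * f ∈ I ^ 2 := fun f hf => by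
    obtain ⟨t', ht', htf⟩ := (hred x hx hxc).exists_mul_mem (ht f hf)
    refine ⟨t' * t, fun h => ?_, ?_⟩
    · rcases hPprime.mem_or_mem h with h | h
      · exact ht' (hPx h)
      · exact htP h
    · rw [mul_assoc]
      exact hJI (singularIdeal_pullbackForm_le F A htf)
  obtain ⟨τ₁, hτ₁, h₁⟩ := key _ (hIP (Ideal.subset_span (by simp : F i ∈ ({F i, F j} : Set _))))
  obtain ⟨τ₂, hτ₂, h₂⟩ := key _ (hIP (Ideal.subset_span (by simp : F j ∈ ({F i, F j} : Set _))))
  obtain ⟨u₁, hu₁, v₁, hv₁, e₁⟩ := exists_eq_add_of_mem_span_pair_sq h₁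
  obtain ⟨u₂, hu₂, v₂, hv₂, e₂⟩ := exists_eq_add_of_mem_span_pair_sq h₂
  have hFi0 : F i ≠ 0 := by
    rw [← pullback_X F i]
    exact (map_ne_zero_iff _ (pullback_injective hflat)).2 (X_ne_zero i)
  -- Nakayama's lemma as a determinant trick: locally at `P` the nonzero ideal `(F i, F j) ⊆ P`
  -- would equal its own square.
  have := mem_prime_of_smul_eq_sum P ![F i, F j] (i₀ := 0) hFi0 (τ₁ * τ₂)
    !![τ₂ * u₁, τ₂ * v₁; τ₁ * u₂, τ₁ * v₂]
    (by
      intro a b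
      fin_cases a <;> fin_cases b
      · exact Ideal.mul_mem_left _ _ (hIP hu₁)
      · exact Ideal.mul_mem_left _ _ (hIP hv₁)
      · exact Ideal.mul_mem_left _ _ (hIP hu₂)
      · exact Ideal.mul_mem_left _ _ (hIP hv₂))
    (by
      intro a
      fin_cases a
      · simp [Fin.sum_univ_two]
        linear_combination τ₂ * e₁
      · simp [Fin.sum_univ_two]
        linear_combination τ₁ * e₂)
  rcases hPprime.mem_or_mem this with h | h
  · exact hτ₁ h
  · exact hτ₂ h

end

end ToricKupka

theorem proposition5p21 {m n : ℕ} (hmn : m ≤ n)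
    (X : ToricKupka.CompleteSimplicialFan 2 m) (D : X.Cl)
    (A : ToricKupka.OneForm (Fin m)) (hA : ToricKupka.IsFoliationForm X D A)
    (e : Fin m → ℕ) (F : Fin m → MvPolynomial (Fin (n + 1)) ℂ)
    (hF : ToricKupka.IsLifting X e F)
    (hgen : ToricKupka.IsAlmostGeneric X F A)
    (hflat : (ToricKupka.pullback F).Flat) :
    (ToricKupka.pullbackForm F A).kupkaIdeal = Ideal.map (ToricKupka.pullback F) A.kupkaIdeal := by
  have hJ := X.heightGE_of_saturation hgen.codim
  have hpos := hF.pos hflat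
  have hn : 2 ≤ n := by
    have := X.two_lt_card hF.relation hpos
    omega
  refine le_antisymm
    (ToricKupka.kupkaIdeal_pullbackForm_le hmn hn hA hflat hJ hgen.reduced) ?_
  -- Reducedness concerns points of projective space and says nothing at the vertex of the cone. A
  -- critical vertex therefore needs the global identity `g dα = β ∧ α`.
  by_cases h0 : ToricKupka.IsCriticalPoint X F 0
  · obtain ⟨w, hw⟩ := hA.exists_detLeft_eq
    obtain ⟨ζ, B, ℓ, hB, hζ, hAB, hG⟩ := ToricKupka.exists_block_isRowSystem hJ hw
    exact ToricKupka.map_kupkaIdeal_le_of_exists_eq F fun g hg =>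
      ToricKupka.exists_eq_wedge_of_mem_kupkaIdeal hA hw hB hζ hAB
        (fun i j hij hd => ToricKupka.not_le_span_X_pair_of_critical_zero hmn hn hA hF hpos hflat
          hJ hgen.reduced h0 hw hAB hij hd (hG i j hij hd)) hg
  · exact ToricKupka.map_kupkaIdeal_le_of_not_critical_zero hA hgen.reduced h0
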